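/- Let $2\le k<N$, let $V$ be a complex vector space of dimension $2N$ with a non-degenerate alternating form $\omega$, and let $E\subset V$ be a $k$-dimensional isotropic subspace, $E\subseteq E^\perp$. Let $P\subset \mathrm{Sp}(V,\omega)$ be the stabilizer of $E$ (the $k$-th maximal parabolic subgroup), let $\mathfrak p\subset\mathfrak{sp}(V,\omega)$ be the Lie subalgebra of the elements $X$ with $XE\subseteq E$, and let $P$ act on $\mathfrak{sp}(V,\omega)/\mathfrak p\;(\simeq \mathrm{Sym}^2E^\vee\oplus (E^\vee\otimes E^\perp/E))$ by the adjoint action. The class of $X\in\mathfrak{sp}(V,\omega)$ determines the symmetric bilinear form $\sigma(x,y)=\omega(Xx,y)$ on $E$ and, on the radical $\ker\sigma\subseteq E$, the linear map $H\colon\ker\sigma\to E^\perp/E$, $x\mapsto Xx \bmod E$. Let $\omega'$ be the symplectic form induced by $\omega$ on $E^\perp/E$, and let $\mathcal O_{(r,h,t)}\subset\mathfrak{sp}(V,\omega)/\mathfrak p$ be the set of all classes with $$r=\operatorname{rk}\sigma,\qquad h=\operatorname{rk}H,\qquad t=h-\operatorname{rk}\bigl(\omega'|_{\operatorname{im}H}\bigr).$$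 Let $r,h,t\ge 0$ be integers with $r+h\le k$, $t\le h$, $t\equiv h \pmod 2$ and $h+t\le 2N-2k$. Then $\mathcal O_{(r,h,t)}$ is a (non-empty) $P$-orbit, and its dimension (the dimension of its Zariski closure) is $$\dim\mathcal O_{(r,h,t)}=\frac{r(r+1)}2+(r+h)(2N-k-r)+\frac{t(t+1)}2-h^2-t^2 .$$ -/

import Mathlib

open LinearMap (BilinForm)

noncomputable section

/-! ### Dimension of a subset of an affine space -/

/-- The coordinate ring `ℂ[Y]` of a subset `Y` of a complex vector space `M`: the algebra of
functions on `Y` that are restrictions of polynomial functions on `M`, i.e. the subalgebra of all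
functions `Y → ℂ` generated by the restrictions of linear functionals. If `M` has finite dimension,
then it is the polynomial ring of `M` modulo the ideal of polynomials that vanish on `Y`. -/
def coordinateRing {M : Type*} [AddCommGroup M] [Module ℂ M] (Y : Set M) : Subalgebra ℂ (Y → ℂ) :=
  Algebra.adjoin ℂ (Set.range fun (l : Module.Dual ℂ M) (y : Y) => l y)

/-- The dimension of a (locally closed) subset `Y` of an affine space: the dimension of its Zariski
closure, i.e. the Krull dimension of the coordinate ring of `Y`. It is `⊥` if `Y` is empty. -/
def varietyDim {M : Type*} [AddCommGroup M] [Module ℂ M] (Y : Set M) : WithBot ℕ∞ :=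
  ringKrullDim (coordinateRing Y)

section Symplectic

attribute [local instance] LieRing.ofAssociativeRing

variable {V : Type*} [AddCommGroup V] [Module ℂ V]

/-! ### The parabolic subgroup, its Lie algebra, and the adjoint action on the quotient -/

/-- The symplectic Lie algebra `𝔰𝔭(V)`: endomorphisms `X` with `ω (X x) y = - ω x (X y)`. -/
abbrev spAlgebra (ω : BilinForm ℂ V) : LieSubalgebra ℂ (Module.End ℂ V) :=
  skewAdjointLieSubalgebra ω

/-- The parabolic subgroup `P`: the stabilizer of `E` in the symplectic group of `(V, ω)`. -/
def parabolic (ω : BilinForm ℂ V) (E : Submodule ℂ V) : Subgroup (V ≃ₗ[ℂ] V) where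
  carrier := {g | (∀ x y, ω (g x) (g y) = ω x y) ∧ ∀ x, g x ∈ E ↔ x ∈ E}
  one_mem' := ⟨fun _ _ => rfl, fun _ => Iff.rfl⟩
  mul_mem' := fun {a b} ha hb =>
    ⟨fun x y => (ha.1 (b x) (b y)).trans (hb.1 x y), fun x => (ha.2 (b x)).trans (hb.2 x)⟩
  inv_mem' := fun {a} ha => by
    have key : ∀ x, a (a⁻¹ x) = x := fun x => a.apply_symm_apply x
    refine ⟨fun x y => ?_, fun x => ?_⟩
    · rw [← ha.1 (a⁻¹ x) (a⁻¹ y), key, key]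
    · rw [← ha.2 (a⁻¹ x), key]

/-- The parabolic subalgebra `𝔭`: the stabilizer of `E` in `𝔰𝔭(V)`. -/
def parabolicAlgebra (ω : BilinForm ℂ V) (E : Submodule ℂ V) : LieSubalgebra ℂ (spAlgebra ω) where
  carrier := {X | ∀ x ∈ E, (X : Module.End ℂ V) x ∈ E}
  add_mem' := fun {_ _} hX hY x hx => E.add_mem (hX x hx) (hY x hx)
  zero_mem' := fun _ _ => E.zero_mem
  smul_mem' := fun c _ hX x hx => E.smul_mem c (hX x hx)
  lie_mem' := fun {_ _} hX hY x hx => E.sub_mem (hX _ (hY x hx)) (hY _ (hX x hx))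

/-- The quotient `𝔰𝔭(V) / 𝔭`, the tangent space at `E` of the isotropic Grassmannian. -/
abbrev tangentQuotient (ω : BilinForm ℂ V) (E : Submodule ℂ V) : Type _ :=
  spAlgebra ω ⧸ (parabolicAlgebra ω E).toSubmodule

/-- The adjoint action `X ↦ g X g⁻¹` of an element of `P` on `𝔰𝔭(V)`. -/
def adjointMap (ω : BilinForm ℂ V) (E : Submodule ℂ V) (g : parabolic ω E) :
    spAlgebra ω →ₗ[ℂ] spAlgebra ω :=
  ((LinearEquiv.conj (g : V ≃ₗ[ℂ] V)).toLinearMap ∘ₗ (spAlgebra ω).toSubmodule.subtype).codRestrict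
    (spAlgebra ω).toSubmodule <| by
      rintro ⟨X, hX⟩
      have hX' : ∀ x y, ω (X x) y = ω x ((-X) y) := (ω.mem_skewAdjointSubmodule X).1 hX
      have hg : ∀ x y, ω ((g : V ≃ₗ[ℂ] V) x) ((g : V ≃ₗ[ℂ] V) y) = ω x y := g.2.1
      refine (ω.mem_skewAdjointSubmodule _).2 ?_
      change ∀ x y, ω ((g : V ≃ₗ[ℂ] V) (X ((g : V ≃ₗ[ℂ] V).symm x))) y =
        ω x (-((g : V ≃ₗ[ℂ] V) (X ((g : V ≃ₗ[ℂ] V).symm y))))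
      intro x y
      obtain ⟨x, rfl⟩ := (g : V ≃ₗ[ℂ] V).surjective x
      obtain ⟨y, rfl⟩ := (g : V ≃ₗ[ℂ] V).surjective y
      rw [LinearEquiv.symm_apply_apply, LinearEquiv.symm_apply_apply, ← map_neg, hg, hg, hX']
      rfl

/-- The adjoint action of `P` on `𝔰𝔭(V) / 𝔭`, sending the class of `X` to that of `g X g⁻¹`. -/
def adjointQuotient (ω : BilinForm ℂ V) (E : Submodule ℂ V) (g : parabolic ω E) :
    tangentQuotient ω E →ₗ[ℂ] tangentQuotient ω E :=
  (parabolicAlgebra ω E).toSubmodule.mapQ (parabolicAlgebra ω E).toSubmodule (adjointMap ω E g) <| by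
    intro X hX x hx
    change (g : V ≃ₗ[ℂ] V) ((X : Module.End ℂ V) ((g : V ≃ₗ[ℂ] V).symm x)) ∈ E
    refine (g.2.2 _).2 (hX _ ((g.2.2 _).1 ?_))
    rwa [LinearEquiv.apply_symm_apply]

/-- The `P`-orbit of a point of `𝔰𝔭(V) / 𝔭`. -/
def parabolicOrbit (ω : BilinForm ℂ V) (E : Submodule ℂ V) (q : tangentQuotient ω E) :
    Set (tangentQuotient ω E) :=
  Set.range fun g : parabolic ω E => adjointQuotient ω E g q

/-! ### The invariants `r`, `h`, `t` -/

/-- The quotient `E^⊥ / E` (for an isotropic subspace `E`). -/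
abbrev perpQuotient (ω : BilinForm ℂ V) (E : Submodule ℂ V) : Type _ :=
  ω.orthogonal E ⧸ E.submoduleOf (ω.orthogonal E)

/-- The form `ω'` induced by `ω` on `E^⊥ / E`. -/
def reducedForm (ω : BilinForm ℂ V) (hω : ω.IsAlt) (E : Submodule ℂ V) :
    BilinForm ℂ (perpQuotient ω E) :=
  LinearMap.liftQ₂ (E.submoduleOf (ω.orthogonal E)) (E.submoduleOf (ω.orthogonal E))
    (ω.restrict (ω.orthogonal E))
    (fun x hx => LinearMap.ext fun y => y.2 x hx)
    (fun y hy => LinearMap.ext fun x => hω.isRefl _ _ (x.2 y hy))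

/-- The `Sym² E^∨`-component `σ` of (the class of) `X`: the form `σ(x, y) = ω(X x, y)` on `E`, which
is symmetric because `X ∈ 𝔰𝔭(V)`. -/
def symPart (ω : BilinForm ℂ V) (E : Submodule ℂ V) (X : spAlgebra ω) : BilinForm ℂ E :=
  ω.compl₁₂ ((X : Module.End ℂ V) ∘ₗ E.subtype) E.subtype

/-- The restriction of the `E^∨ ⊗ E^⊥/E`-component `H` of (the class of) `X` to the quotient of `E`
by the support of `σ`, that is, to the radical of `σ`: the linear map
`ker σ → E^⊥ / E, x ↦ X x mod E`. -/
def mixedPart (ω : BilinForm ℂ V) (hω : ω.IsAlt) (E : Submodule ℂ V) (X : spAlgebra ω) :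
    LinearMap.ker (symPart ω E X) →ₗ[ℂ] perpQuotient ω E :=
  (E.submoduleOf (ω.orthogonal E)).mkQ ∘ₗ
    LinearMap.codRestrict (ω.orthogonal E)
      ((X : Module.End ℂ V) ∘ₗ E.subtype ∘ₗ (LinearMap.ker (symPart ω E X)).subtype)
      (fun x y hy => hω.isRefl _ _ (LinearMap.congr_fun (LinearMap.mem_ker.1 x.2) ⟨y, hy⟩))

/-- The set `𝒪_(r,h,t)` of those classes `σ + H` in `𝔰𝔭(V) / 𝔭` for which `r = rk σ`, `h` is the rank
of the restriction of `H` to the radical of `σ`, and `t = h - rk (ω' restricted to the image of that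
restriction)`. The conditions do not depend on the representative `X` if `E` is isotropic. -/
def orbitSet (ω : BilinForm ℂ V) (hω : ω.IsAlt) (E : Submodule ℂ V) (r h t : ℕ) :
    Set (tangentQuotient ω E) :=
  {q | ∃ X : spAlgebra ω, (parabolicAlgebra ω E).toSubmodule.mkQ X = q ∧
    Module.finrank ℂ (LinearMap.range (symPart ω E X)) = r ∧
    Module.finrank ℂ (LinearMap.range (mixedPart ω hω E X)) = h ∧
    t + Module.finrank ℂ (LinearMap.range
      ((reducedForm ω hω E).restrict (LinearMap.range (mixedPart ω hω E X)))) = h}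

end Symplectic

end

/-!
A class in `𝔰𝔭(V) / 𝔭` is the same thing as a symmetric form `σ` on `E` together with a linear map
`E → E^⊥/E`, once a complement is chosen. Concretely, an adapted basis of `V` (`AdaptedBasis`: a
basis `e` of `E`, an isotropic dual family `d`, and a basis `f` of a lift of `E^⊥/E` orthogonal to
both) identifies the quotient with the pairs of matrices `(σ, H)` with `σ` symmetric, and by
`AdaptedBasis.mem_orbitSet_iff` the invariants `(r, h, t)` can be read off from these matrices.

*One orbit.* The group `P` acts simply transitively on adapted bases, so two classes are conjugate
as soon as they have the same matrices in suitable adapted bases. `exists_normal_form` provides such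
a basis for every class with invariants `(r, h, t)`: the basis `e` consists of an orthonormal family
for `σ`, spanning a complement of its radical, and of vectors in the radical that `H` maps to members of
a Darboux basis of `E^⊥/E` or to `0`. The image of the radical under `H` is a subspace on which the form
has a radical of dimension `t`, and the Darboux basis is adapted to these two subspaces
(`exists_darboux_adapted`). Choosing the images of the orthonormal family, modulo `E`, as the
corresponding dual vectors makes the component of the class in `Hom(E, E^⊥/E)` vanish on that family.

*The dimension.* In matrix coordinates the set is described by an explicit polynomial chart. Write
`h = 2 s + t`. A symmetric matrix of rank `r` with invertible leading block `A` is determined by `A`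
and a matrix `B` (`symChart`). On the radical of `σ`, the map `H` is given by a matrix whose row space
`U` has dimension `2 s + t` and a radical of dimension `t`. If the radical of `U` projects isomorphically
to the first half of `t` hyperbolic pairs, it has a unique basis dual to these coordinates, described
by a matrix `X` and a symmetric matrix `S`; the vectors of `U` with vanishing first coordinates form a
complement of the radical, described by a matrix `C`; and the remaining parameters are the coefficients
of the rows in these vectors (`mixChart`). The rows of `H` that belong to the block `A` are arbitrary
(`rowChart`). The domain of the chart is given by the nonvanishing of a
polynomial (`chartPoly`). The normal form lies in the domain, so every point of the orbit lies in the
domain of the chart of some adapted basis, and the dimension is at most the number of parameters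
(`varietyDim_orbitSet_le`). Conversely the differential of the chart at the normal form is injective,
so it is at least that number (`le_varietyDim_orbitSet`).

Both bounds rest on two facts on the Krull dimension of a finitely generated algebra over a field: it
is at least the size of any algebraically independent family, and it is the size of some such family,
by Noether normalization.
-/

noncomputable section

attribute [local instance] LieRing.ofAssociativeRing

/-! ### Dimension and algebraic independence -/

/-- By incomparability, chains of primes in an integral extension contract to chains of primes. -/
theorem ringKrullDim_le_of_integral {R S : Type*} [CommRing R] [CommRing S] (f : R →+* S)
    (hf : f.IsIntegral) : ringKrullDim S ≤ ringKrullDim R := by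
  algebraize [f]
  refine Order.krullDim_le_of_strictMono (PrimeSpectrum.comap (algebraMap R S)) fun I J hIJ => ?_
  exact Ideal.IsIntegral.comap_lt_comap (R := R) (I := I.asIdeal) (J := J.asIdeal) hIJ

/-- By lying over and going up, chains of primes lift to an integral extension. -/
theorem ringKrullDim_le_of_injective_of_integral {R S : Type*} [CommRing R] [CommRing S]
    (f : R →+* S) (hinj : Function.Injective f) (hf : f.IsIntegral) :
    ringKrullDim R ≤ ringKrullDim S := by
  algebraize [f]
  refine iSup_le fun l => ?_
  obtain ⟨Q, -, hQ, hQl⟩ := Ideal.exists_ideal_over_prime_of_isIntegral (S := S) l.head.asIdeal ⊥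
    (by
      rw [← RingHom.ker_eq_comap_bot, (RingHom.injective_iff_ker_eq_bot (algebraMap R S)).1 hinj]
      exact bot_le)
  have : Q.LiesOver l.head.asIdeal := ⟨hQl.symm⟩
  obtain ⟨L, hL, -⟩ := Ideal.exists_ltSeries_of_hasGoingUp (S := S) l Q
  rw [← hL]
  exact Order.LTSeries.length_le_krullDim L

/-- Algebraically independent elements bound the Krull dimension of a finitely generated algebra
from below. The algebra need not be a domain: it is replaced by its quotient by a prime that meets
the polynomial ring in these elements only in `0`. -/
theorem AlgebraicIndependent.natCast_le_ringKrullDim {F A : Type*} [Field F] [CommRing A]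
    [Algebra F A] [Algebra.FiniteType F A] {n : ℕ} {x : Fin n → A}
    (hx : AlgebraicIndependent F x) : (n : WithBot ℕ∞) ≤ ringKrullDim A := by
  let φ : MvPolynomial (Fin n) F →ₐ[F] A := MvPolynomial.aeval x
  have hφ : Function.Injective φ := hx
  obtain ⟨p, hp, -, hdis⟩ := Ideal.exists_le_prime_disjoint (⊥ : Ideal A)
    (Submonoid.map φ (nonZeroDivisors _)) (by
      rw [Set.disjoint_left]
      rintro a ha ⟨q, hq, rfl⟩
      have : q = 0 := hφ (by simpa using ha)
      exact nonZeroDivisors.ne_zero hq this)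
  have hx' : AlgebraicIndependent F (fun i => Ideal.Quotient.mk p (x i)) := by
    refine (injective_iff_map_eq_zero (MvPolynomial.aeval _)).2 fun q hq => ?_
    by_contra hne
    have e : (MvPolynomial.aeval fun i => Ideal.Quotient.mk p (x i)) q
        = Ideal.Quotient.mkₐ F p (φ q) := by
      change _ = ((Ideal.Quotient.mkₐ F p).comp φ) q
      congr 1
      ext i
      simp [φ]
    rw [e, Ideal.Quotient.mkₐ_eq_mk, Ideal.Quotient.eq_zero_iff_mem] at hq
    exact Set.disjoint_left.1 hdis hq ⟨q, mem_nonZeroDivisors_of_ne_zero hne, rfl⟩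
  have : Algebra.FiniteType F (A ⧸ p) :=
    Algebra.FiniteType.of_surjective (Ideal.Quotient.mkₐ F p) Ideal.Quotient.mk_surjective
  obtain ⟨s, g, hg, hi⟩ := exists_integral_inj_algHom_of_fg F (A ⧸ p)
  have hadj : Algebra.adjoin F (Set.range fun i => g (MvPolynomial.X i)) = g.range := by
    rw [← Algebra.map_top, ← MvPolynomial.adjoin_range_X, AlgHom.map_adjoin, ← Set.range_comp]
    rfl
  have halg : Algebra.IsAlgebraic
      (Algebra.adjoin F (Set.range fun i => g (MvPolynomial.X i))) (A ⧸ p) := by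
    rw [hadj]
    have : Algebra.IsIntegral g.range (A ⧸ p) := ⟨fun a => by
      obtain ⟨q, hq, hqa⟩ := hi a
      refine ⟨q.map g.rangeRestrict.toRingHom, hq.map _, ?_⟩
      rw [Polynomial.eval₂_map]
      exact hqa⟩
    infer_instance
  have h1 := hx'.lift_cardinalMk_le_trdeg
  have h2 := Algebra.IsAlgebraic.trdeg_le_cardinalMk F
    (Set.range fun i => g (MvPolynomial.X i : MvPolynomial (Fin s) F))
  have h3 := Cardinal.mk_range_le_lift (f := fun i => g (MvPolynomial.X i : MvPolynomial (Fin s) F))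
  simp only [Cardinal.mk_fin, Cardinal.lift_natCast] at h1 h3
  have h4 := h1.trans ((Cardinal.lift_le.2 h2).trans h3)
  have h5 : n ≤ s := by exact_mod_cast h4
  calc (n : WithBot ℕ∞) ≤ s := by exact_mod_cast h5
    _ = ringKrullDim (MvPolynomial (Fin s) F) := by
      rw [MvPolynomial.ringKrullDim_of_isNoetherianRing]; simp
    _ ≤ ringKrullDim (A ⧸ p) := ringKrullDim_le_of_injective_of_integral g.toRingHom hg hi
    _ ≤ ringKrullDim A := ringKrullDim_quotient_le p

/-- By Noether normalization, the Krull dimension of a finitely generated algebra over a field is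
the size of some algebraically independent family. -/
theorem ringKrullDim_le_of_algebraicIndependent_le {F A : Type*} [Field F] [CommRing A]
    [Nontrivial A] [Algebra F A] [Algebra.FiniteType F A] {d : ℕ}
    (H : ∀ (n : ℕ) (x : Fin n → A), AlgebraicIndependent F x → n ≤ d) :
    ringKrullDim A ≤ d := by
  obtain ⟨s, g, hg, hi⟩ := exists_integral_inj_algHom_of_fg F A
  refine (ringKrullDim_le_of_integral g.toRingHom hi).trans ?_
  rw [MvPolynomial.ringKrullDim_of_isNoetherianRing]
  have := H s (fun i => g (MvPolynomial.X i)) ((MvPolynomial.algebraicIndependent_X _ _).map' hg)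
  simpa using this

/-! ### Polynomial functions and polynomial parametrizations -/

/-- The algebra of polynomial functions on a complex vector space. -/
def polyFun (W : Type*) [AddCommGroup W] [Module ℂ W] : Subalgebra ℂ (W → ℂ) :=
  Algebra.adjoin ℂ (Set.range fun (l : Module.Dual ℂ W) (x : W) => l x)

section PolyFun

variable {W M : Type*} [AddCommGroup W] [Module ℂ W] [AddCommGroup M] [Module ℂ M]

theorem dual_mem_polyFun (l : Module.Dual ℂ W) : (fun x => l x) ∈ polyFun W :=
  Algebra.subset_adjoin ⟨l, rfl⟩

theorem const_mem_polyFun (c : ℂ) : (fun _ : W => c) ∈ polyFun W :=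
  (polyFun W).algebraMap_mem c

theorem polyFun_sum {ι : Type*} (s : Finset ι) {f : ι → W → ℂ} (h : ∀ i ∈ s, f i ∈ polyFun W) :
    (fun x => ∑ i ∈ s, f i x) ∈ polyFun W := by
  have := (polyFun W).sum_mem h
  convert this using 1
  ext x
  simp

theorem polyFun_prod {ι : Type*} (s : Finset ι) {f : ι → W → ℂ} (h : ∀ i ∈ s, f i ∈ polyFun W) :
    (fun x => ∏ i ∈ s, f i x) ∈ polyFun W := by
  have := (polyFun W).prod_mem h
  convert this using 1
  ext x
  simp

theorem polyFun_det {n : Type*} [Fintype n] [DecidableEq n] {A : W → Matrix n n ℂ}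
    (h : ∀ i j, (fun x => A x i j) ∈ polyFun W) : (fun x => (A x).det) ∈ polyFun W := by
  simp only [Matrix.det_apply']
  exact polyFun_sum _ fun σ _ => (polyFun W).mul_mem (const_mem_polyFun _)
    (polyFun_prod _ fun i _ => h _ _)

theorem polyFun_adjugate {n : Type*} [Fintype n] [DecidableEq n] {A : W → Matrix n n ℂ}
    (h : ∀ i j, (fun x => A x i j) ∈ polyFun W) (i j : n) :
    (fun x => (A x).adjugate i j) ∈ polyFun W := by
  simp only [Matrix.adjugate_apply]
  refine polyFun_det fun k l => ?_
  by_cases hk : k = j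
  · subst hk
    simpa using const_mem_polyFun _
  · simpa [Matrix.updateRow_ne hk] using h k l

theorem polyFun_comp {ψ : W → M} (hψ : ∀ l : Module.Dual ℂ M, (fun x => l (ψ x)) ∈ polyFun W)
    {f : M → ℂ} (hf : f ∈ polyFun M) : (fun x => f (ψ x)) ∈ polyFun W := by
  refine Algebra.adjoin_induction (p := fun f _ => (fun x => f (ψ x)) ∈ polyFun W) ?_ ?_ ?_ ?_ hf
  · rintro _ ⟨l, rfl⟩
    exact hψ l
  · exact fun c => const_mem_polyFun c
  · exact fun f g _ _ hf hg => (polyFun W).add_mem hf hg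
  · exact fun f g _ _ hf hg => (polyFun W).mul_mem hf hg

/-- Restriction of functions to a subset, as a homomorphism of algebras. -/
def restrictAlgHom (Y : Set M) : (M → ℂ) →ₐ[ℂ] (Y → ℂ) :=
  AlgHom.pi fun y => Pi.evalAlgHom ℂ _ (y : M)

theorem coordinateRing_eq_map (Y : Set M) :
    coordinateRing Y = (polyFun M).map (restrictAlgHom Y) := by
  rw [polyFun, AlgHom.map_adjoin, ← Set.range_comp]
  rfl

theorem polyFun_eq_range {ι : Type*} [Finite ι] (b : Module.Basis ι ℂ W) :
    polyFun W = (MvPolynomial.aeval (R := ℂ) fun (i : ι) (x : W) => b.coord i x).range := by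
  cases nonempty_fintype ι
  rw [← Algebra.adjoin_range_eq_range_aeval]
  refine le_antisymm (Algebra.adjoin_le ?_) (Algebra.adjoin_mono ?_)
  · rintro _ ⟨l, rfl⟩
    have : (fun x => l x) = ∑ i, l (b i) • fun x => b.coord i x := by
      ext x
      conv_lhs => rw [← b.sum_repr x, map_sum]
      simp only [map_smul, smul_eq_mul, Finset.sum_apply, Pi.smul_apply, Module.Basis.coord_apply]
      exact Finset.sum_congr rfl fun i _ => mul_comm _ _
    change (fun x => l x) ∈ _
    rw [this]
    exact Subalgebra.sum_mem _ fun i _ =>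
      Subalgebra.smul_mem _ (Algebra.subset_adjoin (Set.mem_range_self i)) _
  · rintro _ ⟨i, rfl⟩
    exact ⟨b.coord i, rfl⟩

theorem polyFun_finiteType [FiniteDimensional ℂ W] : Algebra.FiniteType ℂ (polyFun W) := by
  rw [polyFun_eq_range (Module.finBasis ℂ W)]
  exact Algebra.FiniteType.of_surjective (AlgHom.rangeRestrict _) (AlgHom.rangeRestrict_surjective _)

theorem coordinateRing_finiteType [FiniteDimensional ℂ M] (Y : Set M) :
    Algebra.FiniteType ℂ (coordinateRing Y) := by
  have := polyFun_finiteType (W := M)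
  rw [coordinateRing_eq_map, ← Subalgebra.fg_iff_finiteType]
  exact ((Subalgebra.fg_iff_finiteType _).2 this).map _

/-- More polynomial functions than the dimension of the space are algebraically dependent. -/
theorem polyFun_exists_relation [FiniteDimensional ℂ W] {n : ℕ} (hn : Module.finrank ℂ W < n)
    {p : Fin n → W → ℂ} (hp : ∀ i, p i ∈ polyFun W) :
    ∃ Q : MvPolynomial (Fin n) ℂ, Q ≠ 0 ∧ ∀ x, MvPolynomial.eval (fun i => p i x) Q = 0 := by
  by_contra! hcon
  let b := Module.finBasis ℂ W
  choose q hq using fun i => (polyFun_eq_range b ▸ hp i : p i ∈ AlgHom.range _)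
  have hind : AlgebraicIndependent ℂ q := by
    refine (injective_iff_map_eq_zero (MvPolynomial.aeval (R := ℂ) q)).2 fun Q hQ => ?_
    by_contra hne
    obtain ⟨x, hx⟩ := hcon Q hne
    apply hx
    have e : (fun i => p i x) = fun i => MvPolynomial.aeval (fun i => b.coord i x) (q i) := by
      ext i
      rw [← hq i]
      have := MvPolynomial.comp_aeval (R := ℂ) (fun (i : Fin _) (x : W) => b.coord i x)
        (Pi.evalAlgHom ℂ (fun _ : W => ℂ) x)
      exact DFunLike.congr_fun this (q i)
    rw [e, ← MvPolynomial.aeval_eq_eval]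
    have := MvPolynomial.comp_aeval (R := ℂ) q
      (MvPolynomial.aeval (R := ℂ) (fun i => b.coord i x))
    change MvPolynomial.aeval _ Q = 0
    rw [← this, AlgHom.comp_apply, hQ, map_zero]
  have := hind.lift_cardinalMk_le_trdeg
  simp at this
  omega

/-- If a set is covered by images of polynomial maps from a space `W`, each of which contains a
nonempty Zariski open part of the set, then its dimension is at most that of `W`. -/
theorem varietyDim_le_of_parametrization [FiniteDimensional ℂ W] [FiniteDimensional ℂ M]
    {Y : Set M} (hY : Y.Nonempty)
    (H : ∀ y ∈ Y, ∃ f ∈ polyFun M, f y ≠ 0 ∧ ∃ ψ : W → M,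
      (∀ l : Module.Dual ℂ M, (fun x => l (ψ x)) ∈ polyFun W) ∧
      ∀ z ∈ Y, f z ≠ 0 → z ∈ Set.range ψ) :
    varietyDim Y ≤ Module.finrank ℂ W := by
  have := coordinateRing_finiteType Y
  have : Nonempty Y := hY.to_subtype
  refine ringKrullDim_le_of_algebraicIndependent_le (F := ℂ) (A := coordinateRing Y) fun n x hx => ?_
  by_contra! hn
  have hx' : ∀ i, ∃ p ∈ polyFun M, restrictAlgHom Y p = x i := fun i =>
    (coordinateRing_eq_map Y).le (x i).2
  choose p hp hpx using hx'
  have hpx' : ∀ i (y : Y), (x i : Y → ℂ) y = p i y := fun i y => (congrFun (hpx i) y).symm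
  choose! f hf hfy ψ hψ hYψ using H
  -- finitely many of the open sets `f y ≠ 0` cover `Y`
  have := polyFun_finiteType (W := M)
  have : IsNoetherianRing (polyFun M) := Algebra.FiniteType.isNoetherianRing ℂ _
  let F : Y → polyFun M := fun y => ⟨f y, hf y y.2⟩
  obtain ⟨t, ht, hspan⟩ := (Submodule.fg_span_iff_fg_span_finset_subset (R := polyFun M)
    (Set.range F)).1 (IsNoetherian.noetherian _)
  have hcov : ∀ y : Y, ∃ z : Y, F z ∈ t ∧ f z y ≠ 0 := by
    intro y
    by_contra! hcon
    have hle : Submodule.span (polyFun M) (t : Set (polyFun M)) ≤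
        RingHom.ker ((Pi.evalRingHom (fun _ : M => ℂ) (y : M)).comp (polyFun M).val.toRingHom) := by
      refine Submodule.span_le.2 fun g hg => ?_
      obtain ⟨z, rfl⟩ := ht hg
      exact hcon z hg
    have := hle (hspan ▸ Submodule.subset_span (Set.mem_range_self y))
    exact hfy y y.2 this
  have hrel : ∀ y : Y, ∃ Q : MvPolynomial (Fin n) ℂ, Q ≠ 0 ∧
      ∀ z : Y, f y z ≠ 0 → MvPolynomial.eval (fun i => p i z) Q = 0 := by
    intro y
    obtain ⟨Q, hQ, h⟩ := polyFun_exists_relation hn (fun i => polyFun_comp (hψ y y.2) (hp i))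
    refine ⟨Q, hQ, fun z hz => ?_⟩
    obtain ⟨w, hw⟩ := hYψ y y.2 z z.2 hz
    rw [← hw]
    exact h w
  choose Q hQ hQz using hrel
  choose z hzt hzf using hcov
  -- the product of the relations on the charts is a relation on `Y`
  choose! c hc using fun g (hg : g ∈ t) => ht hg
  have hprod : ∏ g ∈ t, Q (c g) ≠ 0 := Finset.prod_ne_zero_iff.2 fun g _ => hQ _
  refine hprod ((injective_iff_map_eq_zero (MvPolynomial.aeval (R := ℂ) x)).1 hx _ ?_)
  ext y
  have e : ((MvPolynomial.aeval x (∏ g ∈ t, Q (c g)) : coordinateRing Y) : Y → ℂ) y =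
      MvPolynomial.eval (fun i => p i y) (∏ g ∈ t, Q (c g)) := by
    have := MvPolynomial.comp_aeval (R := ℂ) x
      ((Pi.evalAlgHom ℂ (fun _ : Y => ℂ) y).comp (coordinateRing Y).val)
    have h2 := DFunLike.congr_fun this (∏ g ∈ t, Q (c g))
    rw [← MvPolynomial.aeval_eq_eval]
    refine h2.trans ?_
    congr 2
    ext i
    exact hpx' i y
  rw [e, map_prod]
  refine Finset.prod_eq_zero (hzt y) (hQz _ _ ?_)
  have : f (c (F (z y))) = f (z y) := congrArg Subtype.val (hc _ (hzt y))
  rw [this]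
  exact hzf y

theorem polyFun_contDiff {W : Type*} [NormedAddCommGroup W] [NormedSpace ℂ W]
    [FiniteDimensional ℂ W] {f : W → ℂ} (hf : f ∈ polyFun W) : ContDiff ℂ 1 f := by
  refine Algebra.adjoin_induction (p := fun f _ => ContDiff ℂ 1 f) ?_ ?_ ?_ ?_ hf
  · rintro _ ⟨l, rfl⟩
    exact (LinearMap.toContinuousLinearMap l).contDiff
  · exact fun c => contDiff_const
  · exact fun f g _ _ hf hg => hf.add hg
  · exact fun f g _ _ hf hg => hf.mul hg

/-- If a polynomial map from `W` sends a neighbourhood of `x₀` into `Y`, and its differential at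
`x₀` is injective, then `dim W ≤ dim Y`: by the inverse function theorem some projection of `Y` to
`W` has an interior point, so that no polynomial relation holds between its coordinates. -/
theorem le_varietyDim_of_injective_differential {W : Type*} [NormedAddCommGroup W]
    [NormedSpace ℂ W] [FiniteDimensional ℂ W] [FiniteDimensional ℂ M] {Y : Set M} {ψ : W → M}
    (hψ : ∀ l : Module.Dual ℂ M, (fun x => l (ψ x)) ∈ polyFun W) (x₀ : W)
    (hY : ∀ᶠ x in nhds x₀, ψ x ∈ Y)
    (hinj : ∀ v : W, (∀ l : Module.Dual ℂ M, HasDerivAt (fun s : ℂ => l (ψ (x₀ + s • v))) 0 0) →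
      v = 0) :
    (Module.finrank ℂ W : WithBot ℕ∞) ≤ varietyDim Y := by
  have : CompleteSpace W := FiniteDimensional.complete ℂ W
  let e := (Module.finBasis ℂ M).equivFun
  let Ψ : W → Fin (Module.finrank ℂ M) → ℂ := fun x => e (ψ x)
  have hΨ : ContDiff ℂ 1 Ψ := contDiff_pi.2 fun i =>
    polyFun_contDiff (hψ (LinearMap.proj i ∘ₗ e.toLinearMap))
  have hstrict := (hΨ.contDiffAt (x := x₀)).hasStrictFDerivAt one_ne_zero
  set D := fderiv ℂ Ψ x₀ with hD
  have hker : LinearMap.ker D.toLinearMap = ⊥ := by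
    refine LinearMap.ker_eq_bot'.2 fun v hv => hinj v fun l => ?_
    have hline : HasDerivAt (fun s : ℂ => x₀ + s • v) v 0 := by
      simpa using ((hasDerivAt_id (0 : ℂ)).smul_const v).const_add x₀
    have h1 : HasFDerivAt Ψ D (x₀ + (0 : ℂ) • v) := by simpa using hstrict.hasFDerivAt
    have h2 := h1.comp_hasDerivAt (0 : ℂ) hline
    have h3 := (LinearMap.toContinuousLinearMap (l ∘ₗ e.symm.toLinearMap)).hasFDerivAt.comp_hasDerivAt
      (0 : ℂ) h2
    have hv' : D v = 0 := hv
    rw [hv', map_zero] at h3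
    refine h3.congr_of_eventuallyEq (Filter.Eventually.of_forall fun s => ?_)
    simp [Ψ]
  obtain ⟨p, hp⟩ := LinearMap.exists_leftInverse_of_injective D.toLinearMap hker
  let P := LinearMap.toContinuousLinearMap p
  have hPD : P.comp D = ContinuousLinearMap.id ℂ W := by
    ext v
    exact LinearMap.congr_fun hp v
  have hs := P.hasStrictFDerivAt.comp x₀ hstrict
  rw [hPD] at hs
  have hnhds := hs.map_nhds_eq_of_surj (by simp)
  have himg : (fun x => P (Ψ x)) '' {x | ψ x ∈ Y} ∈ nhds (P (Ψ x₀)) := by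
    have := Filter.image_mem_map (m := fun x => P (Ψ x)) hY
    rwa [show Filter.map (fun x => P (Ψ x)) (nhds x₀) = _ from hnhds] at this
  let b := Module.finBasis ℂ W
  let φ := b.equivFunL
  have hφ : Set.image φ ((fun x => P (Ψ x)) '' {x | ψ x ∈ Y}) ∈ nhds (φ (P (Ψ x₀))) :=
    φ.toHomeomorph.isOpenMap.image_mem_nhds himg
  obtain ⟨ε, hε, hball⟩ := Metric.mem_nhds_iff.1 hφ
  have := coordinateRing_finiteType Y
  let l : Fin (Module.finrank ℂ W) → Module.Dual ℂ M := fun i => b.coord i ∘ₗ p ∘ₗ e.toLinearMap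
  let x : Fin (Module.finrank ℂ W) → coordinateRing Y :=
    fun i => ⟨fun y => l i y, Algebra.subset_adjoin ⟨l i, rfl⟩⟩
  refine AlgebraicIndependent.natCast_le_ringKrullDim (F := ℂ) (A := coordinateRing Y) (x := x) ?_
  refine (injective_iff_map_eq_zero (MvPolynomial.aeval (R := ℂ) x)).2 fun Q hQ => ?_
  refine MvPolynomial.funext_set (fun i => Metric.ball (φ (P (Ψ x₀)) i) ε) (fun i => ?_)
    fun w hw => ?_
  · exact infinite_of_mem_nhds _ (Metric.ball_mem_nhds _ hε)
  · have hw' : w ∈ Metric.ball (φ (P (Ψ x₀))) ε := by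
      rw [ball_pi _ hε]
      exact hw
    obtain ⟨_, ⟨u, hu, rfl⟩, rfl⟩ := hball hw'
    have := MvPolynomial.comp_aeval (R := ℂ) x
      ((Pi.evalAlgHom ℂ (fun _ : Y => ℂ) ⟨ψ u, hu⟩).comp (coordinateRing Y).val)
    have h2 := DFunLike.congr_fun this Q
    rw [AlgHom.comp_apply, hQ, map_zero] at h2
    rw [map_zero, ← MvPolynomial.aeval_eq_eval]
    exact h2.symm

end PolyFun

/-! ### Darboux bases -/

/-- The Gram matrix `(0, 1; -1, 0)` of a Darboux basis. -/
def darbouxGram (n : Type*) [DecidableEq n] : Matrix (n ⊕ n) (n ⊕ n) ℂ :=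
  Matrix.fromBlocks 0 1 (-1) 0

/-- The Gram matrix of a Darboux basis whose hyperbolic pairs come in three groups. -/
def blockGram (β α γ : Type*) [DecidableEq β] [DecidableEq α] [DecidableEq γ] :
    Matrix ((β ⊕ β) ⊕ ((α ⊕ α) ⊕ (γ ⊕ γ))) ((β ⊕ β) ⊕ ((α ⊕ α) ⊕ (γ ⊕ γ))) ℂ :=
  Matrix.fromBlocks (darbouxGram β) 0 0 (Matrix.fromBlocks (darbouxGram α) 0 0 (darbouxGram γ))

theorem isUnit_det_darbouxGram (n : Type*) [DecidableEq n] [Fintype n] :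
    IsUnit (darbouxGram n).det := by
  have : darbouxGram n * (-darbouxGram n) = 1 := by
    simp [darbouxGram, Matrix.fromBlocks_neg, Matrix.fromBlocks_multiply, Matrix.fromBlocks_one]
  exact (Matrix.isUnit_iff_isUnit_det _).1 (IsUnit.of_mul_eq_one _ this)

theorem isUnit_det_blockGram (β α γ : Type*) [DecidableEq β] [DecidableEq α] [DecidableEq γ]
    [Fintype β] [Fintype α] [Fintype γ] : IsUnit (blockGram β α γ).det := by
  rw [blockGram, Matrix.det_fromBlocks_zero₂₁, Matrix.det_fromBlocks_zero₂₁]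
  exact (isUnit_det_darbouxGram β).mul ((isUnit_det_darbouxGram α).mul (isUnit_det_darbouxGram γ))

section Darboux

variable {F : Type*} [AddCommGroup F] [Module ℂ F] {B : BilinForm ℂ F}

theorem LinearMap.BilinForm.IsAlt.nondegenerate_of_forall (hB : B.IsAlt)
    (h : ∀ x, (∀ y, B x y = 0) → x = 0) : B.Nondegenerate :=
  ⟨h, fun y hy => h y fun x => hB.isRefl _ _ (hy x)⟩

theorem eq_zero_of_gram {ι : Type*} [Fintype ι] [DecidableEq ι] {f : ι → F} {G : Matrix ι ι ℂ}
    (hG : IsUnit G.det) (hf : ∀ i j, B (f i) (f j) = G i j) {c : ι → ℂ}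
    (hc : ∀ j, B (∑ i, c i • f i) (f j) = 0) : c = 0 := by
  have : Matrix.vecMul c G = 0 := by
    ext j
    have := hc j
    simp only [map_sum, map_smul, LinearMap.sum_apply, LinearMap.smul_apply, hf] at this
    simpa [Matrix.vecMul, dotProduct] using this
  exact Matrix.eq_zero_of_vecMul_eq_zero hG.ne_zero this

theorem linearIndependent_of_gram {ι : Type*} [Fintype ι] [DecidableEq ι] {f : ι → F}
    {G : Matrix ι ι ℂ} (hG : IsUnit G.det) (hf : ∀ i j, B (f i) (f j) = G i j) :
    LinearIndependent ℂ f := by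
  refine Fintype.linearIndependent_iff.2 fun c hc => congrFun (eq_zero_of_gram (B := B) hG hf ?_)
  simp [hc]

theorem restrict_span_nondegenerate_of_gram (hB : B.IsAlt) {ι : Type*} [Fintype ι] [DecidableEq ι]
    {f : ι → F} {G : Matrix ι ι ℂ} (hG : IsUnit G.det) (hf : ∀ i j, B (f i) (f j) = G i j) :
    (B.restrict (Submodule.span ℂ (Set.range f))).Nondegenerate := by
  refine LinearMap.BilinForm.IsAlt.nondegenerate_of_forall (fun x => hB x) ?_
  rintro ⟨x, hx⟩ h
  obtain ⟨c, rfl⟩ := (Submodule.mem_span_range_iff_exists_fun ℂ).1 hx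
  have : c = 0 := eq_zero_of_gram (B := B) hG hf fun j =>
    h ⟨f j, Submodule.subset_span (Set.mem_range_self j)⟩
  ext
  simp [this]

theorem restrict_orthogonal_nondegenerate [FiniteDimensional ℂ F] (hB : B.IsAlt)
    (hnd : B.Nondegenerate) {U : Submodule ℂ F} (hU : (B.restrict U).Nondegenerate) :
    (B.restrict (B.orthogonal U)).Nondegenerate := by
  have hc := (BilinForm.restrict_nondegenerate_iff_isCompl_orthogonal hB.isRefl).1 hU
  refine (BilinForm.restrict_nondegenerate_iff_isCompl_orthogonal hB.isRefl).2 ?_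
  rw [BilinForm.orthogonal_orthogonal hnd hB.isRefl]
  exact hc.symm

theorem exists_dual_family [FiniteDimensional ℂ F] (hnd : B.Nondegenerate) {ι : Type*} [Fintype ι]
    [DecidableEq ι] {e : ι → F} (he : LinearIndependent ℂ e) :
    ∃ w : ι → F, ∀ i j, B (w i) (e j) = if i = j then 1 else 0 := by
  obtain ⟨g, hg⟩ := LinearMap.exists_leftInverse_of_injective (Fintype.linearCombination ℂ e)
    (LinearMap.ker_eq_bot.2 (he.fintypeLinearCombination_injective))
  refine ⟨fun i => (B.toDual hnd).symm (LinearMap.proj i ∘ₗ g), fun i j => ?_⟩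
  rw [BilinForm.apply_toDual_symm_apply]
  have := LinearMap.congr_fun hg (Pi.single j 1)
  simp only [LinearMap.comp_apply, Fintype.linearCombination_apply_single, one_smul] at this
  simp [this, Pi.single_apply]

/-- A family dual to an isotropic family becomes isotropic after subtracting suitable combinations
of the isotropic family. -/
theorem exists_isotropic_correction (hB : B.IsAlt) {ι : Type*} [Fintype ι] [DecidableEq ι]
    {e w : ι → F} (he : ∀ i j, B (e i) (e j) = 0)
    (hw : ∀ i j, B (w i) (e j) = if i = j then 1 else 0) :
    ∃ d : ι → F, (∀ i j, B (d i) (e j) = if i = j then 1 else 0) ∧ (∀ i j, B (d i) (d j) = 0) ∧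
      ∀ i, d i - w i ∈ Submodule.span ℂ (Set.range e) := by
  have hw' : ∀ i j, B (e j) (w i) = if i = j then -1 else 0 := fun i j => by
    rw [← hB.neg_eq, hw]
    split_ifs <;> simp
  refine ⟨fun i => w i + ∑ j, (2⁻¹ * B (w i) (w j)) • e j, fun i j => ?_, fun i j => ?_,
    fun i => ?_⟩
  · simp [map_add, map_sum, hw, he]
  · simp only [map_add, map_sum, map_smul, LinearMap.add_apply, LinearMap.sum_apply,
      LinearMap.smul_apply, hw, he, hw', smul_eq_mul]
    simp only [mul_ite, mul_one, mul_zero, mul_neg, Finset.sum_ite_eq, Finset.mem_univ, if_true,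
      Finset.sum_const_zero, add_zero]
    rw [← hB.neg_eq (w i) (w j)]
    ring
  · simp only [add_sub_cancel_left]
    exact Submodule.sum_mem _ fun j _ =>
      Submodule.smul_mem _ _ (Submodule.subset_span (Set.mem_range_self j))

theorem exists_isotropic_dual_family [FiniteDimensional ℂ F] (hB : B.IsAlt) (hnd : B.Nondegenerate)
    {ι : Type*} [Fintype ι] [DecidableEq ι] {e : ι → F} (hli : LinearIndependent ℂ e)
    (he : ∀ i j, B (e i) (e j) = 0) :
    ∃ d : ι → F, (∀ i j, B (e i) (d j) = if i = j then 1 else 0) ∧ ∀ i j, B (d i) (d j) = 0 := by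
  obtain ⟨w, hw⟩ := exists_dual_family hnd hli
  obtain ⟨d, hd, hdd, -⟩ := exists_isotropic_correction hB he hw
  refine ⟨fun i => -d i, fun i j => ?_, fun i j => by simp [hdd]⟩
  rw [map_neg, hB.neg_eq, hd]
  simp [eq_comm]

/-- Every symplectic space has a Darboux basis: take a basis of a maximal isotropic subspace and
an isotropic dual family. -/
theorem exists_darboux [FiniteDimensional ℂ F] (hB : B.IsAlt) (hnd : B.Nondegenerate) :
    ∃ (n : ℕ) (f : Fin n ⊕ Fin n → F), Module.finrank ℂ F = 2 * n ∧
      ∀ i j, B (f i) (f j) = darbouxGram (Fin n) i j := by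
  obtain ⟨L, hL, hmax⟩ : ∃ L : Submodule ℂ F, L ≤ B.orthogonal L ∧
      ∀ L' : Submodule ℂ F, L' ≤ B.orthogonal L' → L ≤ L' → L' = L := by
    obtain ⟨L, hL⟩ := (wellFounded_gt (α := Submodule ℂ F)).has_min
      {L : Submodule ℂ F | L ≤ B.orthogonal L} ⟨⊥, (bot_le : (⊥ : Submodule ℂ F) ≤ _)⟩
    exact ⟨L, hL.1, fun L' h' hle => (hle.eq_or_lt.resolve_right (hL.2 L' h')).symm⟩
  have hperp : B.orthogonal L = L := by
    refine le_antisymm (fun x hx => ?_) hL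
    have hiso : L ⊔ Submodule.span ℂ {x} ≤ B.orthogonal (L ⊔ Submodule.span ℂ {x}) := by
      intro y hy z hz
      obtain ⟨y₁, hy₁, y₂, hy₂, rfl⟩ := Submodule.mem_sup.1 hy
      obtain ⟨z₁, hz₁, z₂, hz₂, rfl⟩ := Submodule.mem_sup.1 hz
      obtain ⟨a, rfl⟩ := Submodule.mem_span_singleton.1 hy₂
      obtain ⟨b, rfl⟩ := Submodule.mem_span_singleton.1 hz₂
      have h1 : B z₁ y₁ = 0 := hL hy₁ z₁ hz₁
      have h2 : B z₁ x = 0 := hx z₁ hz₁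
      have h3 : B x y₁ = 0 := hB.isRefl _ _ (hx y₁ hy₁)
      change B _ _ = 0
      simp [h1, h2, h3, hB.self_eq_zero]
    rw [← hmax _ hiso le_sup_left]
    exact Submodule.mem_sup_right (Submodule.mem_span_singleton_self x)
  let b := Module.finBasis ℂ L
  have hli : LinearIndependent ℂ (fun i => (b i : F)) :=
    b.linearIndependent.map' L.subtype L.ker_subtype
  have hiso : ∀ i j, B (b i) (b j) = 0 := fun i j => hL (b j).2 (b i) (b i).2
  obtain ⟨d, hd, hdd⟩ := exists_isotropic_dual_family hB hnd hli hiso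
  refine ⟨_, Sum.elim (fun i => (b i : F)) d, ?_, ?_⟩
  · have h1 := BilinForm.finrank_orthogonal hnd L
    have h2 := Submodule.finrank_le L
    rw [hperp] at h1
    omega
  · rintro (i | i) (j | j)
    · simp [darbouxGram, hiso]
    · simp [darbouxGram, hd, Matrix.one_apply]
    · have : B (d i) (b j) = - (if j = i then 1 else 0) := by rw [← hd, hB.neg_eq]
      simp [darbouxGram, this, Matrix.one_apply, eq_comm]
    · simp [darbouxGram, hdd]

/-- A Darboux basis adapted to a subspace `W`: if `W` has dimension `a + t` and the form has rank
`a` on `W`, then `a = 2 s`, and `W` is spanned by `s` hyperbolic pairs together with the first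
vectors of `t` further pairs. -/
theorem exists_darboux_adapted [FiniteDimensional ℂ F] (hB : B.IsAlt) (hnd : B.Nondegenerate)
    (W : Submodule ℂ F) {a t : ℕ} (hW : Module.finrank ℂ W = a + t)
    (ha : Module.finrank ℂ (LinearMap.range (B.restrict W)) = a) :
    ∃ (s l : ℕ) (f : (Fin t ⊕ Fin t) ⊕ ((Fin s ⊕ Fin s) ⊕ (Fin l ⊕ Fin l)) → F),
      a = 2 * s ∧ Module.finrank ℂ F = 2 * t + 2 * s + 2 * l ∧
      (∀ i j, B (f i) (f j) = blockGram (Fin t) (Fin s) (Fin l) i j) ∧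
      W = Submodule.span ℂ (Set.range (fun i => f (.inl (.inl i)))) ⊔
        Submodule.span ℂ (Set.range (fun i => f (.inr (.inl i)))) := by
  let K : Submodule ℂ W := LinearMap.ker (B.restrict W)
  have hK : Module.finrank ℂ K = t := by
    have := LinearMap.finrank_range_add_finrank_ker (B.restrict W)
    change _ + Module.finrank ℂ K = _ at this
    omega
  obtain ⟨C, hC⟩ := K.exists_isCompl
  have hCf : Module.finrank ℂ C = a := by
    have := Submodule.finrank_add_eq_of_isCompl hC
    omega
  have hKW : ∀ x ∈ K, ∀ y : W, B (x : F) y = 0 := fun x hx y => LinearMap.congr_fun hx y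
  have hKW' : ∀ x ∈ K, ∀ y : W, B (y : F) x = 0 := fun x hx y => hB.isRefl _ _ (hKW x hx y)
  -- the form is nondegenerate on a complement of its radical in `W`
  have hCnd : ((B.restrict W).restrict C).Nondegenerate := by
    refine LinearMap.BilinForm.IsAlt.nondegenerate_of_forall (fun x => hB (x : W)) fun x hx => ?_
    have hxK : (x : W) ∈ K := by
      refine LinearMap.mem_ker.2 (LinearMap.ext fun y => ?_)
      obtain ⟨y₁, hy₁, y₂, hy₂, rfl⟩ := Submodule.mem_sup.1
        (hC.codisjoint.eq_top ▸ Submodule.mem_top : y ∈ K ⊔ C)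
      have h1 : B ((x : W) : F) y₁ = 0 := hKW' y₁ hy₁ x
      have h2 : B ((x : W) : F) y₂ = 0 := hx ⟨y₂, hy₂⟩
      change B ((x : W) : F) ((y₁ : F) + y₂) = 0
      rw [map_add, h1, h2, add_zero]
    have : (x : W) ∈ K ⊓ C := ⟨hxK, x.2⟩
    rw [hC.disjoint.eq_bot] at this
    exact Subtype.ext ((Submodule.mem_bot _).1 this)
  obtain ⟨s, u, hs, hu⟩ := exists_darboux (B := (B.restrict W).restrict C)
    (fun x => hB (x : W)) hCnd
  let u' : Fin s ⊕ Fin s → F := fun i => ((u i : W) : F)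
  have hu' : ∀ i j, B (u' i) (u' j) = darbouxGram (Fin s) i j := hu
  let b := Module.finBasisOfFinrankEq ℂ K hK
  -- in the orthogonal complement of the hyperbolic pairs, the radical has an isotropic dual family
  let U := B.orthogonal (Submodule.span ℂ (Set.range u'))
  have hUnd : (B.restrict U).Nondegenerate := restrict_orthogonal_nondegenerate hB hnd
    (restrict_span_nondegenerate_of_gram hB (isUnit_det_darbouxGram _) hu')
  have hspanW : Submodule.span ℂ (Set.range u') ≤ W := Submodule.span_le.2 (by
    rintro _ ⟨i, rfl⟩
    exact (u i : W).2)
  let bU : Fin t → U := fun i => ⟨b i, fun y hy => hKW' _ (b i).2 ⟨y, hspanW hy⟩⟩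
  have hbli : LinearIndependent ℂ (fun i => ((b i : W) : F)) := by
    have h1 := b.linearIndependent.map' K.subtype K.ker_subtype
    exact h1.map' W.subtype W.ker_subtype
  have hbU : LinearIndependent ℂ bU := LinearIndependent.of_comp U.subtype hbli
  obtain ⟨d, hd, hdd⟩ := exists_isotropic_dual_family (B := B.restrict U)
    (fun x => hB (x : F)) hUnd hbU (fun i j => hKW _ (b i).2 _)
  have hd' : ∀ i j, B (b i : W) (d j : F) = if i = j then 1 else 0 := hd
  have hd'' : ∀ i j, B (d i : F) (b j : W) = -if j = i then 1 else 0 := fun i j => by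
    rw [← hB.neg_eq, hd']
  have hdd' : ∀ i j, B (d i : F) (d j : F) = 0 := hdd
  have hbb : ∀ i j, B (b i : W) (b j : W) = 0 := fun i j => hKW _ (b i).2 _
  have hub : ∀ i j, B (u' i) (b j : W) = 0 := fun i j => hKW' _ (b j).2 _
  have hbu : ∀ i j, B (b j : W) (u' i) = 0 := fun i j => hKW _ (b j).2 _
  have hud : ∀ i j, B (u' i) (d j : F) = 0 := fun i j =>
    (d j).2 _ (Submodule.subset_span (Set.mem_range_self i))
  have hdu : ∀ i j, B (d j : F) (u' i) = 0 := fun i j => hB.isRefl _ _ (hud i j)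
  let g : (Fin t ⊕ Fin t) ⊕ (Fin s ⊕ Fin s) → F :=
    Sum.elim (Sum.elim (fun i => ((b i : W) : F)) (fun i => d i)) u'
  have hg : ∀ i j, B (g i) (g j) =
      Matrix.fromBlocks (darbouxGram (Fin t)) 0 0 (darbouxGram (Fin s)) i j := by
    rintro ((i | i) | i) ((j | j) | j) <;>
      simp [g, darbouxGram, hbb, hd', hd'', hdd', hub, hbu, hud, hdu, hu', Matrix.one_apply,
        eq_comm]
  have hgdet : IsUnit (Matrix.fromBlocks (darbouxGram (Fin t)) 0 0 (darbouxGram (Fin s))).det := by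
    rw [Matrix.det_fromBlocks_zero₂₁]
    exact (isUnit_det_darbouxGram _).mul (isUnit_det_darbouxGram _)
  have hSnd := restrict_span_nondegenerate_of_gram hB hgdet hg
  let T := B.orthogonal (Submodule.span ℂ (Set.range g))
  have hTnd : (B.restrict T).Nondegenerate := restrict_orthogonal_nondegenerate hB hnd hSnd
  obtain ⟨l, c, hl, hc⟩ := exists_darboux (B := B.restrict T) (fun x => hB (x : F)) hTnd
  have hc' : ∀ i j, B (c i : F) (c j : F) = darbouxGram (Fin l) i j := hc
  have hgc : ∀ i j, B (g i) (c j : F) = 0 := fun i j =>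
    (c j).2 _ (Submodule.subset_span (Set.mem_range_self i))
  have hcg : ∀ i j, B (c j : F) (g i) = 0 := fun i j => hB.isRefl _ _ (hgc i j)
  refine ⟨s, l, Sum.elim (fun i => g (.inl i)) (Sum.elim u' fun i => c i), ?_, ?_, ?_, ?_⟩
  · omega
  · have h1 := BilinForm.finrank_orthogonal hnd (Submodule.span ℂ (Set.range g))
    have h2 := finrank_span_eq_card (linearIndependent_of_gram hgdet hg)
    have h3 := Submodule.finrank_le (Submodule.span ℂ (Set.range g))
    simp only [Fintype.card_sum, Fintype.card_fin] at h2
    change Module.finrank ℂ T = _ at h1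
    omega
  · rintro (i | i | i) (j | j | j)
    · exact hg (.inl i) (.inl j)
    · exact hg (.inl i) (.inr j)
    · exact hgc (.inl i) j
    · exact hg (.inr i) (.inl j)
    · exact hg (.inr i) (.inr j)
    · exact hgc (.inr i) j
    · exact hcg (.inl j) i
    · exact hcg (.inr j) i
    · exact hc' i j
  · refine (Submodule.eq_of_le_of_finrank_le (sup_le ?_ hspanW) ?_).symm
    · refine Submodule.span_le.2 ?_
      rintro _ ⟨i, rfl⟩
      exact (b i : W).2
    · let g' : Fin t ⊕ (Fin s ⊕ Fin s) → F := fun i => g (Sum.map Sum.inl id i)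
      have hli : LinearIndependent ℂ g' := (linearIndependent_of_gram hgdet hg).comp _ (by
        rintro (i | i) (j | j) h <;> simp_all)
      have hr : Set.range g' = (Set.range fun i => g (.inl (.inl i))) ∪ Set.range u' := by
        ext x
        simp [g', g]
      have h2 := finrank_span_eq_card hli
      rw [hr, Submodule.span_union] at h2
      simp only [Fintype.card_sum, Fintype.card_fin] at h2
      refine le_of_eq ?_
      rw [hW]
      refine Eq.trans ?_ h2.symm
      omega

end Darboux

/-! ### Bases adapted to the isotropic subspace -/

/-- A basis of `V` made of a basis `e` of `E`, an isotropic dual family `d`, normalized by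
`ω (d i) (e j) = δᵢⱼ`, and a basis `f`, with Gram matrix `G`, of the orthogonal complement of
these. -/
structure AdaptedBasis {V : Type*} [AddCommGroup V] [Module ℂ V] (ω : BilinForm ℂ V)
    (E : Submodule ℂ V) (κ φ : Type*) [DecidableEq κ] (G : Matrix φ φ ℂ) where
  /-- the basis; the three groups of indices belong to `e`, `d` and `f` -/
  b : Module.Basis ((κ ⊕ κ) ⊕ φ) ℂ V
  gram : ∀ i j, ω (b i) (b j) = Matrix.fromBlocks (-darbouxGram κ) 0 0 G i j
  span_eq : Submodule.span ℂ (Set.range fun i => b (.inl (.inl i))) = E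

namespace AdaptedBasis

variable {V : Type*} [AddCommGroup V] [Module ℂ V] {ω : BilinForm ℂ V} {E : Submodule ℂ V}
  {κ φ : Type*} [DecidableEq κ] {G : Matrix φ φ ℂ}

section

variable (a : AdaptedBasis ω E κ φ G)

/-- The basis vectors spanning `E`. -/
def e (i : κ) : V := a.b (.inl (.inl i))

/-- The basis vectors dual to those of `E`. -/
def d (i : κ) : V := a.b (.inl (.inr i))

/-- The basis vectors orthogonal to `E` and its dual. -/
def f (p : φ) : V := a.b (.inr p)

theorem e_mem (i : κ) : a.e i ∈ E := by
  have h : a.e i ∈ Submodule.span ℂ (Set.range fun i => a.b (.inl (.inl i))) :=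
    Submodule.subset_span ⟨i, rfl⟩
  rwa [a.span_eq] at h

theorem ee (i j : κ) : ω (a.e i) (a.e j) = 0 := by
  simpa [e, d, darbouxGram] using a.gram (.inl (.inl i)) (.inl (.inl j))

theorem de (i j : κ) : ω (a.d i) (a.e j) = if i = j then 1 else 0 := by
  simpa [e, d, darbouxGram, Matrix.one_apply] using a.gram (.inl (.inr i)) (.inl (.inl j))

theorem fe (p : φ) (j : κ) : ω (a.f p) (a.e j) = 0 := by
  simpa [e, d, f] using a.gram (.inr p) (.inl (.inl j))

theorem ef (i : κ) (p : φ) : ω (a.e i) (a.f p) = 0 := by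
  simpa [e, d, f] using a.gram (.inl (.inl i)) (.inr p)

theorem ff (p q : φ) : ω (a.f p) (a.f q) = G p q := by
  simpa [e, d, f] using a.gram (.inr p) (.inr q)

variable [Fintype κ] [Fintype φ]

theorem sum_repr (v : V) :
    v = ∑ i, a.b.repr v (.inl (.inl i)) • a.e i + ∑ i, a.b.repr v (.inl (.inr i)) • a.d i +
      ∑ p, a.b.repr v (.inr p) • a.f p := by
  conv_lhs => rw [← a.b.sum_repr v, Fintype.sum_sum_type, Fintype.sum_sum_type]
  rfl

theorem form_e (v : V) (j : κ) : ω v (a.e j) = a.b.repr v (.inl (.inr j)) := by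
  conv_lhs => rw [a.sum_repr v]
  simp [ee, de, fe]

theorem mem_iff (v : V) :
    v ∈ E ↔ (∀ i, a.b.repr v (.inl (.inr i)) = 0) ∧ ∀ p, a.b.repr v (.inr p) = 0 := by
  constructor
  · intro hv
    rw [← a.span_eq] at hv
    refine Submodule.span_induction (p := fun v _ => (∀ i, a.b.repr v (.inl (.inr i)) = 0) ∧
      ∀ p, a.b.repr v (.inr p) = 0) ?_ (by simp) ?_ ?_ hv
    · rintro _ ⟨i, rfl⟩
      simp
    · intro x y _ _ hx hy
      simp [hx.1, hx.2, hy.1, hy.2]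
    · intro c x _ hx
      simp [hx.1, hx.2]
  · rintro ⟨h1, h2⟩
    rw [a.sum_repr v]
    simp only [h1, h2, zero_smul, Finset.sum_const_zero, add_zero]
    exact Submodule.sum_mem _ fun i _ => E.smul_mem _ (a.e_mem i)

/-- Against a vector of `E`, only the components of `v` along the dual family matter. -/
theorem form_mem (v : V) {x : V} (hx : x ∈ E) :
    ω v x = ∑ j, a.b.repr x (.inl (.inl j)) * a.b.repr v (.inl (.inr j)) := by
  have h := (a.mem_iff x).1 hx
  conv_lhs => rw [a.sum_repr x]
  simp only [h.1, h.2, zero_smul, Finset.sum_const_zero, add_zero, map_sum, map_smul, smul_eq_mul,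
    a.form_e]

theorem mem_orthogonal_iff (hω : ω.IsAlt) (v : V) :
    v ∈ ω.orthogonal E ↔ ∀ i, a.b.repr v (.inl (.inr i)) = 0 := by
  constructor
  · intro hv i
    rw [← a.form_e]
    exact hω.isRefl _ _ (hv _ (a.e_mem i))
  · intro hv x hx
    refine hω.isRefl _ _ ?_
    rw [a.form_mem v hx]
    simp [hv]

/-- The matrix of the form `σ` of a class in `𝔰𝔭(V) / 𝔭`. -/
def symCoord : tangentQuotient ω E →ₗ[ℂ] Matrix κ κ ℂ :=
  (parabolicAlgebra ω E).toSubmodule.liftQ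
    (LinearMap.pi fun i => LinearMap.pi fun j => a.b.coord (.inl (.inr j)) ∘ₗ
      LinearMap.applyₗ (a.e i) ∘ₗ (spAlgebra ω).toSubmodule.subtype) (by
    intro X hX
    ext i j
    exact ((a.mem_iff _).1 (hX _ (a.e_mem i))).1 j)

/-- The matrix of the `Hom(E, E^⊥/E)`-component of a class in `𝔰𝔭(V) / 𝔭` with respect to the
decomposition of `V` given by the adapted basis. -/
def mixCoord : tangentQuotient ω E →ₗ[ℂ] Matrix κ φ ℂ :=
  (parabolicAlgebra ω E).toSubmodule.liftQ
    (LinearMap.pi fun i => LinearMap.pi fun p => a.b.coord (.inr p) ∘ₗ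
      LinearMap.applyₗ (a.e i) ∘ₗ (spAlgebra ω).toSubmodule.subtype) (by
    intro X hX
    ext i p
    exact ((a.mem_iff _).1 (hX _ (a.e_mem i))).2 p)

theorem symCoord_mk (X : spAlgebra ω) (i j : κ) :
    a.symCoord ((parabolicAlgebra ω E).toSubmodule.mkQ X) i j =
      a.b.repr ((X : Module.End ℂ V) (a.e i)) (.inl (.inr j)) := rfl

theorem mixCoord_mk (X : spAlgebra ω) (i : κ) (p : φ) :
    a.mixCoord ((parabolicAlgebra ω E).toSubmodule.mkQ X) i p =
      a.b.repr ((X : Module.End ℂ V) (a.e i)) (.inr p) := rfl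

theorem coord_ext {q q' : tangentQuotient ω E} (h1 : a.symCoord q = a.symCoord q')
    (h2 : a.mixCoord q = a.mixCoord q') : q = q' := by
  obtain ⟨X, rfl⟩ := (parabolicAlgebra ω E).toSubmodule.mkQ_surjective q
  obtain ⟨X', rfl⟩ := (parabolicAlgebra ω E).toSubmodule.mkQ_surjective q'
  rw [← sub_eq_zero, ← map_sub, Submodule.mkQ_apply, Submodule.Quotient.mk_eq_zero]
  intro x hx
  rw [← a.span_eq] at hx
  refine Submodule.span_induction
    (p := fun x _ => ((X - X' : spAlgebra ω) : Module.End ℂ V) x ∈ E) ?_ (by simp) ?_ ?_ hx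
  · rintro _ ⟨i, rfl⟩
    change ((X - X' : spAlgebra ω) : Module.End ℂ V) (a.e i) ∈ E
    refine (a.mem_iff _).2 ⟨fun j => ?_, fun p => ?_⟩
    · have := congrFun (congrFun h1 i) j
      rw [symCoord_mk, symCoord_mk] at this
      simpa [sub_eq_zero, e] using this
    · have := congrFun (congrFun h2 i) p
      rw [mixCoord_mk, mixCoord_mk] at this
      simpa [sub_eq_zero, e] using this
  · intro x y _ _ hx hy
    rw [map_add]
    exact E.add_mem hx hy
  · intro c x _ hx
    rw [map_smul]
    exact E.smul_mem c hx

theorem symCoord_transpose (hω : ω.IsAlt) (q : tangentQuotient ω E) :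
    (a.symCoord q).transpose = a.symCoord q := by
  obtain ⟨X, rfl⟩ := (parabolicAlgebra ω E).toSubmodule.mkQ_surjective q
  ext i j
  have h : ∀ x y, ω ((X : Module.End ℂ V) x) y = ω x (-(X : Module.End ℂ V) y) :=
    (ω.mem_skewAdjointSubmodule _).1 X.2
  rw [Matrix.transpose_apply, symCoord_mk, symCoord_mk, ← a.form_e, ← a.form_e, h, map_neg,
    hω.neg_eq]

end

/-- The rank two elements `x ↦ ω(v, x) w + ω(w, x) v`, which span the symplectic Lie algebra. -/
def symTensor (hω : ω.IsAlt) (v w : V) : spAlgebra ω :=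
  ⟨(ω v).smulRight w + (ω w).smulRight v, (ω.mem_skewAdjointSubmodule _).2 fun x y => by
    change ω (ω v x • w + ω w x • v) y = ω x (-(ω v y • w + ω w y • v))
    simp only [map_add, map_smul, map_neg, LinearMap.add_apply, LinearMap.smul_apply, smul_eq_mul]
    rw [← hω.neg_eq v x, ← hω.neg_eq w x]
    ring⟩

theorem symTensor_apply (hω : ω.IsAlt) (v w x : V) :
    ((symTensor hω v w : spAlgebra ω) : Module.End ℂ V) x = ω v x • w + ω w x • v := rfl

variable [Fintype κ] [Fintype φ] (a : AdaptedBasis ω E κ φ G)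

/-- The class in `𝔰𝔭(V) / 𝔭` with given coordinates, for symmetric `σ`. The factor `1/2` is there
because `symTensor` is symmetric, so that each pair of indices contributes twice to `σ`. -/
def ofCoord (hω : ω.IsAlt) (σ : Matrix κ κ ℂ) (H : Matrix κ φ ℂ) : tangentQuotient ω E :=
  (parabolicAlgebra ω E).toSubmodule.mkQ
    (∑ i, ∑ j, (2⁻¹ * σ i j) • symTensor hω (a.d i) (a.d j) +
      ∑ i, ∑ p, H i p • symTensor hω (a.d i) (a.f p))

theorem ofCoord_apply_e (hω : ω.IsAlt) {σ : Matrix κ κ ℂ} (hσ : σ.transpose = σ)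
    (H : Matrix κ φ ℂ) (l : κ) :
    ((∑ i, ∑ j, (2⁻¹ * σ i j) • symTensor hω (a.d i) (a.d j) +
      ∑ i, ∑ p, H i p • symTensor hω (a.d i) (a.f p) : spAlgebra ω) : Module.End ℂ V) (a.e l) =
      ∑ j, σ l j • a.d j + ∑ p, H l p • a.f p := by
  have hσ' : ∀ i j, σ i j = σ j i := fun i j => congrFun (congrFun hσ j) i
  have h1 : ∑ i, ∑ j, (2⁻¹ * σ i j) • (ω (a.d i) (a.e l) • a.d j + ω (a.d j) (a.e l) • a.d i) =
      ∑ j, σ l j • a.d j := by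
    simp only [de, smul_add, Finset.sum_add_distrib, ite_smul, smul_ite, one_smul, zero_smul,
      smul_zero, Finset.sum_ite_eq', Finset.mem_univ, if_true]
    rw [Finset.sum_comm]
    simp only [Finset.sum_ite_eq', Finset.mem_univ, if_true]
    rw [← Finset.sum_add_distrib]
    refine Finset.sum_congr rfl fun j _ => ?_
    rw [← add_smul, hσ' j l]
    congr 1
    ring
  have h2 : ∑ i, ∑ p, H i p • (ω (a.d i) (a.e l) • a.f p + ω (a.f p) (a.e l) • a.d i) =
      ∑ p, H l p • a.f p := by
    simp only [de, fe, ite_smul, smul_ite, one_smul, zero_smul, smul_zero, add_zero]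
    rw [Finset.sum_comm]
    simp
  rw [← h1, ← h2]
  simp [symTensor_apply]

theorem symCoord_ofCoord (hω : ω.IsAlt) {σ : Matrix κ κ ℂ} (hσ : σ.transpose = σ)
    (H : Matrix κ φ ℂ) : a.symCoord (a.ofCoord hω σ H) = σ := by
  ext l j
  rw [ofCoord, symCoord_mk, ofCoord_apply_e a hω hσ, ← a.form_e]
  simp [de, fe]

theorem mixCoord_ofCoord (hω : ω.IsAlt) {σ : Matrix κ κ ℂ} (hσ : σ.transpose = σ)
    (H : Matrix κ φ ℂ) : a.mixCoord (a.ofCoord hω σ H) = H := by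
  ext l p
  rw [ofCoord, mixCoord_mk, ofCoord_apply_e a hω hσ]
  classical simp [d, f, Finsupp.single_apply]

theorem ofCoord_coord (hω : ω.IsAlt) (q : tangentQuotient ω E) :
    a.ofCoord hω (a.symCoord q) (a.mixCoord q) = q :=
  a.coord_ext (a.symCoord_ofCoord hω (a.symCoord_transpose hω q) _)
    (a.mixCoord_ofCoord hω (a.symCoord_transpose hω q) _)

end AdaptedBasis

/-! ### The invariants in coordinates -/

/-- The image under `H` of the radical of `σ`, for matrices acting on row vectors. -/
def radicalImage {κ φ : Type*} [Fintype κ] (σ : Matrix κ κ ℂ) (H : Matrix κ φ ℂ) :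
    Submodule ℂ (φ → ℂ) :=
  (LinearMap.ker σ.vecMulLinear).map H.vecMulLinear

/-- The conditions defining `𝒪_(r,h,t)`, for a pair of matrices `(σ, H)`; the matrix `G` is the Gram
matrix of the form on `E^⊥/E`. -/
def HasInvariants {κ φ : Type*} [Fintype κ] [Fintype φ] [DecidableEq φ] (G : Matrix φ φ ℂ)
    (σ : Matrix κ κ ℂ) (H : Matrix κ φ ℂ) (r h t : ℕ) : Prop :=
  Module.finrank ℂ (LinearMap.range σ.vecMulLinear) = r ∧
  Module.finrank ℂ (radicalImage σ H) = h ∧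
  t + Module.finrank ℂ (LinearMap.range ((Matrix.toBilin' G).restrict (radicalImage σ H))) = h

theorem finrank_range_conj {A A' B B' : Type*} [AddCommGroup A] [Module ℂ A] [AddCommGroup A']
    [Module ℂ A'] [AddCommGroup B] [Module ℂ B] [AddCommGroup B'] [Module ℂ B'] (u : A →ₗ[ℂ] B)
    (u' : A' →ₗ[ℂ] B') (e : A ≃ₗ[ℂ] A') (e' : B ≃ₗ[ℂ] B') (h : ∀ x, e' (u x) = u' (e x)) :
    Module.finrank ℂ (LinearMap.range u) = Module.finrank ℂ (LinearMap.range u') := by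
  have h1 : u'.range = u.range.map e'.toLinearMap := by
    rw [← LinearMap.range_comp, ← LinearMap.range_comp_of_range_eq_top (f := e.toLinearMap) u' e.range]
    congr 1
    ext x
    exact (h x).symm
  rw [h1]
  exact (LinearEquiv.finrank_map_eq e' _).symm

theorem finrank_range_restrict_of_isometry {A A' : Type*} [AddCommGroup A] [Module ℂ A]
    [AddCommGroup A'] [Module ℂ A'] {B : BilinForm ℂ A} {B' : BilinForm ℂ A'} (e : A ≃ₗ[ℂ] A')
    (h : ∀ x y, B x y = B' (e x) (e y)) {U : Submodule ℂ A} {U' : Submodule ℂ A'}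
    (hU : U.map e.toLinearMap = U') :
    Module.finrank ℂ (LinearMap.range (B.restrict U)) =
      Module.finrank ℂ (LinearMap.range (B'.restrict U')) := by
  subst hU
  refine finrank_range_conj _ _ (e.submoduleMap U) (e.submoduleMap U).symm.dualMap fun x => ?_
  ext y
  obtain ⟨y, rfl⟩ := (e.submoduleMap U).surjective y
  simp only [LinearEquiv.dualMap_apply, LinearEquiv.symm_apply_apply]
  exact h x y

namespace AdaptedBasis

variable {V : Type*} [AddCommGroup V] [Module ℂ V] {ω : BilinForm ℂ V} {E : Submodule ℂ V}
  {κ φ : Type*} [DecidableEq κ] {G : Matrix φ φ ℂ} [Fintype κ] [Fintype φ]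
  (a : AdaptedBasis ω E κ φ G)

/-- The coordinates on `E` given by an adapted basis. -/
def coordE : E ≃ₗ[ℂ] (κ → ℂ) :=
  LinearEquiv.ofBijective
    (LinearMap.pi fun i => a.b.coord (.inl (.inl i)) ∘ₗ E.subtype) <| by
    constructor
    · refine (injective_iff_map_eq_zero _).2 fun x hx => ?_
      have h := (a.mem_iff x).1 x.2
      have h' : ∀ i, a.b.repr x (.inl (.inl i)) = 0 := fun i => congrFun hx i
      ext
      rw [a.sum_repr (x : V)]
      simp [h.1, h.2, h']
    · intro c
      refine ⟨⟨∑ i, c i • a.e i, Submodule.sum_mem _ fun i _ => E.smul_mem _ (a.e_mem i)⟩, ?_⟩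
      ext j
      classical simp [e, Finsupp.single_apply]

theorem coordE_apply (x : E) (i : κ) : a.coordE x i = a.b.repr (x : V) (.inl (.inl i)) := rfl

theorem coe_eq_sum (x : E) : (x : V) = ∑ i, a.coordE x i • a.e i := by
  have h := (a.mem_iff x).1 x.2
  conv_lhs => rw [a.sum_repr (x : V)]
  simp [h.1, h.2, coordE_apply]

/-- The coordinates on `E^⊥ / E` given by an adapted basis. -/
def coordPerp (hω : ω.IsAlt) : perpQuotient ω E ≃ₗ[ℂ] (φ → ℂ) :=
  LinearEquiv.ofBijective
    ((E.submoduleOf (ω.orthogonal E)).liftQ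
      (LinearMap.pi fun p => a.b.coord (.inr p) ∘ₗ (ω.orthogonal E).subtype) (by
        intro x hx
        ext p
        exact ((a.mem_iff (x : V)).1 hx).2 p)) <| by
    constructor
    · refine LinearMap.ker_eq_bot.1 (Submodule.ker_liftQ_eq_bot _ _ _ fun x hx => ?_)
      exact (a.mem_iff (x : V)).2 ⟨(a.mem_orthogonal_iff hω _).1 x.2, fun p => congrFun hx p⟩
    · intro c
      refine ⟨Submodule.Quotient.mk ⟨∑ p, c p • a.f p, ?_⟩, ?_⟩
      · rw [a.mem_orthogonal_iff hω]
        intro i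
        rw [← a.form_e]
        simp [fe]
      · ext p
        change a.b.repr (∑ p, c p • a.f p) (.inr p) = c p
        classical simp [f, Finsupp.single_apply]

theorem coordPerp_mk (hω : ω.IsAlt) (x : ω.orthogonal E) (p : φ) :
    a.coordPerp hω (Submodule.Quotient.mk x) p = a.b.repr (x : V) (.inr p) := rfl

theorem reducedForm_eq [DecidableEq φ] (hω : ω.IsAlt) (x y : perpQuotient ω E) :
    reducedForm ω hω E x y = Matrix.toBilin' G (a.coordPerp hω x) (a.coordPerp hω y) := by
  obtain ⟨x, rfl⟩ := Submodule.Quotient.mk_surjective _ x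
  obtain ⟨y, rfl⟩ := Submodule.Quotient.mk_surjective _ y
  change ω (x : V) (y : V) = _
  have hx := (a.mem_orthogonal_iff hω _).1 x.2
  have hy := (a.mem_orthogonal_iff hω _).1 y.2
  rw [a.sum_repr (x : V), a.sum_repr (y : V), Matrix.toBilin'_apply]
  simp [hx, hy, coordPerp_mk, ee, ef, fe, ff, Finset.mul_sum]
  exact Finset.sum_congr rfl fun _ _ => Finset.sum_congr rfl fun _ _ => by ring

theorem form_apply_eq (X : spAlgebra ω) (x y : E) :
    symPart ω E X x y = ∑ j, Matrix.vecMul (a.coordE x)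
      (a.symCoord ((parabolicAlgebra ω E).toSubmodule.mkQ X)) j * a.coordE y j := by
  change ω ((X : Module.End ℂ V) x) y = _
  rw [a.form_mem _ y.2]
  refine Finset.sum_congr rfl fun j _ => ?_
  rw [mul_comm, ← coordE_apply]
  congr 1
  rw [a.coe_eq_sum x]
  simp [Matrix.vecMul, dotProduct]
  rfl

theorem repr_apply_inr (X : spAlgebra ω) (x : E) (p : φ) :
    a.b.repr ((X : Module.End ℂ V) x) (.inr p) = Matrix.vecMul (a.coordE x)
      (a.mixCoord ((parabolicAlgebra ω E).toSubmodule.mkQ X)) p := by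
  rw [a.coe_eq_sum x]
  simp [Matrix.vecMul, dotProduct]
  rfl

theorem invariants_iff [DecidableEq φ] (hω : ω.IsAlt) (X : spAlgebra ω) (r h t : ℕ) :
    (Module.finrank ℂ (LinearMap.range (symPart ω E X)) = r ∧
    Module.finrank ℂ (LinearMap.range (mixedPart ω hω E X)) = h ∧
    t + Module.finrank ℂ (LinearMap.range
      ((reducedForm ω hω E).restrict (LinearMap.range (mixedPart ω hω E X)))) = h) ↔
    HasInvariants G (a.symCoord ((parabolicAlgebra ω E).toSubmodule.mkQ X))
      (a.mixCoord ((parabolicAlgebra ω E).toSubmodule.mkQ X)) r h t := by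
  set σ := a.symCoord ((parabolicAlgebra ω E).toSubmodule.mkQ X) with hσ
  set H := a.mixCoord ((parabolicAlgebra ω E).toSubmodule.mkQ X) with hH
  have hker : ∀ x : E, x ∈ LinearMap.ker (symPart ω E X) ↔
      a.coordE x ∈ LinearMap.ker σ.vecMulLinear := by
    intro x
    rw [LinearMap.mem_ker, LinearMap.mem_ker]
    constructor
    · intro hx
      ext j
      have := LinearMap.congr_fun hx (a.coordE.symm (Pi.single j 1))
      rw [a.form_apply_eq, ← hσ] at this
      simpa [Pi.single_apply] using this
    · intro hx
      ext y
      have hx' : Matrix.vecMul (a.coordE x) σ = 0 := hx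
      rw [a.form_apply_eq, ← hσ, hx']
      simp
  have h1 : Module.finrank ℂ (LinearMap.range (symPart ω E X)) =
      Module.finrank ℂ (LinearMap.range σ.vecMulLinear) := by
    have : Module.Finite ℂ E := Module.Finite.equiv a.coordE.symm
    have hk : (LinearMap.ker (symPart ω E X)).map a.coordE.toLinearMap =
        LinearMap.ker σ.vecMulLinear := by
      ext v
      constructor
      · rintro ⟨x, hx, rfl⟩
        exact (hker x).1 hx
      · intro hv
        exact ⟨a.coordE.symm v, (hker _).2 (by simpa using hv), by simp⟩
    have e1 := LinearMap.finrank_range_add_finrank_ker (symPart ω E X)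
    have e2 := LinearMap.finrank_range_add_finrank_ker σ.vecMulLinear
    have e3 : Module.finrank ℂ (LinearMap.ker (symPart ω E X)) =
        Module.finrank ℂ (LinearMap.ker σ.vecMulLinear) := by
      rw [← hk]
      exact (LinearEquiv.finrank_map_eq a.coordE _).symm
    have e4 := a.coordE.finrank_eq
    omega
  have h2 : (LinearMap.range (mixedPart ω hω E X)).map (a.coordPerp hω).toLinearMap =
      radicalImage σ H := by
    ext c
    simp only [radicalImage, Submodule.mem_map, LinearMap.mem_range]
    constructor
    · rintro ⟨_, ⟨x, rfl⟩, rfl⟩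
      refine ⟨a.coordE x, (hker x).1 x.2, ?_⟩
      ext p
      exact (a.repr_apply_inr X x p).symm
    · rintro ⟨v, hv, rfl⟩
      refine ⟨_, ⟨⟨a.coordE.symm v, (hker _).2 (by simpa using hv)⟩, rfl⟩, ?_⟩
      ext p
      have := a.repr_apply_inr X (a.coordE.symm v) p
      rw [LinearEquiv.apply_symm_apply] at this
      exact this
  have h3 := finrank_range_restrict_of_isometry (a.coordPerp hω) (a.reducedForm_eq hω) h2
  have h4 : Module.finrank ℂ (LinearMap.range (mixedPart ω hω E X)) =
      Module.finrank ℂ (radicalImage σ H) := by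
    rw [← h2]
    exact (LinearEquiv.finrank_map_eq (a.coordPerp hω) _).symm
  rw [HasInvariants, h1, h3, h4]

/-- A class lies in `𝒪_(r,h,t)` if and only if its coordinates, with respect to any adapted basis,
have the invariants `(r, h, t)`. -/
theorem mem_orbitSet_iff [DecidableEq φ] (hω : ω.IsAlt) (q : tangentQuotient ω E) (r h t : ℕ) :
    q ∈ orbitSet ω hω E r h t ↔ HasInvariants G (a.symCoord q) (a.mixCoord q) r h t := by
  constructor
  · rintro ⟨X, rfl, hX⟩
    exact (a.invariants_iff hω X r h t).1 hX
  · intro hq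
    obtain ⟨X, rfl⟩ := (parabolicAlgebra ω E).toSubmodule.mkQ_surjective q
    exact ⟨X, rfl, (a.invariants_iff hω X r h t).2 hq⟩

end AdaptedBasis

/-! ### Normal form of a class -/

theorem exists_orthonormal_of_symm {C : Type*} [AddCommGroup C] [Module ℂ C] [FiniteDimensional ℂ C]
    {B : BilinForm ℂ C} (hs : LinearMap.IsSymm B) (hnd : B.Nondegenerate) {n : ℕ}
    (hn : Module.finrank ℂ C = n) :
    ∃ v : Fin n → C, ∀ i j, B (v i) (v j) = if i = j then 1 else 0 := by
  subst hn
  have : Invertible (2 : ℂ) := invertibleOfNonzero two_ne_zero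
  obtain ⟨v, hv⟩ := BilinForm.exists_orthogonal_basis hs
  have hne : ∀ i, B (v i) (v i) ≠ 0 := fun i h =>
    hv.not_isOrtho_basis_self_of_separatingLeft hnd.1 i h
  choose c hc using fun i => IsAlgClosed.exists_pow_nat_eq (B (v i) (v i)) (n := 2) (by norm_num)
  have hc0 : ∀ i, c i ≠ 0 := fun i h => hne i (by rw [← hc i, h]; norm_num)
  refine ⟨fun i => (c i)⁻¹ • v i, fun i j => ?_⟩
  simp only [map_smul, LinearMap.smul_apply, smul_eq_mul]
  split_ifs with hij
  · subst hij
    rw [← hc i]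
    field_simp [hc0 i]
  · have : B (v i) (v j) = 0 := hv hij
    rw [this, mul_zero, mul_zero]

/-- A basis of `E` adapted to a symmetric form `σ` and a linear map `m` on its radical: an
orthonormal family, preimages of a basis of the image of `m`, and a basis of the kernel of `m`. -/
theorem exists_family_adapted_to_radical {E Q : Type*} [AddCommGroup E] [Module ℂ E]
    [FiniteDimensional ℂ E] [AddCommGroup Q] [Module ℂ Q] {σ : BilinForm ℂ E}
    (hσ : ∀ x y, σ x y = σ y x) (m : LinearMap.ker σ →ₗ[ℂ] Q) {α β : Type*} [Fintype α] [Fintype β]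
    {fα : α → Q} {fβ : β → Q} (hα : ∀ i, fα i ∈ LinearMap.range m)
    (hβ : ∀ i, fβ i ∈ LinearMap.range m) (hf : LinearIndependent ℂ (Sum.elim fα fβ)) {r z : ℕ}
    (hr : Module.finrank ℂ (LinearMap.range σ) = r)
    (hz : Module.finrank ℂ (LinearMap.ker m) = z) :
    ∃ (v : Fin r → E) (uα : α → LinearMap.ker σ) (uβ : β → LinearMap.ker σ)
      (w : Fin z → LinearMap.ker σ),
      (∀ i j, σ (v i) (v j) = if i = j then 1 else 0) ∧ (∀ i, m (uα i) = fα i) ∧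
      (∀ i, m (uβ i) = fβ i) ∧ (∀ i, m (w i) = 0) ∧
      LinearIndependent ℂ (Sum.elim v (Sum.elim (fun i => (uα i : E)) (Sum.elim (fun i => (uβ i : E))
        (fun i => (w i : E))))) := by
  have hRl : ∀ (x : LinearMap.ker σ) y, σ x y = 0 := fun x y => LinearMap.congr_fun x.2 y
  have hRr : ∀ (x : LinearMap.ker σ) y, σ y x = 0 := fun x y => by rw [hσ, hRl]
  obtain ⟨C, hC⟩ := (LinearMap.ker σ).exists_isCompl
  have hCf : Module.finrank ℂ C = r := by
    have h1 := Submodule.finrank_add_eq_of_isCompl hC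
    have h2 := LinearMap.finrank_range_add_finrank_ker σ
    omega
  have hCl : ∀ x : C, (∀ y : C, σ x y = 0) → x = 0 := by
    intro x hx
    have hxR : (x : E) ∈ LinearMap.ker σ := by
      refine LinearMap.mem_ker.2 (LinearMap.ext fun y => ?_)
      obtain ⟨y₁, hy₁, y₂, hy₂, rfl⟩ := Submodule.mem_sup.1
        (hC.codisjoint.eq_top ▸ Submodule.mem_top : y ∈ LinearMap.ker σ ⊔ C)
      rw [map_add, hRr ⟨y₁, hy₁⟩, hx ⟨y₂, hy₂⟩]
      simp
    have : (x : E) ∈ LinearMap.ker σ ⊓ C := ⟨hxR, x.2⟩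
    rw [hC.disjoint.eq_bot] at this
    exact Subtype.ext ((Submodule.mem_bot _).1 this)
  obtain ⟨v, hv⟩ := exists_orthonormal_of_symm (B := σ.restrict C) ⟨fun x y => hσ x y⟩
    ⟨hCl, fun y hy => hCl y fun x => by rw [hσ]; exact hy x⟩ hCf
  have hv' : ∀ i j, σ (v i) (v j) = if i = j then 1 else 0 := hv
  choose uα huα using hα
  choose uβ huβ using hβ
  let w := Module.finBasisOfFinrankEq ℂ (LinearMap.ker m) hz
  refine ⟨fun i => v i, uα, uβ, fun i => w i, hv', huα, huβ, fun i => (w i).2, ?_⟩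
  refine Fintype.linearIndependent_iff.2 fun c hc => ?_
  simp only [Fintype.sum_sum_type, Sum.elim_inl, Sum.elim_inr] at hc
  have h1 : ∀ i, c (.inl i) = 0 := fun i => by
    have := congrArg (fun x => σ x (v i)) hc
    simpa [hv', hRl] using this
  simp only [h1, zero_smul, Finset.sum_const_zero, zero_add] at hc
  have hc' : ∑ i, c (.inr (.inl i)) • uα i + (∑ i, c (.inr (.inr (.inl i))) • uβ i +
      ∑ i, c (.inr (.inr (.inr i))) • (w i : LinearMap.ker σ)) = 0 := by
    ext
    simpa using hc
  have h2 := congrArg m hc'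
  have hbz : ∀ i, m (w i) = 0 := fun i => (w i).2
  simp only [map_add, map_sum, map_smul, huα, huβ, hbz, smul_zero, Finset.sum_const_zero,
    add_zero, map_zero] at h2
  have h3 := Fintype.linearIndependent_iff.1 hf
    (Sum.elim (fun i => c (.inr (.inl i))) (fun i => c (.inr (.inr (.inl i)))))
    (by simpa [Fintype.sum_sum_type] using h2)
  have h4 : ∀ i, c (.inr (.inl i)) = 0 := fun i => h3 (.inl i)
  have h5 : ∀ i, c (.inr (.inr (.inl i))) = 0 := fun i => h3 (.inr i)
  simp only [h4, h5, zero_smul, Finset.sum_const_zero, zero_add] at hc'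
  have h6 := Fintype.linearIndependent_iff.1 w.linearIndependent
    (fun i => c (.inr (.inr (.inr i)))) (by
      ext
      simpa using congrArg Subtype.val hc')
  rintro (i | i | i | i)
  exacts [h1 i, h4 i, h5 i, h6 i]

/-- The matrix of `σ` in normal form. -/
def normalSym (ρ υ : Type*) [DecidableEq ρ] : Matrix (ρ ⊕ υ) (ρ ⊕ υ) ℂ :=
  Matrix.fromBlocks 1 0 0 0

/-- The matrix of the `Hom(E, E^⊥/E)`-component in normal form: the groups `α` and `β` of basis
vectors of the radical of `σ` are sent to the corresponding groups of basis vectors of `E^⊥/E`. -/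
def normalMix (ρ α β ζ γ : Type*) [DecidableEq α] [DecidableEq β] :
    Matrix (ρ ⊕ (α ⊕ (β ⊕ ζ))) ((β ⊕ β) ⊕ (α ⊕ γ)) ℂ :=
  Matrix.fromRows 0 (Matrix.fromRows (Matrix.fromCols 0 (Matrix.fromCols 1 0))
    (Matrix.fromRows (Matrix.fromCols (Matrix.fromCols 1 0) 0) 0))

section

variable {V : Type*} [AddCommGroup V] [Module ℂ V] {ω : BilinForm ℂ V} {E : Submodule ℂ V}

theorem exists_adaptedBasis [FiniteDimensional ℂ V] (hω : ω.IsAlt) {κ φ : Type*} [DecidableEq κ]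
    [Fintype κ] [Fintype φ] [DecidableEq φ] {G : Matrix φ φ ℂ} (hG : IsUnit G.det) {e d : κ → V}
    {f : φ → V} (ee : ∀ i j, ω (e i) (e j) = 0)
    (de : ∀ i j, ω (d i) (e j) = if i = j then 1 else 0) (dd : ∀ i j, ω (d i) (d j) = 0)
    (fe : ∀ p j, ω (f p) (e j) = 0) (fd : ∀ p j, ω (f p) (d j) = 0)
    (ff : ∀ p q, ω (f p) (f q) = G p q)
    (hcard : Module.finrank ℂ V = 2 * Fintype.card κ + Fintype.card φ)
    (hE : Submodule.span ℂ (Set.range e) = E) :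
    ∃ a : AdaptedBasis ω E κ φ G, a.e = e ∧ a.d = d ∧ a.f = f := by
  have ef : ∀ p j, ω (e j) (f p) = 0 := fun p j => hω.isRefl _ _ (fe p j)
  have df : ∀ p j, ω (d j) (f p) = 0 := fun p j => hω.isRefl _ _ (fd p j)
  have ed : ∀ i j, ω (e i) (d j) = -if j = i then 1 else 0 := fun i j => by
    rw [← hω.neg_eq, de]
  let b : (κ ⊕ κ) ⊕ φ → V := Sum.elim (Sum.elim e d) f
  have hb : ∀ i j, ω (b i) (b j) = Matrix.fromBlocks (-darbouxGram κ) 0 0 G i j := by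
    rintro ((i | i) | i) ((j | j) | j) <;>
      simp [b, darbouxGram, ee, de, dd, fe, fd, ff, ef, df, ed, Matrix.one_apply, eq_comm]
  have hdet : IsUnit (Matrix.fromBlocks (-darbouxGram κ) 0 0 G).det := by
    rw [Matrix.det_fromBlocks_zero₂₁, Matrix.det_neg]
    exact (IsUnit.mul ((isUnit_one.neg).pow _) (isUnit_det_darbouxGram κ)).mul hG
  have hli := linearIndependent_of_gram hdet hb
  have hc : Fintype.card ((κ ⊕ κ) ⊕ φ) = Module.finrank ℂ V := by
    simp only [Fintype.card_sum]
    omega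
  have hcoe : ⇑(basisOfLinearIndependentOfCardEqFinrank' b hli hc) = b :=
    coe_basisOfLinearIndependentOfCardEqFinrank' b hli hc
  refine ⟨⟨basisOfLinearIndependentOfCardEqFinrank' b hli hc, fun i j => ?_, ?_⟩, ?_, ?_, ?_⟩
  · rw [hcoe]
    exact hb i j
  · rw [hcoe]
    exact hE
  · ext i
    exact congrFun hcoe (.inl (.inl i))
  · ext i
    exact congrFun hcoe (.inl (.inr i))
  · ext i
    exact congrFun hcoe (.inr i)

/-- Vectors dual to a basis of `E`, and vectors of `E^⊥` with the right Gram matrix, become part of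
an adapted basis after adding suitable elements of `E`. -/
theorem exists_adaptedBasis_of_lifts [FiniteDimensional ℂ V] (hω : ω.IsAlt)
    (hE : E ≤ ω.orthogonal E) {κ φ : Type*} [DecidableEq κ] [Fintype κ] [Fintype φ] [DecidableEq φ]
    {G : Matrix φ φ ℂ} (hG : IsUnit G.det) {e w : κ → V} {f₀ : φ → V}
    (he : Submodule.span ℂ (Set.range e) = E)
    (hw : ∀ i j, ω (w i) (e j) = if i = j then 1 else 0) (hf : ∀ p, f₀ p ∈ ω.orthogonal E)
    (hff : ∀ p q, ω (f₀ p) (f₀ q) = G p q)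
    (hcard : Module.finrank ℂ V = 2 * Fintype.card κ + Fintype.card φ) :
    ∃ a : AdaptedBasis ω E κ φ G, a.e = e ∧ (∀ i, a.d i - w i ∈ E) ∧ ∀ p, a.f p - f₀ p ∈ E := by
  have hmem : ∀ i, e i ∈ E := fun i => he ▸ Submodule.subset_span (Set.mem_range_self i)
  have hee : ∀ i j, ω (e i) (e j) = 0 := fun i j => hE (hmem j) _ (hmem i)
  obtain ⟨d, hde, hdd, hdw⟩ := exists_isotropic_correction hω hee hw
  rw [he] at hdw
  have hef₀ : ∀ p i, ω (e i) (f₀ p) = 0 := fun p i => hf p _ (hmem i)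
  have hf₀e : ∀ p i, ω (f₀ p) (e i) = 0 := fun p i => hω.isRefl _ _ (hef₀ p i)
  have hed : ∀ i j, ω (e i) (d j) = -if j = i then 1 else 0 := fun i j => by
    rw [← hω.neg_eq, hde]
  let f : φ → V := fun p => f₀ p + ∑ i, ω (f₀ p) (d i) • e i
  obtain ⟨a, hae, had, haf⟩ := exists_adaptedBasis hω hG (f := f) hee hde
    hdd (fun p j => by simp [f, hf₀e, hee]) (fun p j => by simp [f, hed])
    (fun p q => by simp [f, hff, hf₀e, hef₀, hee]) hcard he
  refine ⟨a, hae, fun i => had ▸ hdw i, fun p => ?_⟩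
  simp only [haf, f, add_sub_cancel_left]
  exact Submodule.sum_mem _ fun i _ => E.smul_mem _ (hmem i)

theorem AdaptedBasis.repr_eq_of_sub_mem {κ φ : Type*} [DecidableEq κ] [Fintype κ] [Fintype φ]
    {G : Matrix φ φ ℂ} (a : AdaptedBasis ω E κ φ G) {u v : V} (h : u - v ∈ E) :
    (∀ j, a.b.repr u (.inl (.inr j)) = a.b.repr v (.inl (.inr j))) ∧
      ∀ p, a.b.repr u (.inr p) = a.b.repr v (.inr p) := by
  have h' := (a.mem_iff _).1 h
  refine ⟨fun j => sub_eq_zero.1 ?_, fun p => sub_eq_zero.1 ?_⟩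
  · rw [← h'.1 j, map_sub, Finsupp.sub_apply]
  · rw [← h'.2 p, map_sub, Finsupp.sub_apply]

/-- A class is in normal form if, modulo `E`, it sends the basis of `E` to dual vectors, to basis vectors
of `E^⊥` and to zero, according to the group of indices. -/
theorem coord_eq_normal {ρ α β ζ γ : Type*} [Fintype ρ] [Fintype α] [Fintype β] [Fintype ζ]
    [Fintype γ] [DecidableEq ρ] [DecidableEq α] [DecidableEq β] [DecidableEq ζ]
    {G : Matrix ((β ⊕ β) ⊕ (α ⊕ γ)) ((β ⊕ β) ⊕ (α ⊕ γ)) ℂ}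
    (a : AdaptedBasis ω E (ρ ⊕ (α ⊕ (β ⊕ ζ))) ((β ⊕ β) ⊕ (α ⊕ γ)) G) (X : spAlgebra ω)
    (hρ : ∀ i, (X : Module.End ℂ V) (a.e (.inl i)) - a.d (.inl i) ∈ E)
    (hα : ∀ i, (X : Module.End ℂ V) (a.e (.inr (.inl i))) - a.f (.inr (.inl i)) ∈ E)
    (hβ : ∀ i, (X : Module.End ℂ V) (a.e (.inr (.inr (.inl i)))) - a.f (.inl (.inl i)) ∈ E)
    (hζ : ∀ i, (X : Module.End ℂ V) (a.e (.inr (.inr (.inr i)))) ∈ E) :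
    a.symCoord ((parabolicAlgebra ω E).toSubmodule.mkQ X) = normalSym _ _ ∧
      a.mixCoord ((parabolicAlgebra ω E).toSubmodule.mkQ X) = normalMix _ _ _ _ _ := by
  classical
  constructor
  · ext i j
    rw [a.symCoord_mk]
    rcases i with i | i | i | i
    · rw [(a.repr_eq_of_sub_mem (hρ i)).1, AdaptedBasis.d, Module.Basis.repr_self]
      rcases j with j | j <;>
        simp [normalSym, Matrix.one_apply, Finsupp.single_apply]
    · rw [(a.repr_eq_of_sub_mem (hα i)).1, AdaptedBasis.f, Module.Basis.repr_self]
      rcases j with j | j <;> simp [normalSym]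
    · rw [(a.repr_eq_of_sub_mem (hβ i)).1, AdaptedBasis.f, Module.Basis.repr_self]
      rcases j with j | j <;> simp [normalSym]
    · rw [((a.mem_iff _).1 (hζ i)).1]
      rcases j with j | j <;> simp [normalSym]
  · ext i p
    rw [a.mixCoord_mk]
    rcases i with i | i | i | i
    · rw [(a.repr_eq_of_sub_mem (hρ i)).2, AdaptedBasis.d, Module.Basis.repr_self]
      simp [normalMix]
    · rw [(a.repr_eq_of_sub_mem (hα i)).2, AdaptedBasis.f, Module.Basis.repr_self]
      rcases p with (p | p) | p | p <;>
        simp [normalMix, Matrix.one_apply, Finsupp.single_apply]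
    · rw [(a.repr_eq_of_sub_mem (hβ i)).2, AdaptedBasis.f, Module.Basis.repr_self]
      rcases p with (p | p) | p | p <;>
        simp [normalMix, Matrix.one_apply, Finsupp.single_apply]
    · rw [((a.mem_iff _).1 (hζ i)).2]
      simp [normalMix]

theorem reducedForm_isAlt (hω : ω.IsAlt) : (reducedForm ω hω E).IsAlt := by
  intro x
  obtain ⟨x, rfl⟩ := Submodule.Quotient.mk_surjective _ x
  exact hω (x : V)

theorem reducedForm_nondegenerate [FiniteDimensional ℂ V] (hω : ω.IsAlt) (hnd : ω.Nondegenerate) :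
    (reducedForm ω hω E).Nondegenerate := by
  refine LinearMap.BilinForm.IsAlt.nondegenerate_of_forall (reducedForm_isAlt hω) fun x hx => ?_
  obtain ⟨x, rfl⟩ := Submodule.Quotient.mk_surjective _ x
  refine (Submodule.Quotient.mk_eq_zero _).2 ?_
  refine (BilinForm.orthogonal_orthogonal hnd hω.isRefl E).le fun y hy => ?_
  exact hω.isRefl _ _ (hx (Submodule.Quotient.mk ⟨y, hy⟩))

theorem finrank_perpQuotient_add [FiniteDimensional ℂ V] (hnd : ω.Nondegenerate)
    (hE : E ≤ ω.orthogonal E) : Module.finrank ℂ (perpQuotient ω E) + 2 * Module.finrank ℂ E =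
      Module.finrank ℂ V := by
  have h1 := BilinForm.finrank_orthogonal hnd E
  have h2 := Submodule.finrank_quotient_add_finrank (E.submoduleOf (ω.orthogonal E))
  have h3 : Module.finrank ℂ (E.submoduleOf (ω.orthogonal E)) = Module.finrank ℂ E :=
    (Submodule.submoduleOfEquivOfLe hE).finrank_eq
  have h4 := Submodule.finrank_le E
  change Module.finrank ℂ (perpQuotient ω E) + _ = _ at h2
  omega

/-- Every class with invariants `(r, h, t)` is in normal form with respect to some adapted basis. -/
theorem exists_normal_form [FiniteDimensional ℂ V] (hω : ω.IsAlt) (hnd : ω.Nondegenerate)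
    (hE : E ≤ ω.orthogonal E) {r s t z l : ℕ} (hEk : Module.finrank ℂ E = r + 2 * s + t + z)
    (hV : Module.finrank ℂ V = 2 * (r + 2 * s + t + z) + (2 * t + 2 * s + 2 * l))
    (X : spAlgebra ω) (hr : Module.finrank ℂ (LinearMap.range (symPart ω E X)) = r)
    (hh : Module.finrank ℂ (LinearMap.range (mixedPart ω hω E X)) = 2 * s + t)
    (ht : Module.finrank ℂ (LinearMap.range
      ((reducedForm ω hω E).restrict (LinearMap.range (mixedPart ω hω E X)))) = 2 * s) :
    ∃ a : AdaptedBasis ω E (Fin r ⊕ ((Fin s ⊕ Fin s) ⊕ (Fin t ⊕ Fin z)))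
        ((Fin t ⊕ Fin t) ⊕ ((Fin s ⊕ Fin s) ⊕ (Fin l ⊕ Fin l)))
        (blockGram (Fin t) (Fin s) (Fin l)),
      a.symCoord ((parabolicAlgebra ω E).toSubmodule.mkQ X) = normalSym _ _ ∧
      a.mixCoord ((parabolicAlgebra ω E).toSubmodule.mkQ X) = normalMix _ _ _ _ _ := by
  have hmk : ∀ x : LinearMap.ker (symPart ω E X), ∀ y : ω.orthogonal E,
      mixedPart ω hω E X x = Submodule.Quotient.mk y →
        (X : Module.End ℂ V) (x : E) - (y : V) ∈ E := fun x y hxy =>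
    (Submodule.Quotient.eq (E.submoduleOf (ω.orthogonal E))).1 hxy
  have hsymm : ∀ x y : E, symPart ω E X x y = symPart ω E X y x := by
    intro x y
    have h : ∀ x y, ω ((X : Module.End ℂ V) x) y = ω x (-(X : Module.End ℂ V) y) :=
      (ω.mem_skewAdjointSubmodule _).1 X.2
    change ω ((X : Module.End ℂ V) x) y = ω ((X : Module.End ℂ V) y) x
    rw [h, map_neg, hω.neg_eq]
  obtain ⟨s', l', f, hs', hl', hf, hfW⟩ := exists_darboux_adapted (reducedForm_isAlt hω)
    (reducedForm_nondegenerate hω hnd) (LinearMap.range (mixedPart ω hω E X)) hh ht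
  have hperp := finrank_perpQuotient_add hnd hE
  obtain rfl : s' = s := by omega
  obtain rfl : l' = l := by omega
  have hfli := linearIndependent_of_gram (isUnit_det_blockGram _ _ _) hf
  have hz : Module.finrank ℂ (LinearMap.ker (mixedPart ω hω E X)) = z := by
    have h1 := LinearMap.finrank_range_add_finrank_ker (mixedPart ω hω E X)
    have h2 := LinearMap.finrank_range_add_finrank_ker (symPart ω E X)
    omega
  obtain ⟨v, uα, uβ, w₀, hv, huα, huβ, hw₀, heli⟩ := exists_family_adapted_to_radical hsymm
    (mixedPart ω hω E X) (fα := fun i => f (.inr (.inl i))) (fβ := fun i => f (.inl (.inl i)))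
    (fun i => by
      rw [hfW]
      exact Submodule.mem_sup_right (Submodule.subset_span ⟨i, rfl⟩))
    (fun i => by
      rw [hfW]
      exact Submodule.mem_sup_left (Submodule.subset_span ⟨i, rfl⟩))
    (by
      convert! hfli.comp (Sum.elim (fun i => .inr (.inl i)) (fun i => .inl (.inl i))) (by
        rintro (i | i) (j | j) h <;> simp_all) using 1
      ext (i | i) <;> rfl) hr hz
  have hRr : ∀ (x : LinearMap.ker (symPart ω E X)) (y : E), symPart ω E X y x = 0 := fun x y => by
    rw [hsymm]
    exact LinearMap.congr_fun x.2 y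
  generalize he' : Sum.elim v (Sum.elim (fun i => (uα i : E)) (Sum.elim (fun i => (uβ i : E))
        (fun i => (w₀ i : E)))) = e' at heli
  have he'ρ : ∀ i, e' (.inl i) = v i := fun i => by rw [← he']; rfl
  have he'α : ∀ i, e' (.inr (.inl i)) = uα i := fun i => by rw [← he']; rfl
  have he'β : ∀ i, e' (.inr (.inr (.inl i))) = uβ i := fun i => by rw [← he']; rfl
  have he'ζ : ∀ i, e' (.inr (.inr (.inr i))) = w₀ i := fun i => by rw [← he']; rfl
  let e : Fin r ⊕ ((Fin s' ⊕ Fin s') ⊕ (Fin t ⊕ Fin z)) → V := fun i => e' i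
  have hecard : Fintype.card (Fin r ⊕ ((Fin s' ⊕ Fin s') ⊕ (Fin t ⊕ Fin z))) =
      Module.finrank ℂ E := by
    simp only [Fintype.card_sum, Fintype.card_fin]
    omega
  have heliV : LinearIndependent ℂ e := heli.map' E.subtype E.ker_subtype
  have hespan : Submodule.span ℂ (Set.range e) = E := by
    refine Submodule.eq_of_le_of_finrank_eq (Submodule.span_le.2 ?_) ?_
    · rintro _ ⟨i, rfl⟩
      exact (e' i).2
    · rw [finrank_span_eq_card heliV, hecard]
  -- the values of `X` on the orthonormal family are part of a dual family
  obtain ⟨w, hw⟩ := exists_dual_family hnd heliV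
  let w' : Fin r ⊕ ((Fin s' ⊕ Fin s') ⊕ (Fin t ⊕ Fin z)) → V :=
    Sum.elim (fun i => (X : Module.End ℂ V) (e (.inl i))) (fun i => w (.inr i))
  have hw' : ∀ i j, ω (w' i) (e j) = if i = j then 1 else 0 := by
    rintro (i | i) j
    · change symPart ω E X (e' (.inl i)) (e' j) = _
      rw [he'ρ]
      rcases j with j | j | j | j
      · rw [he'ρ, hv]
        simp
      · rw [he'α, hRr]
        simp
      · rw [he'β, hRr]
        simp
      · rw [he'ζ, hRr]
        simp
    · exact hw _ _
  choose f₀ hf₀ using fun p => Submodule.Quotient.mk_surjective _ (f p)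
  have hf₀f₀ : ∀ p q, ω (f₀ p) (f₀ q) = blockGram (Fin t) (Fin s') (Fin l') p q := fun p q => by
    rw [← hf p q, ← hf₀ p, ← hf₀ q]
    rfl
  obtain ⟨a, hae, had, haf⟩ := exists_adaptedBasis_of_lifts hω hE (isUnit_det_blockGram _ _ _)
    hespan hw' (fun p => (f₀ p).2) hf₀f₀ (by
      simp only [Fintype.card_sum, Fintype.card_fin]
      omega)
  have hXf : ∀ (x : LinearMap.ker (symPart ω E X)) p, mixedPart ω hω E X x = f p →
      (X : Module.End ℂ V) (x : E) - a.f p ∈ E := fun x p hx => by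
    have h1 := hmk x (f₀ p) (hx.trans (hf₀ p).symm)
    have h2 := E.sub_mem h1 (haf p)
    rwa [sub_sub_sub_cancel_right] at h2
  have hae' : ∀ i, a.e i = e' i := fun i => congrFun hae i
  refine ⟨a, coord_eq_normal a X (fun i => ?_) (fun i => ?_) (fun i => ?_) (fun i => ?_)⟩
  · rw [hae, ← neg_sub]
    exact E.neg_mem (had (.inl i))
  · rw [hae', he'α]
    exact hXf _ _ (huα i)
  · rw [hae', he'β]
    exact hXf _ _ (huβ i)
  · rw [hae', he'ζ]
    simpa using hmk _ 0 (hw₀ i)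

end

/-! ### A chart of the orbit: the mixed component -/

section Chart

open Matrix

variable {α β ζ μ : Type*} [Fintype α] [Fintype β] [Fintype ζ] [Fintype μ] [DecidableEq α]
  [DecidableEq β] [DecidableEq μ]

/-- The Gram matrix of a space with a basis consisting of hyperbolic pairs indexed by `β` and of
further vectors with Gram matrix `J`. -/
def hypGram (β : Type*) [DecidableEq β] (J : Matrix μ μ ℂ) :
    Matrix ((β ⊕ β) ⊕ μ) ((β ⊕ β) ⊕ μ) ℂ :=
  fromBlocks (darbouxGram β) 0 0 J

/-- A `β`-tuple of vectors that span an isotropic subspace; every isotropic subspace that projects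
isomorphically to the first `β` coordinates has a unique basis of this form with `S` symmetric. -/
def isotropicRows (J : Matrix μ μ ℂ) (X : Matrix β μ ℂ) (S : Matrix β β ℂ) :
    Matrix β ((β ⊕ β) ⊕ μ) ℂ :=
  fromCols (fromCols 1 (S + (2⁻¹ : ℂ) • (X * J * Xᵀ))) X

/-- Vectors orthogonal to the rows of `isotropicRows J X S`, with vanishing first `β`
coordinates. -/
def orthogonalRows (J : Matrix μ μ ℂ) (X : Matrix β μ ℂ) (C : Matrix α μ ℂ) :
    Matrix α ((β ⊕ β) ⊕ μ) ℂ :=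
  fromCols (fromCols 0 (C * J * Xᵀ)) C

/-- A parametrization of the matrices whose rows span a subspace with radical of dimension `|β|`
and with `|α|`-dimensional quotient by the radical. -/
def mixChart {υ : Type*} (J : Matrix μ μ ℂ) (X : Matrix β μ ℂ) (S : Matrix β β ℂ)
    (C : Matrix α μ ℂ) (D : Matrix υ α ℂ) (M : Matrix (α ⊕ υ) β ℂ) :
    Matrix (α ⊕ υ) ((β ⊕ β) ⊕ μ) ℂ :=
  fromRows 1 D * orthogonalRows J X C + M * isotropicRows J X S

/-- The rows of `K` with index in `α` or `β`. -/
def mainRows (K : Matrix (α ⊕ (β ⊕ ζ)) ((β ⊕ β) ⊕ μ) ℂ) : Matrix (α ⊕ β) ((β ⊕ β) ⊕ μ) ℂ :=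
  K.submatrix (Sum.map id Sum.inl) id

/-- The matrix of pairings of the main rows of `K` with its rows indexed by `α` and with the basis
vectors in the second half of the hyperbolic pairs. Its invertibility defines the domain of the
chart. -/
def pairingMatrix (J : Matrix μ μ ℂ) (K : Matrix (α ⊕ (β ⊕ ζ)) ((β ⊕ β) ⊕ μ) ℂ) :
    Matrix (α ⊕ β) (α ⊕ β) ℂ :=
  fromCols (mainRows K * hypGram β J * (K.submatrix Sum.inl id)ᵀ)
    ((mainRows K).submatrix id (Sum.inl ∘ Sum.inl))

theorem toBilin'_vecMul {m n φ : Type*} [Fintype m] [Fintype n] [Fintype φ] [DecidableEq φ]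
    (G : Matrix φ φ ℂ) (M : Matrix m φ ℂ) (M' : Matrix n φ ℂ) (c : m → ℂ) (c' : n → ℂ) :
    toBilin' G (c ᵥ* M) (c' ᵥ* M') = c ⬝ᵥ (M * G * M'ᵀ) *ᵥ c' := by
  rw [toBilin'_apply', dotProduct_mulVec, vecMul_vecMul, ← mulVec_transpose M', ← mulVec_mulVec,
    dotProduct_mulVec (v := c)]

theorem toBilin'_row {m n φ : Type*} [Fintype m] [Fintype n] [Fintype φ] [DecidableEq φ]
    (G : Matrix φ φ ℂ) (M : Matrix m φ ℂ) (M' : Matrix n φ ℂ) (i : m) (j : n) :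
    toBilin' G (M i) (M' j) = (M * G * M'ᵀ) i j := by
  rw [toBilin'_apply', dotProduct_mulVec]
  rfl

omit [Fintype β] [Fintype μ] [DecidableEq μ] in
theorem hypGram_transpose {J : Matrix μ μ ℂ} (hJ : Jᵀ = -J) :
    (hypGram β J)ᵀ = -hypGram β J := by
  simp [hypGram, darbouxGram, fromBlocks_transpose, hJ, fromBlocks_neg]

theorem toBilin'_swap {φ : Type*} [Fintype φ] [DecidableEq φ] {G : Matrix φ φ ℂ} (hG : Gᵀ = -G)
    (x y : φ → ℂ) : toBilin' G x y = -toBilin' G y x := by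
  rw [toBilin'_apply', toBilin'_apply', dotProduct_mulVec, ← mulVec_transpose, hG, neg_mulVec,
    neg_dotProduct, dotProduct_comm]

omit [DecidableEq μ] in
theorem isotropic_mul (J : Matrix μ μ ℂ) (X : Matrix β μ ℂ) (Y : Matrix β β ℂ) :
    (fromCols (fromCols (1 : Matrix β β ℂ) Y) X : Matrix β ((β ⊕ β) ⊕ μ) ℂ) * hypGram β J *
      (fromCols (fromCols (1 : Matrix β β ℂ) Y) X : Matrix β ((β ⊕ β) ⊕ μ) ℂ)ᵀ =
        Yᵀ - Y + X * J * Xᵀ := by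
  simp [hypGram, darbouxGram, fromCols_mul_fromBlocks, transpose_fromCols, fromCols_mul_fromRows,
    sub_eq_add_neg, add_comm]

omit [Fintype α] [DecidableEq α] [DecidableEq μ] in
theorem orthogonal_mul (J : Matrix μ μ ℂ) (X : Matrix β μ ℂ) (Y : Matrix β β ℂ)
    (A : Matrix α β ℂ) (C : Matrix α μ ℂ) :
    (fromCols (fromCols (0 : Matrix α β ℂ) A) C : Matrix α ((β ⊕ β) ⊕ μ) ℂ) * hypGram β J *
      (fromCols (fromCols (1 : Matrix β β ℂ) Y) X : Matrix β ((β ⊕ β) ⊕ μ) ℂ)ᵀ =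
        -A + C * J * Xᵀ := by
  simp [hypGram, darbouxGram, fromCols_mul_fromBlocks, transpose_fromCols, fromCols_mul_fromRows]

omit [DecidableEq μ] in
theorem isotropicRows_mul {J : Matrix μ μ ℂ} (hJ : Jᵀ = -J) (X : Matrix β μ ℂ) {S : Matrix β β ℂ}
    (hS : Sᵀ = S) :
    isotropicRows J X S * hypGram β J * (isotropicRows J X S)ᵀ = 0 := by
  rw [isotropicRows, isotropic_mul]
  simp only [transpose_add, transpose_smul, transpose_mul, transpose_transpose, hJ, hS,
    Matrix.neg_mul, Matrix.mul_neg, Matrix.mul_assoc]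
  module

omit [Fintype α] [DecidableEq α] [DecidableEq μ] in
theorem orthogonalRows_mul (J : Matrix μ μ ℂ) (X : Matrix β μ ℂ) (S : Matrix β β ℂ)
    (C : Matrix α μ ℂ) :
    orthogonalRows J X C * hypGram β J * (isotropicRows J X S)ᵀ = 0 := by
  rw [isotropicRows, orthogonalRows, orthogonal_mul]
  simp

/-- The radical of a bilinear form on a subspace. -/
def radicalOn {φ : Type*} [Fintype φ] [DecidableEq φ] (G : Matrix φ φ ℂ) (W : Submodule ℂ (φ → ℂ)) :
    Submodule ℂ (φ → ℂ) :=
  (LinearMap.ker ((toBilin' G).restrict W)).map W.subtype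

theorem mem_radicalOn {φ : Type*} [Fintype φ] [DecidableEq φ] {G : Matrix φ φ ℂ}
    {W : Submodule ℂ (φ → ℂ)} {w : φ → ℂ} :
    w ∈ radicalOn G W ↔ w ∈ W ∧ ∀ w' ∈ W, toBilin' G w w' = 0 := by
  constructor
  · rintro ⟨w, hw, rfl⟩
    exact ⟨w.2, fun w' hw' => LinearMap.congr_fun hw ⟨w', hw'⟩⟩
  · rintro ⟨hw, h⟩
    exact ⟨⟨w, hw⟩, LinearMap.mem_ker.2 (LinearMap.ext fun y => h y y.2), rfl⟩

theorem finrank_range_add_finrank_radicalOn {φ : Type*} [Fintype φ] [DecidableEq φ]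
    (G : Matrix φ φ ℂ) (W : Submodule ℂ (φ → ℂ)) :
    Module.finrank ℂ (LinearMap.range ((toBilin' G).restrict W)) +
      Module.finrank ℂ (radicalOn G W) = Module.finrank ℂ W := by
  rw [radicalOn, Submodule.finrank_map_subtype_eq]
  exact LinearMap.finrank_range_add_finrank_ker _

section Pairing

variable {J : Matrix μ μ ℂ} {K : Matrix (α ⊕ (β ⊕ ζ)) ((β ⊕ β) ⊕ μ) ℂ}

omit [Fintype μ] [DecidableEq α] [DecidableEq β] [DecidableEq μ] in
theorem range_mainRows_le : LinearMap.range (mainRows K).vecMulLinear ≤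
    LinearMap.range K.vecMulLinear := by
  rw [range_vecMulLinear, range_vecMulLinear]
  refine Submodule.span_mono ?_
  rintro _ ⟨i, rfl⟩
  exact ⟨_, rfl⟩

omit [Fintype ζ] in
theorem eq_zero_of_pairing (hP : (pairingMatrix J K).det ≠ 0) {c : α ⊕ β → ℂ}
    (h1 : ∀ i, toBilin' (hypGram β J) (c ᵥ* mainRows K) (K (.inl i)) = 0)
    (h2 : ∀ j, (c ᵥ* mainRows K) (.inl (.inl j)) = 0) : c = 0 := by
  refine eq_zero_of_vecMul_eq_zero hP ?_
  ext (i | j)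
  · have := h1 i
    rw [toBilin'_apply', dotProduct_mulVec, vecMul_vecMul] at this
    rw [pairingMatrix, vecMul_fromCols, Sum.elim_inl, ← vecMul_vecMul]
    exact this
  · exact h2 j

omit [Fintype ζ] in
theorem finrank_range_mainRows (hP : (pairingMatrix J K).det ≠ 0) :
    Module.finrank ℂ (LinearMap.range (mainRows K).vecMulLinear) =
      Fintype.card α + Fintype.card β := by
  have : Function.Injective (mainRows K).vecMulLinear := by
    refine (injective_iff_map_eq_zero _).2 fun c hc => eq_zero_of_pairing hP (fun i => ?_) fun j => ?_
    · have hc' : c ᵥ* mainRows K = 0 := hc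
      rw [hc', map_zero, LinearMap.zero_apply]
    · have hc' : c ᵥ* mainRows K = 0 := hc
      rw [hc', Pi.zero_apply]
  rw [LinearMap.finrank_range_of_inj this]
  simp

theorem row_mem_range {m n : Type*} [Fintype m] (A : Matrix m n ℂ) (i : m) :
    A i ∈ LinearMap.range A.vecMulLinear := by
  rw [range_vecMulLinear]
  exact Submodule.subset_span ⟨i, rfl⟩

/-- The first `β` coordinates of a vector. -/
def firstCoord (β μ : Type*) : ((β ⊕ β) ⊕ μ → ℂ) →ₗ[ℂ] (β → ℂ) :=
  LinearMap.funLeft ℂ ℂ (Sum.inl ∘ Sum.inl)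

/-- On the domain of the chart, the radical of the row space projects injectively to the first `β`
coordinates. -/
theorem eq_zero_of_mem_radicalOn (hP : (pairingMatrix J K).det ≠ 0)
    (hW : LinearMap.range K.vecMulLinear = LinearMap.range (mainRows K).vecMulLinear)
    {w : (β ⊕ β) ⊕ μ → ℂ}
    (hw : w ∈ radicalOn (hypGram β J) (LinearMap.range K.vecMulLinear))
    (hw' : firstCoord β μ w = 0) : w = 0 := by
  obtain ⟨h1, h2⟩ := mem_radicalOn.1 hw
  rw [hW] at h1
  obtain ⟨c, rfl⟩ := h1
  have : c = 0 := eq_zero_of_pairing hP (fun i => h2 _ (row_mem_range K _)) (congrFun hw')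
  rw [this, map_zero]

theorem finrank_radicalOn_le (hP : (pairingMatrix J K).det ≠ 0)
    (hW : LinearMap.range K.vecMulLinear = LinearMap.range (mainRows K).vecMulLinear) :
    Module.finrank ℂ (radicalOn (hypGram β J) (LinearMap.range K.vecMulLinear)) ≤
      Fintype.card β := by
  have := LinearMap.finrank_le_finrank_of_injective
    (f := (firstCoord β μ).domRestrict (radicalOn (hypGram β J) (LinearMap.range K.vecMulLinear)))
    ((injective_iff_map_eq_zero _).2 fun w hw => Subtype.ext
      (eq_zero_of_mem_radicalOn hP hW w.2 hw))
  simpa using this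

/-- On the domain of the chart, the row space of a matrix of the form `mixChart` has dimension
`|α| + |β|` and the form has rank `|α|` on it. -/
theorem finrank_of_mixChart (hJ : Jᵀ = -J) {X : Matrix β μ ℂ} {S : Matrix β β ℂ}
    {C : Matrix α μ ℂ} {D : Matrix (β ⊕ ζ) α ℂ} {M : Matrix (α ⊕ (β ⊕ ζ)) β ℂ} (hS : Sᵀ = S)
    (hK : K = mixChart J X S C D M) (hP : (pairingMatrix J K).det ≠ 0) :
    Module.finrank ℂ (LinearMap.range K.vecMulLinear) = Fintype.card α + Fintype.card β ∧
    Module.finrank ℂ (LinearMap.range ((toBilin' (hypGram β J)).restrict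
      (LinearMap.range K.vecMulLinear))) = Fintype.card α := by
  let T : Matrix (α ⊕ β) ((β ⊕ β) ⊕ μ) ℂ := fromRows (orthogonalRows J X C) (isotropicRows J X S)
  have hKT : K = fromCols (fromRows 1 D) M * T := by
    rw [hK, mixChart, fromCols_mul_fromRows]
  have hle : LinearMap.range K.vecMulLinear ≤ LinearMap.range T.vecMulLinear := by
    rintro _ ⟨v, rfl⟩
    refine ⟨v ᵥ* fromCols (fromRows 1 D) M, ?_⟩
    simp only [vecMulLinear_apply, vecMul_vecMul, ← hKT]
  have hT : Module.finrank ℂ (LinearMap.range T.vecMulLinear) ≤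
      Fintype.card α + Fintype.card β := by
    have := LinearMap.finrank_range_le T.vecMulLinear
    simpa using this
  have hR := finrank_range_mainRows hP
  have h1 := Submodule.finrank_mono hle
  have h2 := Submodule.finrank_mono (range_mainRows_le (K := K))
  have hW : LinearMap.range (mainRows K).vecMulLinear = LinearMap.range K.vecMulLinear :=
    Submodule.eq_of_le_of_finrank_le range_mainRows_le (by omega)
  have hWT : LinearMap.range K.vecMulLinear = LinearMap.range T.vecMulLinear :=
    Submodule.eq_of_le_of_finrank_le hle (by omega)
  refine ⟨by omega, ?_⟩
  have hrad := finrank_radicalOn_le hP hW.symm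
  have hsum := finrank_range_add_finrank_radicalOn (hypGram β J) (LinearMap.range K.vecMulLinear)
  have hτ : LinearMap.range (isotropicRows J X S).vecMulLinear ≤
      radicalOn (hypGram β J) (LinearMap.range K.vecMulLinear) := by
    rintro _ ⟨c, rfl⟩
    refine mem_radicalOn.2 ⟨?_, fun w' hw' => ?_⟩
    · rw [hWT]
      exact ⟨Sum.elim 0 c, by simp [T, vecMul_fromRows]⟩
    · rw [hWT] at hw'
      obtain ⟨c', rfl⟩ := hw'
      rw [toBilin'_swap (hypGram_transpose hJ)]
      simp only [vecMulLinear_apply]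
      rw [toBilin'_vecMul]
      have : T * hypGram β J * (isotropicRows J X S)ᵀ = 0 := by
        simp only [T, fromRows_mul, isotropicRows_mul hJ X hS, orthogonalRows_mul]
        simp
      rw [this]
      simp
  have hτ' : Module.finrank ℂ (LinearMap.range (isotropicRows J X S).vecMulLinear) =
      Fintype.card β := by
    rw [LinearMap.finrank_range_of_inj]
    · simp
    · refine (injective_iff_map_eq_zero _).2 fun c hc => ?_
      have hc' : c ᵥ* isotropicRows J X S = 0 := hc
      ext j
      have := congrFun hc' (.inl (.inl j))
      rw [isotropicRows, vecMul_fromCols, Sum.elim_inl, vecMul_fromCols, Sum.elim_inl,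
        vecMul_one] at this
      exact this
  have h3 := Submodule.finrank_mono hτ
  omega

/-- On the domain of the chart, every matrix whose row space has dimension `|α| + |β|`, with the
form of rank `|α|` on it, is of the form `mixChart`: the rows of `isotropicRows J X S` are the basis
of the radical of the row space that is dual to the first `β` coordinates, and the rows of
`orthogonalRows J X C` are a basis of the subspace where these coordinates vanish. -/
theorem exists_mixChart (hJ : Jᵀ = -J) (hP : (pairingMatrix J K).det ≠ 0)
    (h1 : Module.finrank ℂ (LinearMap.range K.vecMulLinear) = Fintype.card α + Fintype.card β)
    (h2 : Module.finrank ℂ (LinearMap.range ((toBilin' (hypGram β J)).restrict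
      (LinearMap.range K.vecMulLinear))) = Fintype.card α) :
    ∃ (X : Matrix β μ ℂ) (S : Matrix β β ℂ) (C : Matrix α μ ℂ) (D : Matrix (β ⊕ ζ) α ℂ)
      (M : Matrix (α ⊕ (β ⊕ ζ)) β ℂ), Sᵀ = S ∧ K = mixChart J X S C D M := by
  set W := LinearMap.range K.vecMulLinear with hWdef
  have hW : W = LinearMap.range (mainRows K).vecMulLinear :=
    (Submodule.eq_of_le_of_finrank_le range_mainRows_le
      (by rw [finrank_range_mainRows hP, ← hWdef, h1])).symm
  have hKW : ∀ i, K i ∈ W := row_mem_range K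
  set rad := radicalOn (hypGram β J) W with hrad
  have hradW : rad ≤ W := fun w hw => (mem_radicalOn.1 hw).1
  have hrad_zero : ∀ w ∈ rad, firstCoord β μ w = 0 → w = 0 := fun w hw hw' =>
    eq_zero_of_mem_radicalOn hP hW hw hw'
  have hradf : Module.finrank ℂ rad = Fintype.card β := by
    have := finrank_range_add_finrank_radicalOn (hypGram β J) W
    rw [← hrad] at this
    omega
  have hinj : Function.Injective ((firstCoord β μ).domRestrict rad) :=
    (injective_iff_map_eq_zero _).2 fun w hw => Subtype.ext (hrad_zero w w.2 hw)
  have hsurj : Function.Surjective ((firstCoord β μ).domRestrict rad) :=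
    (LinearMap.injective_iff_surjective_of_finrank_eq_finrank (by simpa using hradf)).1 hinj
  choose τ' hτ' using fun j : β => hsurj (Pi.single j 1)
  let τ : Matrix β ((β ⊕ β) ⊕ μ) ℂ := fun j => τ' j
  have hτmem : ∀ j, τ j ∈ rad := fun j => (τ' j).2
  have hτ1 : ∀ j j', τ j (.inl (.inl j')) = if j = j' then 1 else 0 := fun j j' => by
    have := congrFun (hτ' j) j'
    rw [Pi.single_apply] at this
    simp only [eq_comm (a := j)]
    exact this
  let Y : Matrix β β ℂ := fun j i => τ j (.inl (.inr i))
  let X : Matrix β μ ℂ := fun j m => τ j (.inr m)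
  have hτeq : τ = fromCols (fromCols 1 Y) X := by
    ext j ((i | i) | i)
    · simp [hτ1, one_apply]
    · rfl
    · rfl
  have hτmul : ∀ c : β → ℂ, c ᵥ* τ ∈ rad := fun c => by
    have : LinearMap.range τ.vecMulLinear ≤ rad := by
      rw [range_vecMulLinear, Submodule.span_le]
      rintro _ ⟨j, rfl⟩
      exact hτmem j
    exact this ⟨c, rfl⟩
  -- the isotropy of `τ` determines the skew-symmetric part of `Y`
  have hYX : Yᵀ - Y + X * J * Xᵀ = 0 := by
    rw [← isotropic_mul, ← hτeq]
    ext i j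
    rw [← toBilin'_row]
    exact (mem_radicalOn.1 (hτmem i)).2 _ (hradW (hτmem j))
  let S : Matrix β β ℂ := Y - (2⁻¹ : ℂ) • (X * J * Xᵀ)
  have hτS : τ = isotropicRows J X S := by
    rw [hτeq, isotropicRows]
    simp [S]
  have hS : Sᵀ = S := by
    have h3 : Yᵀ = Y - X * J * Xᵀ := by
      rw [← sub_eq_zero, ← hYX]
      abel
    simp only [S, transpose_sub, transpose_smul, transpose_mul, transpose_transpose, hJ, h3,
      Matrix.neg_mul, Matrix.mul_neg, Matrix.mul_assoc]
    module
  let M : Matrix (α ⊕ (β ⊕ ζ)) β ℂ := K.submatrix id (Sum.inl ∘ Sum.inl)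
  let L := K - M * τ
  have hLrow : ∀ i, L i = K i - M i ᵥ* τ := fun i => rfl
  have hLW : ∀ i, L i ∈ W := fun i => by
    rw [hLrow]
    exact W.sub_mem (hKW i) (hradW (hτmul _))
  have hL0 : ∀ i, firstCoord β μ (L i) = 0 := fun i => by
    ext j
    change K i _ - (M i ᵥ* τ) (.inl (.inl j)) = 0
    rw [hτeq, vecMul_fromCols, Sum.elim_inl, vecMul_fromCols, Sum.elim_inl, vecMul_one]
    exact sub_self _
  let a : Matrix α ((β ⊕ β) ⊕ μ) ℂ := fun i => L (.inl i)
  let C : Matrix α μ ℂ := fun i m => a i (.inr m)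
  let A : Matrix α β ℂ := fun i j => a i (.inl (.inr j))
  have haeq : a = fromCols (fromCols 0 A) C := by
    ext i ((j | j) | j)
    · exact congrFun (hL0 (.inl i)) j
    · rfl
    · rfl
  have hAC : A = C * J * Xᵀ := by
    have : -A + C * J * Xᵀ = 0 := by
      rw [← orthogonal_mul J X Y, ← haeq, ← hτeq]
      ext i j
      rw [← toBilin'_row, toBilin'_swap (hypGram_transpose hJ),
        (mem_radicalOn.1 (hτmem j)).2 _ (hLW _), neg_zero, Matrix.zero_apply]
    rw [← sub_eq_zero, ← neg_eq_zero, ← this]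
    abel
  have haC : a = orthogonalRows J X C := by
    rw [haeq, hAC, orthogonalRows]
  -- the rows of `a` form a basis of the subspace of `W` where the first coordinates vanish
  have hainj : Function.Injective a.vecMulLinear := by
    refine (injective_iff_map_eq_zero _).2 fun c hc => ?_
    have hc' : c ᵥ* a = 0 := hc
    have hcK : c ᵥ* K.submatrix Sum.inl id = (c ᵥ* M.submatrix Sum.inl id) ᵥ* τ := by
      rw [vecMul_vecMul, ← sub_eq_zero, ← vecMul_sub, ← hc']
      rfl
    have hcrad : c ᵥ* K.submatrix Sum.inl id ∈ rad := by
      rw [hcK]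
      exact hτmul _
    have hPc : pairingMatrix J K *ᵥ Sum.elim c 0 = 0 := by
      rw [pairingMatrix, fromCols_mulVec]
      simp only [Sum.elim_comp_inl, Sum.elim_comp_inr, mulVec_zero, add_zero]
      ext i
      have h3 := (mem_radicalOn.1 hcrad).2 _ (hKW (Sum.map id Sum.inl i))
      rw [toBilin'_swap (hypGram_transpose hJ), neg_eq_zero] at h3
      have h4 := toBilin'_vecMul (hypGram β J) (mainRows K) (K.submatrix Sum.inl id)
        (Pi.single i 1) c
      rw [single_one_vecMul, single_one_dotProduct] at h4
      rw [← h4]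
      exact h3
    have := eq_zero_of_mulVec_eq_zero hP hPc
    ext i
    exact congrFun this (.inl i)
  have haf : Module.finrank ℂ (LinearMap.range a.vecMulLinear) = Fintype.card α := by
    rw [LinearMap.finrank_range_of_inj hainj]
    simp
  let W₀ := W ⊓ LinearMap.ker (firstCoord β μ)
  have haW : LinearMap.range a.vecMulLinear ≤ W₀ := by
    rw [range_vecMulLinear, Submodule.span_le]
    rintro _ ⟨i, rfl⟩
    exact ⟨hLW _, hL0 _⟩
  have hW₀f : Module.finrank ℂ W₀ ≤ Fintype.card α := by
    have h3 := Submodule.finrank_sup_add_finrank_inf_eq W₀ rad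
    have h4 : W₀ ⊓ rad = ⊥ := by
      rw [eq_bot_iff]
      rintro w ⟨hw, hw'⟩
      exact (Submodule.mem_bot _).2 (hrad_zero w hw' hw.2)
    have h5 := Submodule.finrank_mono (sup_le inf_le_left hradW : W₀ ⊔ rad ≤ W)
    rw [h4, finrank_bot] at h3
    omega
  have haW₀ : LinearMap.range a.vecMulLinear = W₀ :=
    Submodule.eq_of_le_of_finrank_le haW (by omega)
  have hD : ∀ i : β ⊕ ζ, ∃ c : α → ℂ, c ᵥ* a = L (.inr i) := fun i => by
    have : L (.inr i) ∈ LinearMap.range a.vecMulLinear := by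
      rw [haW₀]
      exact ⟨hLW _, hL0 _⟩
    exact this
  choose D hD using hD
  refine ⟨X, S, C, D, M, hS, ?_⟩
  have : L = fromRows a (Matrix.of D * a) := by
    ext (i | i) p
    · rfl
    · exact (congrFun (hD i) p).symm
  change K = fromRows 1 (Matrix.of D) * orthogonalRows J X C + M * isotropicRows J X S
  rw [← hτS, ← haC, fromRows_mul, Matrix.one_mul, ← this]
  simp [L]

end Pairing

end Chart

/-! ### A chart of the orbit: both components -/

section FullChart

open Matrix

variable {ρ ν φ : Type*} [Fintype ρ] [Fintype ν] [DecidableEq ρ] [DecidableEq ν]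

/-- The symmetric matrices of rank `|ρ|` with invertible leading block `A`. -/
def symChart (A : Matrix ρ ρ ℂ) (B : Matrix ρ ν ℂ) : Matrix (ρ ⊕ ν) (ρ ⊕ ν) ℂ :=
  fromBlocks A (A * B) (Bᵀ * A) (Bᵀ * A * B)

/-- The matrix with upper rows `N` whose restriction to the radical of `symChart A B` is given, in
the coordinates indexed by `ν`, by `K`. -/
def rowChart (B : Matrix ρ ν ℂ) (N : Matrix ρ φ ℂ) (K : Matrix ν φ ℂ) : Matrix (ρ ⊕ ν) φ ℂ :=
  fromRows N (Bᵀ * N + K)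

/-- The restriction of `H` to the radical of `σ` in the coordinates indexed by `ν`, multiplied by
the determinant of the leading block of `σ` in order to be polynomial in `σ` and `H`. -/
def scaledRows (σ : Matrix (ρ ⊕ ν) (ρ ⊕ ν) ℂ) (H : Matrix (ρ ⊕ ν) φ ℂ) : Matrix ν φ ℂ :=
  σ.toBlocks₁₁.det • H.toRows₂ - (adjugate σ.toBlocks₁₁ * σ.toBlocks₁₂)ᵀ * H.toRows₁

omit [Fintype ν] [DecidableEq ν] in
theorem scaledRows_chart (A : Matrix ρ ρ ℂ) (B : Matrix ρ ν ℂ) (N : Matrix ρ φ ℂ)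
    (K : Matrix ν φ ℂ) : scaledRows (symChart A B) (rowChart B N K) = A.det • K := by
  simp only [scaledRows, symChart, rowChart, toBlocks_fromBlocks₁₁, toBlocks_fromBlocks₁₂,
    toRows₂_fromRows, toRows₁_fromRows]
  rw [← Matrix.mul_assoc, adjugate_mul, smul_mul, Matrix.one_mul, transpose_smul, smul_mul,
    smul_add, add_sub_cancel_left]

/-- The radical of `symChart A B` consists of the row vectors `(-c Bᵀ, c)`. -/
theorem ker_symChart {A : Matrix ρ ρ ℂ} (hA : A.det ≠ 0) (B : Matrix ρ ν ℂ) :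
    LinearMap.ker (symChart A B).vecMulLinear =
      LinearMap.range (fromCols (-Bᵀ) (1 : Matrix ν ν ℂ)).vecMulLinear := by
  ext c
  rw [LinearMap.mem_ker, vecMulLinear_apply, LinearMap.mem_range]
  constructor
  · intro h
    refine ⟨c ∘ Sum.inr, ?_⟩
    have h1 : (c ∘ Sum.inl + (c ∘ Sum.inr) ᵥ* Bᵀ) ᵥ* A = 0 := by
      ext i
      have := congrFun h (.inl i)
      rw [symChart, vecMul_fromBlocks, Sum.elim_inl] at this
      rw [add_vecMul, vecMul_vecMul]
      exact this
    have h2 := eq_zero_of_vecMul_eq_zero hA h1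
    rw [vecMulLinear_apply, vecMul_fromCols, vecMul_one]
    ext (i | i)
    · rw [Sum.elim_inl, vecMul_neg, eq_neg_of_add_eq_zero_left h2 |>.symm]
      rfl
    · rfl
  · rintro ⟨c, rfl⟩
    rw [vecMulLinear_apply, vecMul_vecMul, symChart, fromCols_mul_fromBlocks]
    simp [← Matrix.mul_assoc, fromCols_zero]

theorem finrank_range_symChart {A : Matrix ρ ρ ℂ} (hA : A.det ≠ 0) (B : Matrix ρ ν ℂ) :
    Module.finrank ℂ (LinearMap.range (symChart A B).vecMulLinear) = Fintype.card ρ := by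
  have hinj : Function.Injective (fromCols (-Bᵀ) (1 : Matrix ν ν ℂ)).vecMulLinear := by
    refine (injective_iff_map_eq_zero _).2 fun c hc => ?_
    have hc' : c ᵥ* fromCols (-Bᵀ) (1 : Matrix ν ν ℂ) = 0 := hc
    ext i
    have := congrFun hc' (.inr i)
    rwa [vecMul_fromCols, Sum.elim_inr, vecMul_one] at this
  have h := LinearMap.finrank_range_add_finrank_ker (symChart A B).vecMulLinear
  rw [ker_symChart hA, LinearMap.finrank_range_of_inj hinj, Module.finrank_fintype_fun_eq_card,
    Module.finrank_fintype_fun_eq_card, Fintype.card_sum] at h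
  omega

theorem radicalImage_chart {A : Matrix ρ ρ ℂ} (hA : A.det ≠ 0) (B : Matrix ρ ν ℂ)
    (N : Matrix ρ φ ℂ) (K : Matrix ν φ ℂ) :
    radicalImage (symChart A B) (rowChart B N K) = LinearMap.range K.vecMulLinear := by
  rw [radicalImage, ker_symChart hA, ← LinearMap.range_comp]
  congr 1
  refine LinearMap.ext fun c => ?_
  change (c ᵥ* fromCols (-Bᵀ) (1 : Matrix ν ν ℂ)) ᵥ* fromRows N (Bᵀ * N + K) = c ᵥ* K
  rw [vecMul_vecMul, fromCols_mul_fromRows, Matrix.one_mul, Matrix.neg_mul, neg_add_cancel_left]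

omit [DecidableEq ν] in
/-- A symmetric matrix of rank `|ρ|` with invertible leading block is determined by its rows with
index in `ρ`. -/
theorem exists_symChart {σ : Matrix (ρ ⊕ ν) (ρ ⊕ ν) ℂ} (hσ : σᵀ = σ)
    (hr : Module.finrank ℂ (LinearMap.range σ.vecMulLinear) = Fintype.card ρ)
    (hA : σ.toBlocks₁₁.det ≠ 0) : ∃ B, σ = symChart σ.toBlocks₁₁ B := by
  let T : Matrix ρ (ρ ⊕ ν) ℂ := σ.submatrix Sum.inl id
  have hle : LinearMap.range T.vecMulLinear ≤ LinearMap.range σ.vecMulLinear := by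
    rw [range_vecMulLinear, range_vecMulLinear]
    refine Submodule.span_mono ?_
    rintro _ ⟨i, rfl⟩
    exact ⟨_, rfl⟩
  have hinj : Function.Injective T.vecMulLinear := by
    refine (injective_iff_map_eq_zero _).2 fun c hc => eq_zero_of_vecMul_eq_zero hA ?_
    ext i
    exact congrFun (show c ᵥ* T = 0 from hc) (.inl i)
  have hT : LinearMap.range T.vecMulLinear = LinearMap.range σ.vecMulLinear :=
    Submodule.eq_of_le_of_finrank_le hle (by rw [hr, LinearMap.finrank_range_of_inj hinj]; simp)
  have hD : ∀ i : ν, ∃ c : ρ → ℂ, c ᵥ* T = σ (.inr i) := fun i => by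
    have : σ (.inr i) ∈ LinearMap.range T.vecMulLinear := hT ▸ row_mem_range σ _
    exact this
  choose D hD using hD
  have h21 : σ.toBlocks₂₁ = Matrix.of D * σ.toBlocks₁₁ := by
    ext i j
    exact (congrFun (hD i) (.inl j)).symm
  have h22 : σ.toBlocks₂₂ = Matrix.of D * σ.toBlocks₁₂ := by
    ext i j
    exact (congrFun (hD i) (.inr j)).symm
  have hA' : σ.toBlocks₁₁ᵀ = σ.toBlocks₁₁ := by
    ext i j
    exact congrFun (congrFun hσ (.inl i)) (.inl j)
  have h12 : σ.toBlocks₁₂ = σ.toBlocks₁₁ * (Matrix.of D)ᵀ := by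
    rw [← hA', ← transpose_mul, ← h21]
    ext i j
    exact (congrFun (congrFun hσ (.inl i)) (.inr j)).symm
  refine ⟨(Matrix.of D)ᵀ, ?_⟩
  rw [symChart, ← h12, transpose_transpose, ← h21, h21, Matrix.mul_assoc, ← h12, ← h22, ← h21,
    fromBlocks_toBlocks]

variable {α β ζ μ : Type*} [Fintype α] [Fintype β] [Fintype ζ] [Fintype μ] [DecidableEq α]
  [DecidableEq β] [DecidableEq ζ] [DecidableEq μ]

/-- The polynomial whose nonvanishing defines the domain of the chart. -/
def chartPoly (J : Matrix μ μ ℂ)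
    (σ : Matrix (ρ ⊕ (α ⊕ (β ⊕ ζ))) (ρ ⊕ (α ⊕ (β ⊕ ζ))) ℂ)
    (H : Matrix (ρ ⊕ (α ⊕ (β ⊕ ζ))) ((β ⊕ β) ⊕ μ) ℂ) : ℂ :=
  σ.toBlocks₁₁.det * (pairingMatrix J (scaledRows σ H)).det

omit [DecidableEq μ] in
theorem mixChart_smul {υ : Type*} (J : Matrix μ μ ℂ) (X : Matrix β μ ℂ) (S : Matrix β β ℂ)
    (C : Matrix α μ ℂ) (D : Matrix υ α ℂ) (M : Matrix (α ⊕ υ) β ℂ) (c : ℂ) :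
    c • mixChart J X S C D M = mixChart J X S (c • C) D (c • M) := by
  have : orthogonalRows J X (c • C) = c • orthogonalRows J X C := by
    ext i ((j | j) | j) <;> simp [orthogonalRows]
  rw [mixChart, mixChart, this, smul_add, Matrix.mul_smul, Matrix.smul_mul]

theorem range_smul_vecMulLinear {m n : Type*} [Fintype m] (K : Matrix m n ℂ) {c : ℂ} (hc : c ≠ 0) :
    LinearMap.range (c • K).vecMulLinear = LinearMap.range K.vecMulLinear := by
  have : (c • K).vecMulLinear = c • K.vecMulLinear := by
    ext1 v
    ext1
    simp
  rw [this, LinearMap.range_smul _ _ hc]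

/-- A point in the image of the chart has the expected invariants if it lies in the domain. -/
theorem hasInvariants_chart {J : Matrix μ μ ℂ} (hJ : Jᵀ = -J) (A : Matrix ρ ρ ℂ)
    (B : Matrix ρ (α ⊕ (β ⊕ ζ)) ℂ) (N : Matrix ρ ((β ⊕ β) ⊕ μ) ℂ) {S : Matrix β β ℂ} (hS : Sᵀ = S)
    (X : Matrix β μ ℂ) (C : Matrix α μ ℂ) (D : Matrix (β ⊕ ζ) α ℂ) (M : Matrix (α ⊕ (β ⊕ ζ)) β ℂ)
    (hP : chartPoly J (symChart A B) (rowChart B N (mixChart J X S C D M)) ≠ 0) :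
    HasInvariants (hypGram β J) (symChart A B) (rowChart B N (mixChart J X S C D M))
      (Fintype.card ρ) (Fintype.card α + Fintype.card β) (Fintype.card β) := by
  rw [chartPoly, scaledRows_chart, mixChart_smul] at hP
  have hA : A.det ≠ 0 := left_ne_zero_of_mul hP
  have := finrank_of_mixChart hJ hS rfl (right_ne_zero_of_mul hP)
  rw [← mixChart_smul, range_smul_vecMulLinear _ hA] at this
  refine ⟨finrank_range_symChart hA B, ?_, ?_⟩
  · rw [radicalImage_chart hA, this.1]
  · rw [radicalImage_chart hA, this.2, add_comm]

/-- Conversely, a point in the domain with these invariants lies in the image of the chart. -/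
theorem exists_chart {J : Matrix μ μ ℂ} (hJ : Jᵀ = -J)
    {σ : Matrix (ρ ⊕ (α ⊕ (β ⊕ ζ))) (ρ ⊕ (α ⊕ (β ⊕ ζ))) ℂ}
    {H : Matrix (ρ ⊕ (α ⊕ (β ⊕ ζ))) ((β ⊕ β) ⊕ μ) ℂ} (hσ : σᵀ = σ)
    (hinv : HasInvariants (hypGram β J) σ H
      (Fintype.card ρ) (Fintype.card α + Fintype.card β) (Fintype.card β))
    (hP : chartPoly J σ H ≠ 0) :
    ∃ (A : Matrix ρ ρ ℂ) (B : Matrix ρ (α ⊕ (β ⊕ ζ)) ℂ) (N : Matrix ρ ((β ⊕ β) ⊕ μ) ℂ)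
      (X : Matrix β μ ℂ) (S : Matrix β β ℂ) (C : Matrix α μ ℂ) (D : Matrix (β ⊕ ζ) α ℂ)
      (M : Matrix (α ⊕ (β ⊕ ζ)) β ℂ), Aᵀ = A ∧ Sᵀ = S ∧ σ = symChart A B ∧
        H = rowChart B N (mixChart J X S C D M) := by
  obtain ⟨hr, hh, ht⟩ := hinv
  have hA : σ.toBlocks₁₁.det ≠ 0 := left_ne_zero_of_mul hP
  obtain ⟨B, hB⟩ := exists_symChart hσ hr hA
  set A := σ.toBlocks₁₁ with hAdef
  have hH : H = rowChart B H.toRows₁ (H.toRows₂ - Bᵀ * H.toRows₁) := by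
    rw [rowChart, add_sub_cancel, fromRows_toRows]
  set K := H.toRows₂ - Bᵀ * H.toRows₁ with hK
  rw [hB, hH, radicalImage_chart hA] at hh ht
  rw [hB, hH, chartPoly, scaledRows_chart] at hP
  rw [← range_smul_vecMulLinear K hA] at hh ht
  obtain ⟨X, S, C, D, M, hS, hKM⟩ := exists_mixChart hJ (right_ne_zero_of_mul hP) hh (by omega)
  refine ⟨A, B, H.toRows₁, X, S, A.det⁻¹ • C, D, A.det⁻¹ • M, ?_, hS, hB, ?_⟩
  · ext i j
    exact congrFun (congrFun hσ (.inl i)) (.inl j)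
  · rw [← mixChart_smul, ← hKM, inv_smul_smul₀ hA]
    exact hH

end FullChart

/-! ### The parameter space of the chart -/

section Parameters

open Matrix

/-- The coordinates of the parameter space: two symmetric matrices and six arbitrary ones. -/
abbrev ChartIndex (ρ α β ζ μ : Type*) : Type _ :=
  Sym2 ρ ⊕ (ρ × (α ⊕ (β ⊕ ζ))) ⊕ (ρ × ((β ⊕ β) ⊕ μ)) ⊕ ((α ⊕ (β ⊕ ζ)) × β) ⊕ ((β ⊕ ζ) × α) ⊕
    (α × μ) ⊕ (β × μ) ⊕ Sym2 β

namespace ChartIndex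

variable {ρ α β ζ μ : Type*}

/-- The leading block of `σ`. -/
def A (x : ChartIndex ρ α β ζ μ → ℂ) : Matrix ρ ρ ℂ := fun i j => x (.inl s(i, j))

/-- The matrix relating the other rows of `σ` to the leading ones. -/
def B (x : ChartIndex ρ α β ζ μ → ℂ) : Matrix ρ (α ⊕ (β ⊕ ζ)) ℂ := fun i j => x (.inr (.inl (i, j)))

/-- The leading rows of `H`. -/
def N (x : ChartIndex ρ α β ζ μ → ℂ) : Matrix ρ ((β ⊕ β) ⊕ μ) ℂ :=
  fun i j => x (.inr (.inr (.inl (i, j))))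

/-- The coefficients of the rows of `H` on the radical of the image. -/
def M (x : ChartIndex ρ α β ζ μ → ℂ) : Matrix (α ⊕ (β ⊕ ζ)) β ℂ :=
  fun i j => x (.inr (.inr (.inr (.inl (i, j)))))

/-- The coefficients of the rows of `H` on a complement of the radical of the image. -/
def D (x : ChartIndex ρ α β ζ μ → ℂ) : Matrix (β ⊕ ζ) α ℂ :=
  fun i j => x (.inr (.inr (.inr (.inr (.inl (i, j))))))

/-- The parameter of the complement of the radical. -/
def C (x : ChartIndex ρ α β ζ μ → ℂ) : Matrix α μ ℂ :=
  fun i j => x (.inr (.inr (.inr (.inr (.inr (.inl (i, j)))))))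

/-- The parameter of the radical in directions orthogonal to the hyperbolic pairs. -/
def X (x : ChartIndex ρ α β ζ μ → ℂ) : Matrix β μ ℂ :=
  fun i j => x (.inr (.inr (.inr (.inr (.inr (.inr (.inl (i, j))))))))

/-- The symmetric parameter of the radical. -/
def S (x : ChartIndex ρ α β ζ μ → ℂ) : Matrix β β ℂ :=
  fun i j => x (.inr (.inr (.inr (.inr (.inr (.inr (.inr s(i, j))))))))

theorem A_transpose (x : ChartIndex ρ α β ζ μ → ℂ) : (A x)ᵀ = A x := by
  ext i j
  simp [A, Sym2.eq_swap]

theorem S_transpose (x : ChartIndex ρ α β ζ μ → ℂ) : (S x)ᵀ = S x := by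
  ext i j
  simp [S, Sym2.eq_swap]

/-- The point of the parameter space with given matrices. -/
def mk (A : Matrix ρ ρ ℂ) (B : Matrix ρ (α ⊕ (β ⊕ ζ)) ℂ) (N : Matrix ρ ((β ⊕ β) ⊕ μ) ℂ)
    (M : Matrix (α ⊕ (β ⊕ ζ)) β ℂ) (D : Matrix (β ⊕ ζ) α ℂ) (C : Matrix α μ ℂ)
    (X : Matrix β μ ℂ) (S : Matrix β β ℂ) (hA : Aᵀ = A) (hS : Sᵀ = S) : ChartIndex ρ α β ζ μ → ℂ :=
  Sum.elim (Sym2.lift ⟨fun i j => A i j, fun i j => congrFun (congrFun hA j) i⟩) <|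
  Sum.elim (fun p => B p.1 p.2) <| Sum.elim (fun p => N p.1 p.2) <|
  Sum.elim (fun p => M p.1 p.2) <| Sum.elim (fun p => D p.1 p.2) <|
  Sum.elim (fun p => C p.1 p.2) <| Sum.elim (fun p => X p.1 p.2) <|
  Sym2.lift ⟨fun i j => S i j, fun i j => congrFun (congrFun hS j) i⟩

theorem ext_zero {x : ChartIndex ρ α β ζ μ → ℂ} (hA : A x = 0) (hB : B x = 0) (hN : N x = 0)
    (hM : M x = 0) (hD : D x = 0) (hC : C x = 0) (hX : X x = 0) (hS : S x = 0) : x = 0 := by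
  ext (p | ⟨i, j⟩ | ⟨i, j⟩ | ⟨i, j⟩ | ⟨i, j⟩ | ⟨i, j⟩ | ⟨i, j⟩ | p)
  · induction p with | _ i j => exact congrFun (congrFun hA i) j
  · exact congrFun (congrFun hB i) j
  · exact congrFun (congrFun hN i) j
  · exact congrFun (congrFun hM i) j
  · exact congrFun (congrFun hD i) j
  · exact congrFun (congrFun hC i) j
  · exact congrFun (congrFun hX i) j
  · induction p with | _ i j => exact congrFun (congrFun hS i) j

variable [Fintype ρ] [Fintype α] [Fintype β] [Fintype ζ] [Fintype μ] [DecidableEq α]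
  [DecidableEq β]

/-- The matrix `σ` of a point of the parameter space. -/
def sym (x : ChartIndex ρ α β ζ μ → ℂ) : Matrix (ρ ⊕ (α ⊕ (β ⊕ ζ))) (ρ ⊕ (α ⊕ (β ⊕ ζ))) ℂ :=
  symChart (A x) (B x)

/-- The matrix `H` of a point of the parameter space. -/
def mix (J : Matrix μ μ ℂ) (x : ChartIndex ρ α β ζ μ → ℂ) :
    Matrix (ρ ⊕ (α ⊕ (β ⊕ ζ))) ((β ⊕ β) ⊕ μ) ℂ :=
  rowChart (B x) (N x) (mixChart J (X x) (S x) (C x) (D x) (M x))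

omit [Fintype α] [Fintype β] [Fintype ζ] [Fintype μ] [DecidableEq α] [DecidableEq β] in
theorem sym_mk_add_smul (A : Matrix ρ ρ ℂ) (B : Matrix ρ (α ⊕ (β ⊕ ζ)) ℂ)
    (N : Matrix ρ ((β ⊕ β) ⊕ μ) ℂ) (M : Matrix (α ⊕ (β ⊕ ζ)) β ℂ) (D : Matrix (β ⊕ ζ) α ℂ)
    (C : Matrix α μ ℂ) (X : Matrix β μ ℂ) (S : Matrix β β ℂ) (hA : Aᵀ = A) (hS : Sᵀ = S) (s : ℂ)
    (v : ChartIndex ρ α β ζ μ → ℂ) :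
    sym (mk A B N M D C X S hA hS + s • v) =
      symChart (A + s • ChartIndex.A v) (B + s • ChartIndex.B v) :=
  rfl

omit [Fintype ζ] in
theorem mix_mk_add_smul (J : Matrix μ μ ℂ) (A : Matrix ρ ρ ℂ) (B : Matrix ρ (α ⊕ (β ⊕ ζ)) ℂ)
    (N : Matrix ρ ((β ⊕ β) ⊕ μ) ℂ) (M : Matrix (α ⊕ (β ⊕ ζ)) β ℂ) (D : Matrix (β ⊕ ζ) α ℂ)
    (C : Matrix α μ ℂ) (X : Matrix β μ ℂ) (S : Matrix β β ℂ) (hA : Aᵀ = A) (hS : Sᵀ = S) (s : ℂ)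
    (v : ChartIndex ρ α β ζ μ → ℂ) :
    mix J (mk A B N M D C X S hA hS + s • v) =
      rowChart (B + s • ChartIndex.B v) (N + s • ChartIndex.N v)
        (mixChart J (X + s • ChartIndex.X v) (S + s • ChartIndex.S v) (C + s • ChartIndex.C v)
          (D + s • ChartIndex.D v) (M + s • ChartIndex.M v)) :=
  rfl

omit [Fintype α] [Fintype β] [Fintype ζ] [Fintype μ] [DecidableEq α] [DecidableEq β] in
theorem sym_transpose (x : ChartIndex ρ α β ζ μ → ℂ) : (sym x)ᵀ = sym x := by
  simp [sym, symChart, fromBlocks_transpose, A_transpose, Matrix.mul_assoc]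

end ChartIndex

/-! ### Matrices of polynomials -/

section PolyMat

variable {W : Type*} [AddCommGroup W] [Module ℂ W] {m n p : Type*}

theorem coord_mem_polyFun {ι : Type*} (i : ι) : (fun x : ι → ℂ => x i) ∈ polyFun (ι → ℂ) :=
  dual_mem_polyFun (LinearMap.proj i : Module.Dual ℂ (ι → ℂ))

/-- All entries of a matrix depending on a vector are polynomial functions of the vector. -/
def PolyMat (A : W → Matrix m n ℂ) : Prop :=
  ∀ i j, (fun x => A x i j) ∈ polyFun W

theorem PolyMat.const (A : Matrix m n ℂ) : PolyMat fun _ : W => A := fun i j =>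
  const_mem_polyFun (A i j)

theorem PolyMat.add {A B : W → Matrix m n ℂ} (hA : PolyMat A) (hB : PolyMat B) :
    PolyMat fun x => A x + B x := fun i j => (polyFun W).add_mem (hA i j) (hB i j)

theorem PolyMat.sub {A B : W → Matrix m n ℂ} (hA : PolyMat A) (hB : PolyMat B) :
    PolyMat fun x => A x - B x := fun i j => (polyFun W).sub_mem (hA i j) (hB i j)

theorem PolyMat.smul {c : W → ℂ} {A : W → Matrix m n ℂ} (hc : c ∈ polyFun W) (hA : PolyMat A) :
    PolyMat fun x => c x • A x := fun i j => (polyFun W).mul_mem hc (hA i j)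

theorem PolyMat.mul [Fintype n] {A : W → Matrix m n ℂ} {B : W → Matrix n p ℂ} (hA : PolyMat A)
    (hB : PolyMat B) : PolyMat fun x => A x * B x := fun i j => by
  simp only [mul_apply]
  exact polyFun_sum _ fun k _ => (polyFun W).mul_mem (hA i k) (hB k j)

theorem PolyMat.transpose {A : W → Matrix m n ℂ} (hA : PolyMat A) : PolyMat fun x => (A x)ᵀ :=
  fun i j => hA j i

theorem PolyMat.fromRows {A : W → Matrix m n ℂ} {B : W → Matrix p n ℂ} (hA : PolyMat A)
    (hB : PolyMat B) : PolyMat fun x => Matrix.fromRows (A x) (B x) := by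
  rintro (i | i) j
  · exact hA i j
  · exact hB i j

theorem PolyMat.fromCols {A : W → Matrix m n ℂ} {B : W → Matrix m p ℂ} (hA : PolyMat A)
    (hB : PolyMat B) : PolyMat fun x => Matrix.fromCols (A x) (B x) := by
  rintro i (j | j)
  · exact hA i j
  · exact hB i j

theorem PolyMat.submatrix {m' n' : Type*} {A : W → Matrix m n ℂ} (hA : PolyMat A) (f : m' → m)
    (g : n' → n) : PolyMat fun x => (A x).submatrix f g := fun i j => hA (f i) (g j)

theorem PolyMat.symChart {ρ ν : Type*} [Fintype ρ] {A : W → Matrix ρ ρ ℂ} {B : W → Matrix ρ ν ℂ}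
    (hA : PolyMat A) (hB : PolyMat B) : PolyMat fun x => symChart (A x) (B x) := by
  rintro (i | i) (j | j)
  · exact hA i j
  · exact (hA.mul hB) i j
  · exact (hB.transpose.mul hA) i j
  · exact ((hB.transpose.mul hA).mul hB) i j

theorem PolyMat.mixChart {α β υ μ : Type*} [Fintype α] [Fintype β] [Fintype μ] [DecidableEq α]
    [DecidableEq β] (J : Matrix μ μ ℂ) {X : W → Matrix β μ ℂ} {S : W → Matrix β β ℂ}
    {C : W → Matrix α μ ℂ} {D : W → Matrix υ α ℂ} {M : W → Matrix (α ⊕ υ) β ℂ} (hX : PolyMat X)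
    (hS : PolyMat S) (hC : PolyMat C) (hD : PolyMat D) (hM : PolyMat M) :
    PolyMat fun x => mixChart J (X x) (S x) (C x) (D x) (M x) :=
  (((const 1).fromRows hD).mul
    (((const 0).fromCols ((hC.mul (const J)).mul hX.transpose)).fromCols hC)).add
  (hM.mul (((const 1).fromCols (hS.add (smul (const_mem_polyFun 2⁻¹)
    ((hX.mul (const J)).mul hX.transpose)))).fromCols hX))

theorem PolyMat.rowChart {ρ ν φ : Type*} [Fintype ρ] {B : W → Matrix ρ ν ℂ} {N : W → Matrix ρ φ ℂ}
    {K : W → Matrix ν φ ℂ} (hB : PolyMat B) (hN : PolyMat N) (hK : PolyMat K) :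
    PolyMat fun x => rowChart (B x) (N x) (K x) :=
  hN.fromRows ((hB.transpose.mul hN).add hK)

theorem chartPoly_mem_polyFun {ρ α β ζ μ : Type*} [Fintype ρ] [Fintype α] [Fintype β] [Fintype ζ]
    [Fintype μ] [DecidableEq ρ] [DecidableEq α] [DecidableEq β] [DecidableEq ζ] [DecidableEq μ]
    (J : Matrix μ μ ℂ) {σ : W → Matrix (ρ ⊕ (α ⊕ (β ⊕ ζ))) (ρ ⊕ (α ⊕ (β ⊕ ζ))) ℂ}
    {H : W → Matrix (ρ ⊕ (α ⊕ (β ⊕ ζ))) ((β ⊕ β) ⊕ μ) ℂ} (hσ : PolyMat σ) (hH : PolyMat H) :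
    (fun x => chartPoly J (σ x) (H x)) ∈ polyFun W := by
  have h11 : PolyMat fun x => (σ x).toBlocks₁₁ := hσ.submatrix Sum.inl Sum.inl
  have h12 : PolyMat fun x => (σ x).toBlocks₁₂ := hσ.submatrix Sum.inl Sum.inr
  have hadj : PolyMat fun x => adjugate (σ x).toBlocks₁₁ := polyFun_adjugate h11
  have hdet := polyFun_det h11
  have hK : PolyMat fun x => scaledRows (σ x) (H x) :=
    (PolyMat.smul hdet (hH.submatrix Sum.inr id)).sub
      ((hadj.mul h12).transpose.mul (hH.submatrix Sum.inl id))
  have hR : PolyMat fun x => mainRows (scaledRows (σ x) (H x)) := hK.submatrix _ _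
  exact (polyFun W).mul_mem hdet (polyFun_det
    (((hR.mul (.const _)).mul (hK.submatrix Sum.inl id).transpose).fromCols (hR.submatrix _ _)))

theorem ChartIndex.polyMat_sym {ρ α β ζ μ : Type*} [Fintype ρ] :
    PolyMat fun x : ChartIndex ρ α β ζ μ → ℂ => sym x := by
  refine PolyMat.symChart (fun i j => ?_) fun i j => ?_
  · exact coord_mem_polyFun _
  · exact coord_mem_polyFun _

theorem ChartIndex.polyMat_mix {ρ α β ζ μ : Type*} [Fintype ρ] [Fintype α] [Fintype β]
    [Fintype μ] [DecidableEq α] [DecidableEq β] (J : Matrix μ μ ℂ) :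
    PolyMat fun x : ChartIndex ρ α β ζ μ → ℂ => mix J x := by
  refine PolyMat.rowChart (fun i j => ?_) (fun i j => ?_) <|
    PolyMat.mixChart J (fun i j => ?_) (fun i j => ?_) (fun i j => ?_) (fun i j => ?_) fun i j => ?_
  all_goals exact coord_mem_polyFun _

end PolyMat

/-! ### The differential of the chart -/

section Differential

variable {m n p : Type*}

/-- Entrywise derivative at `0` of a matrix depending on a complex number. -/
def HasMatDeriv (A : ℂ → Matrix m n ℂ) (A' : Matrix m n ℂ) : Prop :=
  ∀ i j, HasDerivAt (fun s => A s i j) (A' i j) 0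

theorem HasMatDeriv.unique {A : ℂ → Matrix m n ℂ} {A' A'' : Matrix m n ℂ} (h : HasMatDeriv A A')
    (h' : HasMatDeriv A A'') : A' = A'' := by
  ext i j
  exact (h i j).unique (h' i j)

theorem HasMatDeriv.add {A B : ℂ → Matrix m n ℂ} {A' B' : Matrix m n ℂ} (hA : HasMatDeriv A A')
    (hB : HasMatDeriv B B') : HasMatDeriv (fun s => A s + B s) (A' + B') :=
  fun i j => (hA i j).add (hB i j)

theorem HasMatDeriv.smul {A : ℂ → Matrix m n ℂ} {A' : Matrix m n ℂ} (c : ℂ) (hA : HasMatDeriv A A') :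
    HasMatDeriv (fun s => c • A s) (c • A') :=
  fun i j => (hA i j).const_mul c

theorem HasMatDeriv.const (A : Matrix m n ℂ) : HasMatDeriv (fun _ => A) 0 :=
  fun _ _ => hasDerivAt_const _ _

theorem HasMatDeriv.transpose {A : ℂ → Matrix m n ℂ} {A' : Matrix m n ℂ} (hA : HasMatDeriv A A') :
    HasMatDeriv (fun s => (A s)ᵀ) A'ᵀ :=
  fun i j => hA j i

theorem HasMatDeriv.mul [Fintype n] {A : ℂ → Matrix m n ℂ} {B : ℂ → Matrix n p ℂ}
    {A' : Matrix m n ℂ} {B' : Matrix n p ℂ} (hA : HasMatDeriv A A') (hB : HasMatDeriv B B') :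
    HasMatDeriv (fun s => A s * B s) (A' * B 0 + A 0 * B') := fun i j => by
  simp only [mul_apply, Matrix.add_apply, ← Finset.sum_add_distrib]
  exact HasDerivAt.fun_sum fun k _ => (hA i k).fun_mul (hB k j)

theorem HasMatDeriv.line (A B : Matrix m n ℂ) : HasMatDeriv (fun s => A + s • B) B := fun i j => by
  simpa using ((hasDerivAt_id (0 : ℂ)).mul_const (B i j)).const_add (A i j)

theorem HasMatDeriv.fromRows {A : ℂ → Matrix m n ℂ} {B : ℂ → Matrix p n ℂ} {A' : Matrix m n ℂ}
    {B' : Matrix p n ℂ} (hA : HasMatDeriv A A') (hB : HasMatDeriv B B') :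
    HasMatDeriv (fun s => Matrix.fromRows (A s) (B s)) (Matrix.fromRows A' B') := by
  rintro (i | i) j
  · exact hA i j
  · exact hB i j

variable {ρ ν α β ζ μ : Type*} [Fintype ρ] [Fintype α] [Fintype β] [Fintype μ]
  [DecidableEq ρ] [DecidableEq α] [DecidableEq β]

/-- The coefficients `M` at the base point of the chart: the rows with index in `β` are the basis of
the radical, and the other rows do not involve it. -/
def baseM (α β ζ : Type*) [DecidableEq β] : Matrix (α ⊕ (β ⊕ ζ)) β ℂ := fromRows 0 (fromRows 1 0)

/-- The differential of `mixChart` at the base point is injective. -/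
theorem mixChart_differential {J : Matrix μ μ ℂ} {C₀ : Matrix α μ ℂ}
    (hC₀ : (C₀ * J * C₀ᵀ).det ≠ 0) {X : Matrix β μ ℂ} {S : Matrix β β ℂ} {C : Matrix α μ ℂ}
    {D : Matrix (β ⊕ ζ) α ℂ} {M : Matrix (α ⊕ (β ⊕ ζ)) β ℂ}
    (h : HasMatDeriv (fun s => mixChart J (0 + s • X) (0 + s • S) (C₀ + s • C) (0 + s • D)
      (baseM α β ζ + s • M)) 0) :
    X = 0 ∧ S = 0 ∧ C = 0 ∧ D = 0 ∧ M = 0 := by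
  have hX := HasMatDeriv.line (0 : Matrix β μ ℂ) X
  have hS := HasMatDeriv.line (0 : Matrix β β ℂ) S
  have hC := HasMatDeriv.line C₀ C
  have hD := (HasMatDeriv.const (1 : Matrix α α ℂ)).fromRows
    (HasMatDeriv.line (0 : Matrix (β ⊕ ζ) α ℂ) D)
  have hM := HasMatDeriv.line (baseM α β ζ) M
  -- the first `β` columns of the chart are the coefficients `M`
  have eM : M = 0 := by
    have h1 : HasMatDeriv (fun s : ℂ => baseM α β ζ + s • M) 0 := fun i j => by
      have := h i (.inl (.inl j))
      simpa [mixChart, orthogonalRows, isotropicRows, mul_fromCols] using this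
    exact hM.unique h1
  subst eM
  have h2 : HasMatDeriv (fun s => fromRows 1 (0 + s • D) * (C₀ + s • C) +
    (baseM α β ζ + s • 0) * (0 + s • X)) 0 := fun i j => h i (.inr j)
  have h3 : HasMatDeriv (fun s => fromRows 1 (0 + s • D) * ((C₀ + s • C) * J * (0 + s • X)ᵀ) +
    (baseM α β ζ + s • 0) * (0 + s • S + (2⁻¹ : ℂ) • ((0 + s • X) * J * (0 + s • X)ᵀ))) 0 :=
    fun i j => h i (.inl (.inr j))
  have k2 := ((hD.mul hC).add (hM.mul hX)).unique h2
  have k3 := ((hD.mul ((hC.mul (.const J)).mul hX.transpose)).add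
    (hM.mul (hS.add (((hX.mul (.const J)).mul hX.transpose).smul 2⁻¹)))).unique h3
  simp only [zero_smul, smul_zero, add_zero, zero_add, fromRows_mul, Matrix.zero_mul, Matrix.one_mul,
    Matrix.mul_zero, transpose_zero, baseM] at k2 k3
  have eC : C = 0 := by
    ext i j
    simpa using congrFun (congrFun k2 (.inl i)) j
  have eS : S = 0 := by
    ext i j
    simpa using congrFun (congrFun k3 (.inr (.inl i))) j
  have kX : C₀ * J * Xᵀ = 0 := by
    ext i j
    simpa using congrFun (congrFun k3 (.inl i)) j
  have kD₁ : D.toRows₁ * C₀ + X = 0 := by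
    ext i j
    have := congrFun (congrFun k2 (.inr (.inl i))) j
    simp only [Matrix.add_apply, fromRows_apply_inr, fromRows_apply_inl, Matrix.zero_apply, add_zero]
      at this
    exact this
  have kD₂ : D.toRows₂ * C₀ = 0 := by
    ext i j
    have := congrFun (congrFun k2 (.inr (.inr i))) j
    simp only [Matrix.add_apply, fromRows_apply_inr, Matrix.zero_apply, add_zero] at this
    exact this
  have hu : IsUnit (C₀ * J * C₀ᵀ).det := hC₀.isUnit
  have eD₂ : D.toRows₂ = 0 := by
    rw [← mul_nonsing_inv_cancel_right _ D.toRows₂ hu, Matrix.mul_assoc C₀, ← Matrix.mul_assoc _ C₀,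
      kD₂, Matrix.zero_mul, Matrix.zero_mul]
  have eD₁ : D.toRows₁ = 0 := by
    rw [eq_neg_of_add_eq_zero_right kD₁, transpose_neg, Matrix.mul_neg, neg_eq_zero, transpose_mul,
      ← Matrix.mul_assoc] at kX
    rw [← transpose_eq_zero, ← nonsing_inv_mul_cancel_left _ D.toRows₁ᵀ hu, kX, Matrix.mul_zero]
  refine ⟨?_, eS, eC, ?_, rfl⟩
  · rw [eq_neg_of_add_eq_zero_right kD₁, eD₁, Matrix.zero_mul, neg_zero]
  · rw [← fromRows_toRows D, eD₁, eD₂, fromRows_zero]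

end Differential

/-! ### The dimension of the orbit -/

section Dimension

variable {V : Type*} [AddCommGroup V] [Module ℂ V] {ω : BilinForm ℂ V} {E : Submodule ℂ V}
  {ρ α β ζ μ : Type*} [Fintype ρ] [Fintype α] [Fintype β] [Fintype ζ] [Fintype μ]
  [DecidableEq ρ] [DecidableEq α] [DecidableEq β] [DecidableEq ζ] [DecidableEq μ]

theorem AdaptedBasis.ofCoord_polynomial {W κ φ : Type*} [AddCommGroup W] [Module ℂ W] [Fintype κ]
    [DecidableEq κ] [Fintype φ] {G : Matrix φ φ ℂ} (a : AdaptedBasis ω E κ φ G) (hω : ω.IsAlt)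
    {σ : W → Matrix κ κ ℂ} {H : W → Matrix κ φ ℂ} (hσ : PolyMat σ) (hH : PolyMat H)
    (l : Module.Dual ℂ (tangentQuotient ω E)) :
    (fun x => l (a.ofCoord hω (σ x) (H x))) ∈ polyFun W := by
  simp only [AdaptedBasis.ofCoord, map_add, map_sum, map_smul, smul_eq_mul]
  refine (polyFun W).add_mem ?_ ?_
  · refine polyFun_sum _ fun i _ => polyFun_sum _ fun j _ => ?_
    exact (polyFun W).mul_mem ((polyFun W).mul_mem (const_mem_polyFun _) (hσ i j))
      (const_mem_polyFun _)
  · refine polyFun_sum _ fun i _ => polyFun_sum _ fun p _ => ?_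
    exact (polyFun W).mul_mem (hH i p) (const_mem_polyFun _)

omit [DecidableEq μ] [Fintype ζ] [DecidableEq ζ] in
/-- The base point lies in the domain of the chart. -/
theorem chartPoly_base {J : Matrix μ μ ℂ} {C₀ : Matrix α μ ℂ} (hC₀ : (C₀ * J * C₀ᵀ).det ≠ 0) :
    chartPoly J (symChart (1 : Matrix ρ ρ ℂ) 0)
      (rowChart 0 0 (mixChart J 0 0 C₀ (0 : Matrix (β ⊕ ζ) α ℂ) (baseM α β ζ))) ≠ 0 := by
  have hK : mixChart J 0 0 C₀ (0 : Matrix (β ⊕ ζ) α ℂ) (baseM α β ζ) =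
      fromRows (fromCols 0 C₀) (fromRows (fromCols (fromCols 1 0) 0) 0) := by
    ext (i | i | i) ((j | j) | j) <;>
      simp [mixChart, orthogonalRows, isotropicRows, baseM, fromRows_mul]
  have hP : pairingMatrix J (fromRows (fromCols 0 C₀) (fromRows (fromCols (fromCols 1 0) 0) 0) :
      Matrix (α ⊕ (β ⊕ ζ)) ((β ⊕ β) ⊕ μ) ℂ) = fromBlocks (C₀ * J * C₀ᵀ) 0 0 1 := by
    have hR : mainRows (fromRows (fromCols 0 C₀) (fromRows (fromCols (fromCols 1 0) 0) 0) :
        Matrix (α ⊕ (β ⊕ ζ)) ((β ⊕ β) ⊕ μ) ℂ) = fromRows (fromCols 0 C₀)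
          (fromCols (fromCols 1 0) 0) := by
      ext (i | i) j <;> rfl
    have hR' : (fromRows (fromCols 0 C₀) (fromRows (fromCols (fromCols 1 0) 0) 0) :
        Matrix (α ⊕ (β ⊕ ζ)) ((β ⊕ β) ⊕ μ) ℂ).submatrix Sum.inl id = fromCols 0 C₀ := by
      ext i j
      rfl
    rw [pairingMatrix, hR, hR', hypGram, transpose_fromCols, fromRows_mul, fromCols_mul_fromBlocks,
      fromCols_mul_fromBlocks, fromRows_mul, fromCols_mul_fromRows, fromCols_mul_fromRows]
    ext (i | i) (j | j) <;> simp
  rw [chartPoly, scaledRows_chart, det_one, one_smul, hK, hP, det_fromBlocks_zero₂₁, det_one,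
    mul_one]
  simpa [symChart] using hC₀

variable [FiniteDimensional ℂ V]

/-- The orbit has at least the dimension of the parameter space: the chart maps a neighbourhood of the
base point to the orbit and has injective differential there. -/
theorem le_varietyDim_orbitSet (hω : ω.IsAlt) {J : Matrix μ μ ℂ} (hJ : Jᵀ = -J) {C₀ : Matrix α μ ℂ}
    (hC₀ : (C₀ * J * C₀ᵀ).det ≠ 0)
    (a : AdaptedBasis ω E (ρ ⊕ (α ⊕ (β ⊕ ζ))) ((β ⊕ β) ⊕ μ) (hypGram β J)) :
    (Fintype.card (ChartIndex ρ α β ζ μ) : WithBot ℕ∞) ≤ varietyDim (orbitSet ω hω E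
      (Fintype.card ρ) (Fintype.card α + Fintype.card β) (Fintype.card β)) := by
  let ψ : (ChartIndex ρ α β ζ μ → ℂ) → tangentQuotient ω E := fun x =>
    a.ofCoord hω (ChartIndex.sym x) (ChartIndex.mix J x)
  let x₀ : ChartIndex ρ α β ζ μ → ℂ :=
    ChartIndex.mk 1 0 0 (baseM α β ζ) 0 C₀ 0 0 transpose_one transpose_zero
  have hpoly := fun l => a.ofCoord_polynomial hω ChartIndex.polyMat_sym (ChartIndex.polyMat_mix J) l
  have hsym : ∀ x, a.symCoord (ψ x) = ChartIndex.sym x := fun x =>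
    a.symCoord_ofCoord hω (ChartIndex.sym_transpose x) _
  have hmix : ∀ x, a.mixCoord (ψ x) = ChartIndex.mix J x := fun x =>
    a.mixCoord_ofCoord hω (ChartIndex.sym_transpose x) _
  have key := le_varietyDim_of_injective_differential (Y := orbitSet ω hω E
    (Fintype.card ρ) (Fintype.card α + Fintype.card β) (Fintype.card β)) (ψ := ψ) hpoly x₀ ?_ ?_
  · rwa [Module.finrank_fintype_fun_eq_card] at key
  · have hp := chartPoly_mem_polyFun J (ChartIndex.polyMat_sym (ρ := ρ) (α := α) (β := β)
      (ζ := ζ)) (ChartIndex.polyMat_mix J)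
    have hf : Continuous fun x : ChartIndex ρ α β ζ μ → ℂ =>
        chartPoly J (ChartIndex.sym x) (ChartIndex.mix J x) :=
      (polyFun_contDiff hp).continuous
    have hx₀ : chartPoly J (ChartIndex.sym x₀) (ChartIndex.mix J x₀) ≠ 0 := by
      have hs₀ : ChartIndex.sym x₀ = symChart 1 0 := rfl
      have hm₀ : ChartIndex.mix J x₀ = rowChart 0 0 (mixChart J 0 0 C₀ 0 (baseM α β ζ)) := rfl
      rw [hs₀, hm₀]
      exact chartPoly_base hC₀
    have h0 := hf.continuousAt.eventually_ne hx₀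
    filter_upwards [h0] with x hx
    rw [a.mem_orbitSet_iff hω, hsym, hmix]
    exact hasInvariants_chart hJ _ _ _ (ChartIndex.S_transpose x) _ _ _ _ hx
  · intro v hv
    have hs : HasMatDeriv (fun s : ℂ => ChartIndex.sym (x₀ + s • v)) 0 := fun i j => by
      have := hv (Matrix.entryLinearMap ℂ ℂ i j ∘ₗ a.symCoord)
      simp only [LinearMap.comp_apply, hsym] at this
      exact this
    simp only [x₀, ChartIndex.sym_mk_add_smul] at hs
    have hm : HasMatDeriv (fun s : ℂ => ChartIndex.mix J (x₀ + s • v)) 0 := fun i j => by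
      have := hv (Matrix.entryLinearMap ℂ ℂ i j ∘ₗ a.mixCoord)
      simp only [LinearMap.comp_apply, hmix] at this
      exact this
    simp only [x₀, ChartIndex.mix_mk_add_smul] at hm
    have hA := HasMatDeriv.line (1 : Matrix ρ ρ ℂ) (ChartIndex.A v)
    have hB := HasMatDeriv.line (0 : Matrix ρ (α ⊕ (β ⊕ ζ)) ℂ) (ChartIndex.B v)
    have hN := HasMatDeriv.line (0 : Matrix ρ ((β ⊕ β) ⊕ μ) ℂ) (ChartIndex.N v)
    have eA : ChartIndex.A v = 0 := hA.unique fun i j => hs (.inl i) (.inl j)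
    have eB : ChartIndex.B v = 0 := by
      have := (hA.mul hB).unique (A'' := 0) fun i j => hs (.inl i) (.inr j)
      simpa using this
    have eN : ChartIndex.N v = 0 := hN.unique fun i j => hm (.inl i) j
    rw [eB, eN] at hm
    have hK : HasMatDeriv (fun s => mixChart J (0 + s • ChartIndex.X v) (0 + s • ChartIndex.S v)
        (C₀ + s • ChartIndex.C v) (0 + s • ChartIndex.D v) (baseM α β ζ + s • ChartIndex.M v)) 0 := by
      intro i j
      simpa [rowChart] using hm (.inr i) j
    obtain ⟨eX, eS, eC, eD, eM⟩ := mixChart_differential hC₀ hK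
    exact ChartIndex.ext_zero eA eB eN eM eD eC eX eS

/-- The orbit has at most the dimension of the parameter space, if every point of it has coordinates
in the domain of the chart with respect to some adapted basis. -/
theorem varietyDim_orbitSet_le (hω : ω.IsAlt) {J : Matrix μ μ ℂ} (hJ : Jᵀ = -J)
    (hne : (orbitSet ω hω E (Fintype.card ρ) (Fintype.card α + Fintype.card β)
      (Fintype.card β)).Nonempty)
    (H : ∀ q ∈ orbitSet ω hω E (Fintype.card ρ) (Fintype.card α + Fintype.card β) (Fintype.card β),
      ∃ a : AdaptedBasis ω E (ρ ⊕ (α ⊕ (β ⊕ ζ))) ((β ⊕ β) ⊕ μ) (hypGram β J),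
        chartPoly J (a.symCoord q) (a.mixCoord q) ≠ 0) :
    varietyDim (orbitSet ω hω E (Fintype.card ρ) (Fintype.card α + Fintype.card β)
      (Fintype.card β)) ≤ Fintype.card (ChartIndex ρ α β ζ μ) := by
  have key := varietyDim_le_of_parametrization (W := ChartIndex ρ α β ζ μ → ℂ) hne fun q hq => ?_
  · rwa [Module.finrank_fintype_fun_eq_card] at key
  obtain ⟨a, ha⟩ := H q hq
  refine ⟨fun z => chartPoly J (a.symCoord z) (a.mixCoord z), ?_, ha, fun x =>
    a.ofCoord hω (ChartIndex.sym x) (ChartIndex.mix J x), fun l =>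
    a.ofCoord_polynomial hω ChartIndex.polyMat_sym (ChartIndex.polyMat_mix J) l, fun z hz hPz => ?_⟩
  · exact chartPoly_mem_polyFun J
      (fun i j => dual_mem_polyFun (Matrix.entryLinearMap ℂ ℂ i j ∘ₗ a.symCoord))
      (fun i j => dual_mem_polyFun (Matrix.entryLinearMap ℂ ℂ i j ∘ₗ a.mixCoord))
  · rw [a.mem_orbitSet_iff hω] at hz
    obtain ⟨A, B, N, X, S, C, D, M, hA, hS, h1, h2⟩ :=
      exists_chart hJ (a.symCoord_transpose hω z) hz hPz
    refine ⟨ChartIndex.mk A B N M D C X S hA hS, ?_⟩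
    have h1' : ChartIndex.sym (ChartIndex.mk A B N M D C X S hA hS) = symChart A B := rfl
    have h2' : ChartIndex.mix J (ChartIndex.mk A B N M D C X S hA hS) =
      rowChart B N (mixChart J X S C D M) := rfl
    simp only [h1', h2', ← h1, ← h2]
    exact a.ofCoord_coord hω z

end Dimension

end Parameters

/-! ### The action of the parabolic subgroup on adapted bases -/

section Orbit

variable {V : Type*} [AddCommGroup V] [Module ℂ V] {ω : BilinForm ℂ V} {E : Submodule ℂ V}
  {κ φ : Type*} [DecidableEq κ] {G : Matrix φ φ ℂ}

namespace AdaptedBasis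

/-- The image of an adapted basis under an element of the parabolic subgroup. -/
def map (a : AdaptedBasis ω E κ φ G) (g : parabolic ω E) : AdaptedBasis ω E κ φ G where
  b := a.b.map (g : V ≃ₗ[ℂ] V)
  gram i j := by
    rw [Module.Basis.map_apply, Module.Basis.map_apply, g.2.1, a.gram]
  span_eq := by
    have h : Submodule.span ℂ (Set.range fun i => a.b.map (g : V ≃ₗ[ℂ] V) (.inl (.inl i))) =
        E.map ((g : V ≃ₗ[ℂ] V) : V →ₗ[ℂ] V) := by
      have := congrArg (Submodule.map ((g : V ≃ₗ[ℂ] V) : V →ₗ[ℂ] V)) a.span_eq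
      rw [Submodule.map_span, ← Set.range_comp] at this
      exact this
    rw [h]
    ext x
    constructor
    · rintro ⟨y, hy, rfl⟩
      exact (g.2.2 y).2 hy
    · intro hx
      obtain ⟨y, rfl⟩ := (g : V ≃ₗ[ℂ] V).surjective x
      exact ⟨y, (g.2.2 y).1 hx, rfl⟩

variable [Fintype κ] [Fintype φ]

/-- The parabolic subgroup acts transitively on adapted bases. -/
theorem exists_parabolic (a a' : AdaptedBasis ω E κ φ G) :
    ∃ g : parabolic ω E, ∀ i, (g : V ≃ₗ[ℂ] V) (a.b i) = a'.b i := by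
  let g : V ≃ₗ[ℂ] V := a.b.equiv a'.b (Equiv.refl _)
  have hg : ∀ i, g (a.b i) = a'.b i := fun i => by simp [g]
  have hrepr : ∀ x, a'.b.repr (g x) = a.b.repr x := fun x => by
    simp [g, Module.Basis.equiv]
  refine ⟨⟨g, fun x y => ?_, fun x => ?_⟩, hg⟩
  · have : ω.compl₁₂ (g : V →ₗ[ℂ] V) (g : V →ₗ[ℂ] V) = ω :=
      LinearMap.BilinForm.ext_basis a.b fun i j => by
        change ω (g (a.b i)) (g (a.b j)) = _
        rw [hg, hg, a.gram, a'.gram]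
    exact LinearMap.congr_fun₂ this x y
  · rw [a'.mem_iff, a.mem_iff, hrepr]

/-- Transporting a class and an adapted basis by the same element of the parabolic subgroup does not
change the coordinates. -/
theorem coord_adjointQuotient {a a' : AdaptedBasis ω E κ φ G} {g : parabolic ω E}
    (hg : ∀ i, (g : V ≃ₗ[ℂ] V) (a.b i) = a'.b i) (q : tangentQuotient ω E) :
    a'.symCoord (adjointQuotient ω E g q) = a.symCoord q ∧
      a'.mixCoord (adjointQuotient ω E g q) = a.mixCoord q := by
  have hrepr : ∀ x, a'.b.repr ((g : V ≃ₗ[ℂ] V) x) = a.b.repr x := fun x => by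
    have : a'.b.repr.toLinearMap ∘ₗ (g : V ≃ₗ[ℂ] V).toLinearMap = a.b.repr.toLinearMap :=
      a.b.ext fun i => by simp [hg]
    exact LinearMap.congr_fun this x
  obtain ⟨X, rfl⟩ := (parabolicAlgebra ω E).toSubmodule.mkQ_surjective q
  have hq : adjointQuotient ω E g ((parabolicAlgebra ω E).toSubmodule.mkQ X) =
    (parabolicAlgebra ω E).toSubmodule.mkQ (adjointMap ω E g X) := rfl
  have hX : ∀ i, (adjointMap ω E g X : Module.End ℂ V) (a'.e i) =
      (g : V ≃ₗ[ℂ] V) ((X : Module.End ℂ V) (a.e i)) := fun i => by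
    change (g : V ≃ₗ[ℂ] V) ((X : Module.End ℂ V) ((g : V ≃ₗ[ℂ] V).symm (a'.b _))) = _
    rw [← hg, LinearEquiv.symm_apply_apply]
    rfl
  rw [hq]
  constructor
  · ext i j
    rw [symCoord_mk, symCoord_mk, hX, hrepr]
  · ext i p
    rw [mixCoord_mk, mixCoord_mk, hX, hrepr]

end AdaptedBasis

/-- A set of classes given by the invariants is a single orbit if all its points have the same
coordinates with respect to suitable adapted bases. -/
theorem orbitSet_eq_parabolicOrbit [Fintype κ] [Fintype φ] [DecidableEq φ] (hω : ω.IsAlt)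
    {r h t : ℕ} {q₀ : tangentQuotient ω E} (hq₀ : q₀ ∈ orbitSet ω hω E r h t)
    (a₀ : AdaptedBasis ω E κ φ G)
    (H : ∀ q ∈ orbitSet ω hω E r h t, ∃ a : AdaptedBasis ω E κ φ G,
      a.symCoord q = a₀.symCoord q₀ ∧ a.mixCoord q = a₀.mixCoord q₀) :
    orbitSet ω hω E r h t = parabolicOrbit ω E q₀ := by
  ext q
  constructor
  · intro hq
    obtain ⟨a, h1, h2⟩ := H q hq
    obtain ⟨g, hg⟩ := a₀.exists_parabolic a
    obtain ⟨h3, h4⟩ := AdaptedBasis.coord_adjointQuotient hg q₀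
    exact ⟨g, a.coord_ext (h3.trans h1.symm) (h4.trans h2.symm)⟩
  · rintro ⟨g, rfl⟩
    obtain ⟨h3, h4⟩ := AdaptedBasis.coord_adjointQuotient (a := a₀) (a' := a₀.map g) (g := g)
      (fun _ => rfl) q₀
    rw [(a₀.map g).mem_orbitSet_iff hω]
    simp only [h3, h4]
    exact (a₀.mem_orbitSet_iff hω q₀ r h t).1 hq₀

end Orbit

/-! ### Existence of adapted bases, and the base point -/

section Existence

variable {V : Type*} [AddCommGroup V] [Module ℂ V] {ω : BilinForm ℂ V} {E : Submodule ℂ V}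

theorem nonempty_adaptedBasis [FiniteDimensional ℂ V] (hω : ω.IsAlt) (hnd : ω.Nondegenerate)
    (hE : E ≤ ω.orthogonal E) {κ : Type*} [Fintype κ] [DecidableEq κ] {t s l : ℕ}
    (hEk : Module.finrank ℂ E = Fintype.card κ)
    (hV : Module.finrank ℂ V = 2 * Fintype.card κ + (2 * t + 2 * s + 2 * l)) :
    Nonempty (AdaptedBasis ω E κ ((Fin t ⊕ Fin t) ⊕ ((Fin s ⊕ Fin s) ⊕ (Fin l ⊕ Fin l)))
        (blockGram (Fin t) (Fin s) (Fin l))) := by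
  obtain ⟨n, f, hn, hf⟩ := exists_darboux (reducedForm_isAlt hω)
    (reducedForm_nondegenerate (E := E) hω hnd)
  have hperp := finrank_perpQuotient_add hnd hE
  let σ : Fin t ⊕ (Fin s ⊕ Fin l) ≃ Fin n := Fintype.equivOfCardEq (by
    simp only [Fintype.card_sum, Fintype.card_fin]
    omega)
  let f' : (Fin t ⊕ Fin t) ⊕ ((Fin s ⊕ Fin s) ⊕ (Fin l ⊕ Fin l)) → perpQuotient ω E :=
    Sum.elim (f ∘ Sum.map (σ ∘ .inl) (σ ∘ .inl)) <| Sum.elim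
      (f ∘ Sum.map (σ ∘ .inr ∘ .inl) (σ ∘ .inr ∘ .inl))
      (f ∘ Sum.map (σ ∘ .inr ∘ .inr) (σ ∘ .inr ∘ .inr))
  have hf' : ∀ p q, reducedForm ω hω E (f' p) (f' q) =
      blockGram (Fin t) (Fin s) (Fin l) p q := by
    rintro ((p | p) | (p | p) | (p | p)) ((q | q) | (q | q) | (q | q)) <;>
      simp [f', hf, blockGram, darbouxGram, Matrix.one_apply]
  let e : Module.Basis κ ℂ E := (Module.finBasis ℂ E).reindex (Fintype.equivOfCardEq (by
    rw [Fintype.card_fin, hEk]))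
  have heli : LinearIndependent ℂ fun i => (e i : V) :=
    e.linearIndependent.map' E.subtype E.ker_subtype
  obtain ⟨w, hw⟩ := exists_dual_family hnd heli
  choose f₀ hf₀ using fun p => Submodule.Quotient.mk_surjective _ (f' p)
  obtain ⟨a, -⟩ := exists_adaptedBasis_of_lifts hω hE (isUnit_det_blockGram (Fin t) (Fin s) (Fin l))
    (e := fun i => (e i : V)) (by
      have := congrArg (Submodule.map E.subtype) e.span_eq
      rwa [Submodule.map_span, ← Set.range_comp, Submodule.map_subtype_top] at this)
    hw (fun p => (f₀ p).2) (fun p q => by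
      rw [← hf' p q, ← hf₀ p, ← hf₀ q]
      rfl) (by
      simp only [Fintype.card_sum, Fintype.card_fin]
      omega)
  exact ⟨a⟩

variable {ρ α β ζ γ : Type*} [Fintype ρ] [Fintype α] [Fintype β] [Fintype ζ]
  [Fintype γ] [DecidableEq ρ] [DecidableEq α] [DecidableEq β] [DecidableEq ζ] [DecidableEq γ]

omit [Fintype α] [Fintype β] [Fintype ζ] [DecidableEq α] [DecidableEq β] [DecidableEq ζ] in
theorem normalSym_eq : normalSym ρ (α ⊕ (β ⊕ ζ)) = symChart 1 0 := by
  simp [normalSym, symChart]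

omit [Fintype ζ] [DecidableEq ρ] [DecidableEq ζ] [DecidableEq γ] in
theorem normalMix_eq (J : Matrix (α ⊕ γ) (α ⊕ γ) ℂ) : normalMix ρ α β ζ γ =
    rowChart 0 0 (mixChart J 0 0 (Matrix.fromCols 1 0) 0 (baseM α β ζ)) := by
  ext (i | i | i | i) ((j | j) | j | j) <;>
    simp [normalMix, rowChart, mixChart, orthogonalRows, isotropicRows, baseM]

end Existence

/-! ### The orbit and its dimension -/

theorem blockGram_eq_hypGram (t s l : ℕ) : blockGram (Fin t) (Fin s) (Fin l) =
    hypGram (Fin t) (Matrix.fromBlocks (darbouxGram (Fin s)) 0 0 (darbouxGram (Fin l))) :=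
  rfl

theorem card_chartIndex (r s t z l : ℕ) :
    (Fintype.card (ChartIndex (Fin r) (Fin s ⊕ Fin s) (Fin t) (Fin z)
      ((Fin s ⊕ Fin s) ⊕ (Fin l ⊕ Fin l))) : ℚ) =
      r * (r + 1) / 2 + r * (2 * s + (t + z)) + r * (2 * t + 2 * (s + l)) + (2 * s + (t + z)) * t +
        (t + z) * (2 * s) + 2 * s * (2 * (s + l)) + t * (2 * (s + l)) + t * (t + 1) / 2 := by
  simp only [ChartIndex, Fintype.card_sum, Fintype.card_prod, Sym2.card, Fintype.card_fin,
    Nat.cast_add, Nat.cast_mul, Nat.cast_choose_two]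
  push_cast
  ring

/-- The result in terms of the sizes of the groups of basis vectors in the normal form:
`h = 2 s + t`, `k = r + h + z` and `N - k = t + s + l`. -/
theorem exists_orbit_and_varietyDim {V : Type*} [AddCommGroup V] [Module ℂ V]
    [FiniteDimensional ℂ V] {ω : BilinForm ℂ V} (hω : ω.IsAlt) (hnd : ω.Nondegenerate)
    {E : Submodule ℂ V} (hE : E ≤ ω.orthogonal E) {r s t z l : ℕ}
    (hEk : Module.finrank ℂ E = r + 2 * s + t + z)
    (hV : Module.finrank ℂ V = 2 * (r + 2 * s + t + z) + (2 * t + 2 * s + 2 * l)) :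
    (∃ q : tangentQuotient ω E, orbitSet ω hω E r (2 * s + t) t = parabolicOrbit ω E q) ∧
      varietyDim (orbitSet ω hω E r (2 * s + t) t) =
        Fintype.card (ChartIndex (Fin r) (Fin s ⊕ Fin s) (Fin t) (Fin z)
          ((Fin s ⊕ Fin s) ⊕ (Fin l ⊕ Fin l))) := by
  let J : Matrix ((Fin s ⊕ Fin s) ⊕ (Fin l ⊕ Fin l)) ((Fin s ⊕ Fin s) ⊕ (Fin l ⊕ Fin l)) ℂ :=
    Matrix.fromBlocks (darbouxGram (Fin s)) 0 0 (darbouxGram (Fin l))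
  have hJ : J.transpose = -J := by
    simp [J, darbouxGram, Matrix.fromBlocks_transpose, Matrix.fromBlocks_neg]
  let C₀ : Matrix (Fin s ⊕ Fin s) ((Fin s ⊕ Fin s) ⊕ (Fin l ⊕ Fin l)) ℂ := Matrix.fromCols 1 0
  have hC₀ : (C₀ * J * C₀.transpose).det ≠ 0 := by
    have : C₀ * J * C₀.transpose = darbouxGram (Fin s) := by
      simp [C₀, J, Matrix.fromCols_mul_fromBlocks, Matrix.transpose_fromCols,
        Matrix.fromCols_mul_fromRows]
    rw [this]
    exact (isUnit_det_darbouxGram _).ne_zero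
  have hbase := chartPoly_base (ρ := Fin r) (β := Fin t) (ζ := Fin z) hC₀
  have hinv := hasInvariants_chart hJ (1 : Matrix (Fin r) (Fin r) ℂ) 0 0
    (Matrix.transpose_zero : (0 : Matrix (Fin t) (Fin t) ℂ).transpose = 0) 0 C₀ 0
    (baseM (Fin s ⊕ Fin s) (Fin t) (Fin z)) hbase
  have hnormal : ∀ q ∈ orbitSet ω hω E r (2 * s + t) t,
      ∃ a : AdaptedBasis ω E (Fin r ⊕ ((Fin s ⊕ Fin s) ⊕ (Fin t ⊕ Fin z)))
          ((Fin t ⊕ Fin t) ⊕ ((Fin s ⊕ Fin s) ⊕ (Fin l ⊕ Fin l))) (hypGram (Fin t) J),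
        a.symCoord q = symChart 1 0 ∧ a.mixCoord q =
          rowChart 0 0 (mixChart J 0 0 C₀ 0 (baseM (Fin s ⊕ Fin s) (Fin t) (Fin z))) := by
    rintro _ ⟨X, rfl, h1, h2, h3⟩
    rw [← normalSym_eq, ← normalMix_eq J]
    exact exists_normal_form hω hnd hE hEk hV X h1 h2 (by omega)
  obtain ⟨a₀⟩ := nonempty_adaptedBasis (t := t) (s := s) (l := l) hω hnd hE
    (κ := Fin r ⊕ ((Fin s ⊕ Fin s) ⊕ (Fin t ⊕ Fin z)))
    (by simp only [Fintype.card_sum, Fintype.card_fin]; omega)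
    (by simp only [Fintype.card_sum, Fintype.card_fin]; omega)
  rw [blockGram_eq_hypGram] at a₀
  have hcards : Fintype.card (Fin s ⊕ Fin s) + Fintype.card (Fin t) = 2 * s + t := by
    simp only [Fintype.card_sum, Fintype.card_fin]
    omega
  let q₀ : tangentQuotient ω E := a₀.ofCoord hω (symChart 1 0)
    (rowChart 0 0 (mixChart J 0 0 C₀ 0 (baseM (Fin s ⊕ Fin s) (Fin t) (Fin z))))
  have hsym : (symChart (1 : Matrix (Fin r) (Fin r) ℂ)
      (0 : Matrix (Fin r) ((Fin s ⊕ Fin s) ⊕ (Fin t ⊕ Fin z)) ℂ)).transpose = symChart 1 0 := by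
    simp [symChart, Matrix.fromBlocks_transpose]
  have hq₀ : q₀ ∈ orbitSet ω hω E r (2 * s + t) t := by
    rw [a₀.mem_orbitSet_iff hω, a₀.symCoord_ofCoord hω hsym, a₀.mixCoord_ofCoord hω hsym]
    rw [hcards, Fintype.card_fin, Fintype.card_fin] at hinv
    exact hinv
  refine ⟨⟨q₀, orbitSet_eq_parabolicOrbit hω hq₀ a₀ fun q hq => ?_⟩, le_antisymm ?_ ?_⟩
  · obtain ⟨a, h1, h2⟩ := hnormal q hq
    rw [a₀.symCoord_ofCoord hω hsym, a₀.mixCoord_ofCoord hω hsym]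
    exact ⟨a, h1, h2⟩
  · have := varietyDim_orbitSet_le (ω := ω) (E := E) (ρ := Fin r) (α := Fin s ⊕ Fin s) (β := Fin t)
      (ζ := Fin z) hω hJ
    rw [hcards, Fintype.card_fin, Fintype.card_fin] at this
    refine this ⟨q₀, hq₀⟩ fun q hq => ?_
    obtain ⟨a, h1, h2⟩ := hnormal q hq
    refine ⟨a, ?_⟩
    rw [h1, h2]
    exact hbase
  · have := le_varietyDim_orbitSet hω hJ hC₀ a₀
    rw [hcards, Fintype.card_fin, Fintype.card_fin] at this
    exact this

end

theorem mainTheorem8 {V : Type*} [AddCommGroup V] [Module ℂ V] [FiniteDimensional ℂ V]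
    (ω : LinearMap.BilinForm ℂ V) (hω : ω.IsAlt) (hnd : ω.Nondegenerate)
    (N k : ℕ) (hV : Module.finrank ℂ V = 2 * N) (hk : 2 ≤ k) (hkN : k < N)
    (E : Submodule ℂ V) (hE : E ≤ ω.orthogonal E) (hEk : Module.finrank ℂ E = k)
    (r h t : ℕ) (hrh : r + h ≤ k) (hth : t ≤ h) (hparity : t ≡ h [MOD 2])
    (hht : h + t ≤ 2 * (N - k)) :
    (∃ q : tangentQuotient ω E, orbitSet ω hω E r h t = parabolicOrbit ω E q) ∧
    ∃ d : ℕ, varietyDim (orbitSet ω hω E r h t) = d ∧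
      (d : ℚ) = (r : ℚ) * (r + 1) / 2 + (r + h) * (2 * N - k - r) + (t : ℚ) * (t + 1) / 2
        - (h : ℚ) ^ 2 - (t : ℚ) ^ 2 := by
  -- by parity the image of `H` modulo its radical has even dimension
  obtain ⟨s, rfl⟩ : ∃ s, h = 2 * s + t := by
    obtain ⟨s, hs⟩ := (Nat.modEq_iff_dvd' hth).1 hparity
    exact ⟨s, by omega⟩
  obtain ⟨z, rfl⟩ : ∃ z, k = r + 2 * s + t + z := ⟨k - (r + 2 * s + t), by omega⟩
  obtain ⟨l, rfl⟩ : ∃ l, N = r + 2 * s + t + z + (t + s + l) :=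
    ⟨N - (r + 2 * s + t + z) - (t + s), by omega⟩
  obtain ⟨h1, h2⟩ := exists_orbit_and_varietyDim hω hnd hE (l := l) hEk (by omega)
  refine ⟨h1, _, h2, ?_⟩
  rw [card_chartIndex]
  push_cast
  ring
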